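/- **Setting.** Let $\mathcal X,\mathcal Y$ be finite alphabets, $W(y|x)$ a discrete memoryless channel, and $g$ a real-valued continuous function on the distributions on $\mathcal X\times\mathcal Y$ (the decoding metric). Let $d$ be a real-valued continuous function on the distributions on $\mathcal X\times\mathcal X$ with $d(P_{XX'})=d(P_{X'X})$, put $d(\boldsymbol x,\boldsymbol x')=d(\hat P_{\boldsymbol x\boldsymbol x'})$ where $\hat P$ denotes the (joint) empirical distribution, and let $\Delta\in\mathbb R$. Let $Q_X$ be a distribution on $\mathcal X$ that is the type of some sequence; $n\to\infty$ always runs through the lengths $n$ for which the type class $\mathcal T_n(Q_X)=\{\boldsymbol x\in\mathcal X^n:\hat P_{\boldsymbol x}=Q_X\}$ is non-empty. Let $R>0$ and let $M=M_n$ satisfy $\frac1n\log M_n\to R$ (natural logarithms). The random Gilbert–Varshamov (RGV) code $\mathcal C_n=(\boldsymbol X_1,\dots,\boldsymbol X_M)$ is drawn sequentially: $\boldsymbol X_i$ is uniform on $\{\boldsymbol x\in\mathcal T_n(Q_X): d(\boldsymbol x,\boldsymbol X_j)>\Delta \text{ for all } j<i\}$. Under the generalized likelihood decoder a code $(\boldsymbol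 x_1,\dots,\boldsymbol x_M)$ has error probability $$P_{\rm e}=\frac1M\sum_{m}\sum_{m'\ne m}\sum_{\boldsymbol y\in\mathcal Y^n}\prod_{i=1}^nW(y_i|x_{m,i})\,\frac{\exp\{n g(\hat P_{\boldsymbol x_{m'}\boldsymbol y})\}}{\sum_{\tilde m}\exp\{n g(\hat P_{\boldsymbol x_{\tilde m}\boldsymbol y})\}} .$$ **Rate condition.** For some $\delta>0$: $R\le I_P(X;X')-2\delta$ for every $n$ and every joint type $P$ of length $n$ with both marginals $Q_X$ and $d(P)\le\Delta$. **Exponents.** With $[t]_+=\max\{t,0\}$ put $$\alpha(R,P_Y)=\max_{P_{X'|Y}:\,P_{X'}=Q_X,\ I(X';Y)\le R}\{g(P_{X'Y})-I(X';Y)\}+R,\qquad \beta(R,P_Y)=\max_{P_{\tilde X|Y}:\,P_{\tilde X}=Q_X}\{g(P_{\tilde XY})+[R-I(\tilde X;Y)]_+\},$$ $$\Gamma(P_{XX'},R)=\min_{P_{Y|XX'}}\bigl\{D(P_{Y|X}\|W|Q_X)+I(X';Y|X)+[\max\{g(P_{XY}),\alpha(R,P_Y)\}-g(P_{X'Y})]_+\bigr\},$$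 $$\Lambda(P_{XX'},R)=\min_{P_{Y|XX'}}\bigl\{D(P_{Y|X}\|W|Q_X)+I(X';Y|X)+\beta(R,P_Y)-g(P_{X'Y})\bigr\}.$$ Let $\mathcal L(R,E_0)$ be the set of distributions $P_{XX'}$ on $\mathcal X\times\mathcal X$ with both marginals $Q_X$, $d(P_{XX'})>\Delta$ and $[2R-I(X;X')]_+\ge\Gamma(P_{XX'},R)+R-E_0$, and let $\mathcal M(R,E_0)$ be the same set with $\Lambda$ in place of $\Gamma$. Put $$E_{\rm lt}^{\rm ub}(R,E_0)=\inf_{P\in\mathcal L(R,E_0)}[I_P(X;X')-2R]_+,\qquad E_{\rm lt}^{\rm lb}(R,E_0)=\inf_{P\in\mathcal M(R,E_0)}[I_P(X;X')-2R]_+,$$ with $\inf\emptyset=+\infty$. For $a_n\ge0$ and $E\in[0,\infty]$, $a_n\mathrel{\dot\le}e^{-nE}$ means $\limsup_n\frac1n\log a_n\le-E$, and $a_n\mathrel{\dot\ge}e^{-nE}$ means $\liminf_n\frac1n\log a_n\ge-E$ (with $\log 0=-\infty$). **Theorem.** Let $E_0\in\mathbb R$ and $p_n=\mathbb P\bigl[-\frac1n\log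 P_{\rm e}(\mathcal C_n)\le E_0\bigr]$. 1. $p_n\mathrel{\dot\le}\exp\{-nE_{\rm lt}^{\rm ub}(R,E)\}$ for every $E>E_0$; and $p_n\mathrel{\dot\le}\exp\{-nE_{\rm lt}^{\rm ub}(R,E_0)\}$ whenever $E_{\rm lt}^{\rm ub}(R,\cdot)$ is right-continuous at $E_0$. 2. $p_n\mathrel{\dot\ge}\exp\{-nE_{\rm lt}^{\rm lb}(R,E)\}$ for every $E<E_0$; and $p_n\mathrel{\dot\ge}\exp\{-nE_{\rm lt}^{\rm lb}(R,E_0)\}$ whenever $E_{\rm lt}^{\rm lb}(R,\cdot)$ is left-continuous at $E_0$. (Both exponents are non-increasing in $E_0$, so the unshifted bounds hold at all but countably many $E_0$.) -/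

import Mathlib

open Filter Topology
open scoped ENNReal

noncomputable section

namespace RGV

variable {A B X Y : Type*} [Fintype A] [Fintype B] [Fintype X] [Fintype Y]

/-! ### Distributions on finite alphabets

A distribution on a finite alphabet `A` is a function `A → ℝ` lying in `stdSimplex ℝ A`. -/

/-- First marginal of a joint distribution. -/
def margFst (P : A × B → ℝ) : A → ℝ := fun a => ∑ b, P (a, b)

/-- Second marginal of a joint distribution. -/
def margSnd (P : A × B → ℝ) : B → ℝ := fun b => ∑ a, P (a, b)

/-- All joint distributions on `A × B` with marginals `p` and `q`. -/
def couplings (p : A → ℝ) (q : B → ℝ) : Set (A × B → ℝ) :=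
  {P | P ∈ stdSimplex ℝ (A × B) ∧ margFst P = p ∧ margSnd P = q}

/-- Mutual information (in nats). A summand with `P (a, b) = 0` vanishes. -/
def mutualInfo (P : A × B → ℝ) : ℝ :=
  ∑ a, ∑ b, P (a, b) * Real.log (P (a, b) / (margFst P a * margSnd P b))

/-! A triple distribution `J` is the joint law of `(X, X', Y)`, coded on `X × X × Y`. -/

/-- The law `P_{XX'}` under `J = P_{XX'Y}`. -/
def lawXX' (J : X × X × Y → ℝ) : X × X → ℝ := fun p => ∑ y, J (p.1, p.2, y)

/-- The law `P_{XY}` under `J = P_{XX'Y}`. -/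
def lawXY (J : X × X × Y → ℝ) : X × Y → ℝ := fun p => ∑ x', J (p.1, x', p.2)

/-- The law `P_{X'Y}` under `J = P_{XX'Y}`. -/
def lawX'Y (J : X × X × Y → ℝ) : X × Y → ℝ := fun p => ∑ x, J (x, p.1, p.2)

/-- The law `P_Y` under `J = P_{XX'Y}`. -/
def lawY (J : X × X × Y → ℝ) : Y → ℝ := margSnd (lawXY J)

/-- Conditional mutual information `I(X'; Y | X)` under `J`. -/
def condMutualInfo (J : X × X × Y → ℝ) : ℝ :=
  ∑ x, ∑ x', ∑ y, J (x, x', y) *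
    Real.log (J (x, x', y) * margFst (lawXY J) x / (lawXX' J (x, x') * lawXY J (x, y)))

open scoped Classical in
/-- Conditional divergence `D(P_{Y|X} ‖ W | P_X)` for the joint law `P = P_{XY}`; it is `⊤`
when `P` charges a pair `(x, y)` with `W x y = 0`. -/
def condDiv (W : X → Y → ℝ) (P : X × Y → ℝ) : EReal :=
  if ∃ x y, P (x, y) ≠ 0 ∧ W x y = 0 then ⊤
  else ((∑ x, ∑ y, P (x, y) * Real.log (P (x, y) / (margFst P x * W x y)) : ℝ) : EReal)

/-! ### Types -/

open scoped Classical in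
/-- Empirical distribution (type) of a sequence. -/
def empirical {n : ℕ} (x : Fin n → A) : A → ℝ :=
  fun a => ((Finset.univ.filter fun i => x i = a).card : ℝ) / n

/-- Joint empirical distribution of two sequences. -/
def jointEmpirical {n : ℕ} (x : Fin n → A) (y : Fin n → B) : A × B → ℝ :=
  empirical fun i => (x i, y i)

/-- The type class of `Q` at length `n`. -/
def typeClass (Q : X → ℝ) (n : ℕ) : Set (Fin n → X) := {x | empirical x = Q}

/-- The joint types of length `n` both of whose marginals are `Q`. -/
def jointTypes (Q : X → ℝ) (n : ℕ) : Set (X × X → ℝ) :=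
  {P | (∃ x x' : Fin n → X, jointEmpirical x x' = P) ∧ margFst P = Q ∧ margSnd P = Q}

/-- `n → ∞` along the block lengths `n` for which `Q` is a type of sequences of length `n`. -/
def blockLengths (Q : X → ℝ) : Filter ℕ := atTop ⊓ 𝓟 {n | (typeClass Q n).Nonempty}

/-! ### The random Gilbert-Varshamov ensemble -/

/-- A code with `M` (ordered, possibly repeated) codewords of length `n`. -/
abbrev Code (X : Type*) (M n : ℕ) := Fin M → Fin n → X

open scoped Classical in
/-- The sequences from which codeword number `i` may be drawn, given the codewords of smaller
index: members of the type class at distance more than `Δ` from each of those codewords. -/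
def admissible (Q : X → ℝ) (d : (X × X → ℝ) → ℝ) (Δ : ℝ) {M n : ℕ} (c : Code X M n)
    (i : Fin M) : Finset (Fin n → X) :=
  Finset.univ.filter fun x => x ∈ typeClass Q n ∧ ∀ j < i, Δ < d (jointEmpirical x (c j))

open scoped Classical in
/-- Probability that the sequential construction produces the code `c`: each codeword is drawn
equiprobably from the sequences admissible given the previous ones. -/
def codeProb (Q : X → ℝ) (d : (X × X → ℝ) → ℝ) (Δ : ℝ) {M n : ℕ} (c : Code X M n) : ℝ≥0∞ :=
  ∏ i, if c i ∈ admissible Q d Δ c i then ((admissible Q d Δ c i).card : ℝ≥0∞)⁻¹ else 0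

open scoped Classical in
/-- Probability of a set of codes under the random Gilbert-Varshamov ensemble. -/
def ensembleProb (Q : X → ℝ) (d : (X × X → ℝ) → ℝ) (Δ : ℝ) {M n : ℕ}
    (S : Set (Code X M n)) : ℝ≥0∞ :=
  ∑ c, if c ∈ S then codeProb Q d Δ c else 0

/-! ### The generalized likelihood decoder -/

open scoped Classical in
/-- Average error probability of the code `c` over the memoryless channel `W`, under the
generalized likelihood decoder with metric `g`. -/
def errorProb (W : X → Y → ℝ) (g : (X × Y → ℝ) → ℝ) {M n : ℕ} (c : Code X M n) : ℝ :=
  (1 / (M : ℝ)) * ∑ m, ∑ m' ∈ Finset.univ.erase m, ∑ y : Fin n → Y,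
    (∏ i, W (c m i) (y i)) *
      (Real.exp (n * g (jointEmpirical (c m') y)) /
        ∑ k, Real.exp (n * g (jointEmpirical (c k) y)))

/-- The error exponent `-(1/n) log P_e` of a code. (`P_e > 0` as soon as `M ≥ 2`.) -/
def errorExponent (W : X → Y → ℝ) (g : (X × Y → ℝ) → ℝ) {M n : ℕ} (c : Code X M n) : ℝ :=
  -(1 / (n : ℝ)) * Real.log (errorProb W g c)

/-- Probability, in the ensemble with `M` codewords of length `n`, that the error exponent is at
most `E₀`. -/
def lowerTail (W : X → Y → ℝ) (g : (X × Y → ℝ) → ℝ) (Q : X → ℝ) (d : (X × X → ℝ) → ℝ)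
    (Δ E₀ : ℝ) (M n : ℕ) : ℝ≥0∞ :=
  ensembleProb Q d Δ {c : Code X M n | errorExponent W g c ≤ E₀}

/-! ### The exponent functions -/

/-- `α(R, P_Y)`: the maximum of `g(P_{X'Y}) - I(X';Y)` over couplings with `I(X';Y) ≤ R`,
plus `R`. -/
def alpha (g : (X × Y → ℝ) → ℝ) (Q : X → ℝ) (R : ℝ) (PY : Y → ℝ) : ℝ :=
  sSup ((fun P => g P - mutualInfo P) '' {P | P ∈ couplings Q PY ∧ mutualInfo P ≤ R}) + R

/-- `β(R, P_Y)`: the maximum of `g(P_{X'Y}) + [R - I(X';Y)]_+` over couplings. -/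
def beta (g : (X × Y → ℝ) → ℝ) (Q : X → ℝ) (R : ℝ) (PY : Y → ℝ) : ℝ :=
  sSup ((fun P => g P + max (R - mutualInfo P) 0) '' couplings Q PY)

/-- The joint laws of `(X, X', Y)` that extend a given `P = P_{XX'}`; minimizing over
`P_{Y|XX'}` is minimizing over them. -/
def extensions (Y : Type*) [Fintype Y] (P : X × X → ℝ) : Set (X × X × Y → ℝ) :=
  {J | J ∈ stdSimplex ℝ (X × X × Y) ∧ lawXX' J = P}

/-- The function `Γ(P_{XX'}, R)`. -/
def Gam (W : X → Y → ℝ) (g : (X × Y → ℝ) → ℝ) (Q : X → ℝ) (P : X × X → ℝ) (R : ℝ) : EReal :=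
  ⨅ J ∈ extensions Y P, condDiv W (lawXY J) +
    ((condMutualInfo J +
      max (max (g (lawXY J)) (alpha g Q R (lawY J)) - g (lawX'Y J)) 0 : ℝ) : EReal)

/-- The function `Λ(P_{XX'}, R)`. -/
def Lam (W : X → Y → ℝ) (g : (X × Y → ℝ) → ℝ) (Q : X → ℝ) (P : X × X → ℝ) (R : ℝ) : EReal :=
  ⨅ J ∈ extensions Y P, condDiv W (lawXY J) +
    ((condMutualInfo J + beta g Q R (lawY J) - g (lawX'Y J) : ℝ) : EReal)

/-- The set `ℒ(R, E₀)`. -/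
def setL (W : X → Y → ℝ) (g : (X × Y → ℝ) → ℝ) (Q : X → ℝ) (d : (X × X → ℝ) → ℝ)
    (Δ R E₀ : ℝ) : Set (X × X → ℝ) :=
  {P | P ∈ couplings Q Q ∧ Δ < d P ∧
    Gam W g Q P R + ((R - E₀ : ℝ) : EReal) ≤ ((max (2 * R - mutualInfo P) 0 : ℝ) : EReal)}

/-- The set `ℳ(R, E₀)`. -/
def setM (W : X → Y → ℝ) (g : (X × Y → ℝ) → ℝ) (Q : X → ℝ) (d : (X × X → ℝ) → ℝ)
    (Δ R E₀ : ℝ) : Set (X × X → ℝ) :=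
  {P | P ∈ couplings Q Q ∧ Δ < d P ∧
    Lam W g Q P R + ((R - E₀ : ℝ) : EReal) ≤ ((max (2 * R - mutualInfo P) 0 : ℝ) : EReal)}

/-- The exponent `E_lt^ub(R, E₀)`; it is `⊤` when `ℒ(R, E₀)` is empty. -/
def Eub (W : X → Y → ℝ) (g : (X × Y → ℝ) → ℝ) (Q : X → ℝ) (d : (X × X → ℝ) → ℝ)
    (Δ R E₀ : ℝ) : EReal :=
  ⨅ P ∈ setL W g Q d Δ R E₀, ((max (mutualInfo P - 2 * R) 0 : ℝ) : EReal)

/-- The exponent `E_lt^lb(R, E₀)`; it is `⊤` when `ℳ(R, E₀)` is empty. -/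
def Elb (W : X → Y → ℝ) (g : (X × Y → ℝ) → ℝ) (Q : X → ℝ) (d : (X × X → ℝ) → ℝ)
    (Δ R E₀ : ℝ) : EReal :=
  ⨅ P ∈ setM W g Q d Δ R E₀, ((max (mutualInfo P - 2 * R) 0 : ℝ) : EReal)

/-! ### Exponential inequalities -/

/-- `a_n` is exponentially at most `exp (-n E)` along the filter `l`:
`limsup (1/n) log a_n ≤ -E`. For `E = ⊤` this says that `a_n` decays super-exponentially. -/
def ExpLE (l : Filter ℕ) (a : ℕ → ℝ≥0∞) (E : EReal) : Prop :=
  limsup (fun n => ENNReal.log (a n) / (n : EReal)) l ≤ -E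

/-- `a_n` is exponentially at least `exp (-n E)` along the filter `l`:
`liminf (1/n) log a_n ≥ -E`. For `E = ⊤` this holds trivially. -/
def ExpGE (l : Filter ℕ) (a : ℕ → ℝ≥0∞) (E : EReal) : Prop :=
  -E ≤ liminf (fun n => ENNReal.log (a n) / (n : EReal)) l

end RGV

end

noncomputable section

namespace RGV

open scoped Classical

set_option linter.unusedSectionVars false

/-! ### Sequentially built tuples -/

section Sequential

variable {S : Type*} {M : ℕ}

-- Let I be the mutual information of a joint type P of two codewords. About e^{n(2R-I)} pairs of
-- codewords are expected to have type P. If I > 2R, such a pair appears at all only with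
-- probability about e^{-n(I-2R)}; in every case more than e^{n([2R-I]_+ + small)} such pairs occur
-- only with super-exponentially small probability.
--
-- Off another event of super-exponentially small probability, the decoder's denominator at y is
-- exponentially at least e^{n alpha} and at most e^{n beta}, because every shell of sequences with
-- a given joint type with y holds close to the expected number of codewords, e^{n(R-I(X';Y))} when
-- this is large. By the method of types a pair of type P then contributes at most e^{-n Gamma} and
-- at least e^{-n Lambda} to M times the error probability. Hence the error probability can reach
-- e^{-nE_0} only if some pair has [2R-I]_+ - Gamma - R >= -E_0 to first order, that is, a type in
-- the set L; and about e^{n[2R-I]_+} pairs of one type in the set M are enough for it. Such types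
-- occur with probability about e^{-n[I-2R]_+}, and since there are only polynomially many types,
-- the best one decides.
--
-- The codewords are dependent, and this is where the rate condition enters. It says that a codeword
-- forbids at most a fraction e^{-n(R+delta)} of the type class, so all codewords together forbid a
-- negligible part (`eventually_sparse`). The conditional law of each codeword therefore has density
-- at most 2 relative to the uniform law, and expectations of products of functions revealed one
-- codeword at a time are bounded by summing out the last coordinate
-- (`sum_prod_le_prod_of_adapted`). This yields the Chernoff bounds `prob_sum_ge_le` and
-- `prob_pairCount_ge_le` and the second moment of the pair counts.
--
-- Bounds from below need more care, since a small set could be forbidden completely.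
-- `prob_countIn_lt_le` controls how much of a set has been forbidden, and `prob_pair_ge` compares
-- the ensemble with one in which two codewords are prescribed. First and second moments are
-- combined by the Paley-Zygmund inequality in `prob_pairCount_ge_ge`.
--
-- Rounding and counting of types cost arbitrarily small amounts in the exponent, which the gap
-- between E and E_0 absorbs. One-sided continuity of the exponent then removes the gap.

/-- A function of a tuple that only depends on the coordinates up to `i`. -/
def AdaptedTo {β : Type*} (i : Fin M) (f : (Fin M → S) → β) : Prop :=
  ∀ c c', (∀ j ≤ i, c j = c' j) → f c = f c'

variable [Fintype S]

theorem sum_snoc (f : (Fin (M + 1) → S) → ℝ) :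
    ∑ c, f c = ∑ c : Fin M → S, ∑ z, f (Fin.snoc c z : Fin (M + 1) → S) := by
  rw [← (Fin.snocEquiv fun _ => S).sum_comp, Fintype.sum_prod_type_right]
  rfl

theorem adaptedTo_snoc {k : Fin (M + 1) → (Fin (M + 1) → S) → ℝ}
    (hk : ∀ i, AdaptedTo i (k i)) (c : Fin M → S) (z z₀ : S) (i : Fin M) :
    k i.castSucc (Fin.snoc c z : Fin (M + 1) → S) = k i.castSucc (Fin.snoc c z₀ : Fin (M + 1) → S) := by
  apply hk
  intro j hj
  have hlt : j.val < M := lt_of_le_of_lt (Fin.le_def.mp hj) i.isLt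
  obtain ⟨j', rfl⟩ : ∃ j' : Fin M, j'.castSucc = j := ⟨⟨j, hlt⟩, rfl⟩
  simp

/-- Only the last factor sees the last coordinate, so that coordinate can be summed out first. The
value `z₀` is a placeholder: it lets prefixes be written as full tuples, so that conditional sums
take the form of updates. -/
theorem sum_prod_snoc {k : Fin (M + 1) → (Fin (M + 1) → S) → ℝ}
    (hk : ∀ i, AdaptedTo i (k i)) (z₀ : S) :
    ∑ c, ∏ i, k i c = ∑ c : Fin M → S, (∏ i : Fin M, k i.castSucc (Fin.snoc c z₀ : Fin (M + 1) → S)) *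
      ∑ z, k (Fin.last M) (Function.update (Fin.snoc c z₀ : Fin (M + 1) → S) (Fin.last M) z) := by
  rw [sum_snoc]
  refine Finset.sum_congr rfl fun c _ => ?_
  rw [Finset.mul_sum]
  refine Finset.sum_congr rfl fun z _ => ?_
  rw [Fin.prod_univ_castSucc, Fin.update_snoc_last]
  congr 1
  exact Finset.prod_congr rfl fun i _ => adaptedTo_snoc hk c z z₀ i

theorem adaptedTo_castSucc {k : Fin (M + 1) → (Fin (M + 1) → S) → ℝ}
    (hk : ∀ i, AdaptedTo i (k i)) (z₀ : S) (i : Fin M) :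
    AdaptedTo i fun c : Fin M → S => k i.castSucc (Fin.snoc c z₀ : Fin (M + 1) → S) := by
  intro c c' h
  apply hk
  intro j hj
  have hlt : j.val < M := lt_of_le_of_lt (Fin.le_def.mp hj) i.isLt
  obtain ⟨j', rfl⟩ : ∃ j' : Fin M, j'.castSucc = j := ⟨⟨j, hlt⟩, rfl⟩
  simpa using h j' (by simpa using hj)

/-- A product of adapted weights whose successive conditional sums are at most `B i` has total
mass at most `∏ i, B i`. -/
theorem sum_prod_le_prod_of_adapted : ∀ {M : ℕ} (k : Fin M → (Fin M → S) → ℝ) (B : Fin M → ℝ),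
    (∀ i c, 0 ≤ k i c) → (∀ i, AdaptedTo i (k i)) → (∀ i, 0 ≤ B i) →
    (∀ i c, (∀ j < i, k j c ≠ 0) → ∑ z, k i (Function.update c i z) ≤ B i) →
    ∑ c, ∏ i, k i c ≤ ∏ i, B i := by
  intro M
  induction M with
  | zero => intro k B _ _ _ _; simp
  | succ M ih =>
    intro k B h0 hk hB0 hB
    rcases isEmpty_or_nonempty S with hS | ⟨⟨z₀⟩⟩
    -- Over an empty alphabet there are no tuples of positive length, and the left side is zero.
    · simpa using Finset.prod_nonneg fun i _ => hB0 i
    rw [sum_prod_snoc hk z₀, Fin.prod_univ_castSucc]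
    have h1 := ih (fun i c => k i.castSucc (Fin.snoc c z₀ : Fin (M + 1) → S))
      (fun i => B i.castSucc) (fun i c => h0 _ _) (adaptedTo_castSucc hk z₀) (fun i => hB0 _) ?_
    · calc _ ≤ ∑ c : Fin M → S, (∏ i : Fin M, k i.castSucc (Fin.snoc c z₀ : Fin (M + 1) → S)) *
            B (Fin.last M) := by
            refine Finset.sum_le_sum fun c _ => ?_
            -- Prefixes of weight zero contribute nothing, which is why the conditional bound is
            -- assumed only after prefixes of nonzero weight.
            by_cases hz : ∏ i : Fin M, k i.castSucc (Fin.snoc c z₀ : Fin (M + 1) → S) = 0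
            · simp [hz]
            · refine mul_le_mul_of_nonneg_left (hB _ _ fun j hj => ?_)
                (Finset.prod_nonneg fun i _ => h0 _ _)
              obtain ⟨j', rfl⟩ : ∃ j' : Fin M, j'.castSucc = j := ⟨⟨j, hj⟩, rfl⟩
              exact Finset.prod_ne_zero_iff.mp hz j' (Finset.mem_univ _)
        _ ≤ _ := by
            rw [← Finset.sum_mul]
            exact mul_le_mul_of_nonneg_right h1 (hB0 _)
    · intro i c hc
      refine le_trans (le_of_eq ?_) (hB i.castSucc (Fin.snoc c z₀ : Fin (M + 1) → S) fun j hj => ?_)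
      · refine Finset.sum_congr rfl fun z _ => ?_
        rw [Fin.snoc_update]
      · have hlt : j.val < M := lt_trans (Fin.lt_def.mp hj) i.isLt
        obtain ⟨j', rfl⟩ : ∃ j' : Fin M, j'.castSucc = j := ⟨⟨j, hlt⟩, rfl⟩
        exact hc j' (by simpa using hj)

/-- A product of adapted weights whose successive conditional sums are at least `B i` has total
mass at least `∏ i, B i`. -/
theorem prod_le_sum_prod_of_adapted [Nonempty S] : ∀ {M : ℕ} (k : Fin M → (Fin M → S) → ℝ) (B : Fin M → ℝ),
    (∀ i c, 0 ≤ k i c) → (∀ i, AdaptedTo i (k i)) → (∀ i, 0 ≤ B i) →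
    (∀ i c, (∀ j < i, k j c ≠ 0) → B i ≤ ∑ z, k i (Function.update c i z)) →
    ∏ i, B i ≤ ∑ c, ∏ i, k i c := by
  intro M
  induction M with
  | zero => intro k B _ _ _ _; simp
  | succ M ih =>
    intro k B h0 hk hB0 hB
    -- Nonemptiness is indispensable here: over an empty alphabet the conditional bounds are vacuous
    -- and the right side vanishes.
    obtain ⟨z₀⟩ := ‹Nonempty S›
    rw [sum_prod_snoc hk z₀, Fin.prod_univ_castSucc]
    have h1 := ih (fun i c => k i.castSucc (Fin.snoc c z₀ : Fin (M + 1) → S))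
      (fun i => B i.castSucc) (fun i c => h0 _ _) (adaptedTo_castSucc hk z₀) (fun i => hB0 _) ?_
    · calc _ ≤ ∑ c : Fin M → S, (∏ i : Fin M, k i.castSucc (Fin.snoc c z₀ : Fin (M + 1) → S)) *
            B (Fin.last M) := by
            rw [← Finset.sum_mul]
            exact mul_le_mul_of_nonneg_right h1 (hB0 _)
        _ ≤ _ := by
            refine Finset.sum_le_sum fun c _ => ?_
            by_cases hz : ∏ i : Fin M, k i.castSucc (Fin.snoc c z₀ : Fin (M + 1) → S) = 0
            · simp [hz]
            · refine mul_le_mul_of_nonneg_left (hB _ _ fun j hj => ?_)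
                (Finset.prod_nonneg fun i _ => h0 _ _)
              obtain ⟨j', rfl⟩ : ∃ j' : Fin M, j'.castSucc = j := ⟨⟨j, hj⟩, rfl⟩
              exact Finset.prod_ne_zero_iff.mp hz j' (Finset.mem_univ _)
    · intro i c hc
      refine le_trans (hB i.castSucc (Fin.snoc c z₀ : Fin (M + 1) → S) fun j hj => ?_) (le_of_eq ?_)
      · have hlt : j.val < M := lt_trans (Fin.lt_def.mp hj) i.isLt
        obtain ⟨j', rfl⟩ : ∃ j' : Fin M, j'.castSucc = j := ⟨⟨j, hlt⟩, rfl⟩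
        exact hc j' (by simpa using hj)
      · refine Finset.sum_congr rfl fun z _ => ?_
        rw [Fin.snoc_update]

end Sequential


/-! ### An abstract sequential ensemble -/

section Ensemble

variable {S : Type*} [Fintype S] {M : ℕ}

/-- The elements of `T` that are compatible with all entries of `c` before `i`. -/
def avail (T : Finset S) (good : S → S → Prop) (c : Fin M → S) (i : Fin M) : Finset S :=
  T.filter fun z => ∀ j < i, good z (c j)

/-- Conditional probability of the entry `c i` given the previous ones. -/
def stepProb (T : Finset S) (good : S → S → Prop) (i : Fin M) (c : Fin M → S) : ℝ :=
  if c i ∈ avail T good c i then ((avail T good c i).card : ℝ)⁻¹ else 0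

/-- Probability of the tuple `c` when entries are drawn uniformly among the available ones. -/
def tupleProb (T : Finset S) (good : S → S → Prop) (c : Fin M → S) : ℝ :=
  ∏ i, stepProb T good i c

/-- Probability of an event under `tupleProb`. -/
def prob (T : Finset S) (good : S → S → Prop) (p : (Fin M → S) → Prop) : ℝ :=
  ∑ c, if p c then tupleProb T good c else 0

/-- Every element of `T` conflicts with at most a fraction `κ` of `T`, where `16 M κ ≤ 1`. -/
structure Sparse (T : Finset S) (good : S → S → Prop) (M : ℕ) (κ : ℝ) : Prop where
  nonempty : T.Nonempty
  pos : 0 < κ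
  small : M * κ ≤ 1 / 16
  left : ∀ x ∈ T, ((T.filter fun z => ¬ good z x).card : ℝ) ≤ κ * T.card
  right : ∀ x ∈ T, ((T.filter fun z => ¬ good x z).card : ℝ) ≤ κ * T.card

variable {T : Finset S} {good : S → S → Prop} {κ : ℝ}

theorem avail_congr {c c' : Fin M → S} {i : Fin M} (h : ∀ j < i, c j = c' j) :
    avail T good c i = avail T good c' i := by
  unfold avail
  refine Finset.filter_congr fun z _ => forall₂_congr fun j hj => ?_
  rw [h j hj]

theorem avail_update (c : Fin M → S) (i : Fin M) (z : S) :
    avail T good (Function.update c i z) i = avail T good c i :=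
  avail_congr fun j hj => by simp [hj.ne]

theorem avail_subset (c : Fin M → S) (i : Fin M) : avail T good c i ⊆ T :=
  Finset.filter_subset _ _

theorem stepProb_nonneg (i : Fin M) (c : Fin M → S) : 0 ≤ stepProb T good i c := by
  unfold stepProb
  split_ifs <;> positivity

theorem tupleProb_nonneg (c : Fin M → S) : 0 ≤ tupleProb T good c :=
  Finset.prod_nonneg fun i _ => stepProb_nonneg i c

theorem stepProb_adapted (i : Fin M) : AdaptedTo i (stepProb (S := S) T good i) := by
  intro c c' h
  have h1 : avail T good c i = avail T good c' i := avail_congr fun j hj => h j hj.le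
  unfold stepProb
  rw [h1, h i le_rfl]

theorem mem_of_stepProb_ne_zero {i : Fin M} {c : Fin M → S} (h : stepProb T good i c ≠ 0) :
    c i ∈ avail T good c i := by
  unfold stepProb at h
  by_contra h'
  simp [h'] at h

theorem sum_stepProb_mul (c : Fin M → S) (i : Fin M) (h : (Fin M → S) → ℝ) :
    ∑ z, stepProb T good i (Function.update c i z) * h (Function.update c i z) =
      ((avail T good c i).card : ℝ)⁻¹ * ∑ z ∈ avail T good c i, h (Function.update c i z) := by
  unfold stepProb
  simp only [avail_update, Function.update_self, ite_mul, zero_mul]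
  rw [Finset.mul_sum, ← Finset.sum_filter]
  simp

/-- Fewer than `M` earlier entries exclude at most a fraction κ of `T` each, and `M * κ ≤ 1 / 16`.
The cruder half is all that is needed; it is the source of the factors 2 in the comparisons with
uniform drawing. -/
theorem card_avail_ge (hs : Sparse T good M κ) {c : Fin M → S} {i : Fin M}
    (hc : ∀ j < i, c j ∈ T) : (T.card : ℝ) / 2 ≤ (avail T good c i).card := by
  have h1 : T ⊆ avail T good c i ∪
      (Finset.univ.filter (· < i)).biUnion fun j => T.filter fun z => ¬ good z (c j) := by
    intro z hz
    by_cases h : ∀ j < i, good z (c j)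
    · exact Finset.mem_union_left _ (Finset.mem_filter.mpr ⟨hz, h⟩)
    · push Not at h
      obtain ⟨j, hj, hb⟩ := h
      exact Finset.mem_union_right _ (Finset.mem_biUnion.mpr
        ⟨j, by simpa using hj, Finset.mem_filter.mpr ⟨hz, hb⟩⟩)
  have h2 : (T.card : ℝ) ≤ (avail T good c i).card + M * (κ * T.card) := by
    have h3 : (T.card : ℝ) ≤ (avail T good c i).card +
        ∑ j ∈ Finset.univ.filter (· < i), ((T.filter fun z => ¬ good z (c j)).card : ℝ) := by
      exact_mod_cast (Finset.card_le_card h1).trans ((Finset.card_union_le _ _).trans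
        (Nat.add_le_add_left Finset.card_biUnion_le _))
    refine h3.trans (add_le_add_right ?_ _)
    calc _ ≤ ∑ j ∈ Finset.univ.filter (· < i), κ * T.card :=
          Finset.sum_le_sum fun j hj => hs.left _ (hc j (by simpa using hj))
      _ ≤ ∑ j : Fin M, κ * T.card :=
          Finset.sum_le_sum_of_subset_of_nonneg (Finset.subset_univ _) fun _ _ _ =>
            mul_nonneg hs.pos.le (Nat.cast_nonneg _)
      _ = _ := by simp
  have h4 : M * (κ * T.card) ≤ 1 / 16 * T.card := by
    rw [← mul_assoc]
    exact mul_le_mul_of_nonneg_right hs.small (Nat.cast_nonneg _)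
  have h5 : (0 : ℝ) ≤ T.card := Nat.cast_nonneg _
  linarith

theorem card_avail_pos (hs : Sparse T good M κ) {c : Fin M → S} {i : Fin M}
    (hc : ∀ j < i, c j ∈ T) : (0 : ℝ) < (avail T good c i).card := by
  refine lt_of_lt_of_le ?_ (card_avail_ge hs hc)
  have : (0 : ℝ) < T.card := by exact_mod_cast hs.nonempty.card_pos
  linarith

/-- Expectation bound for a product of adapted factors with controlled conditional means. -/
theorem sum_tupleProb_mul_prod_le (hs : Sparse T good M κ) (h : Fin M → (Fin M → S) → ℝ)
    (B : Fin M → ℝ) (h0 : ∀ i c, 0 ≤ h i c) (hh : ∀ i, AdaptedTo i (h i)) (hB0 : ∀ i, 0 ≤ B i)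
    (hB : ∀ i c, (∀ j < i, c j ∈ T) →
      ∑ z ∈ avail T good c i, h i (Function.update c i z) ≤ B i * (avail T good c i).card) :
    ∑ c, tupleProb T good c * ∏ i, h i c ≤ ∏ i, B i := by
  unfold tupleProb
  simp only [← Finset.prod_mul_distrib]
  refine sum_prod_le_prod_of_adapted _ B (fun i c => mul_nonneg (stepProb_nonneg i c) (h0 i c))
    (fun i c c' hc => ?_) hB0 fun i c hc => ?_
  · rw [stepProb_adapted i c c' hc, hh i c c' hc]
  · have hT : ∀ j < i, c j ∈ T := fun j hj =>
      avail_subset _ _ (mem_of_stepProb_ne_zero (left_ne_zero_of_mul (hc j hj)))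
    rw [sum_stepProb_mul, inv_mul_le_iff₀ (card_avail_pos hs hT), mul_comm]
    exact hB i c hT

/-- Expectation bound for a product of adapted factors over a set of indices, in terms of the
averages over `T`. -/
theorem sum_tupleProb_mul_prod_subset_le (hs : Sparse T good M κ) (I : Finset (Fin M))
    (f : Fin M → (Fin M → S) → ℝ) (q : Fin M → ℝ) (f0 : ∀ i c, 0 ≤ f i c)
    (hf : ∀ i ∈ I, AdaptedTo i (f i)) (hq0 : ∀ i, 0 ≤ q i)
    (hq : ∀ i ∈ I, ∀ c : Fin M → S, (∀ j < i, c j ∈ T) →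
      ∑ z ∈ T, f i (Function.update c i z) ≤ q i * T.card) :
    ∑ c, tupleProb T good c * ∏ i ∈ I, f i c ≤ ∏ i ∈ I, (2 * q i) := by
  have key := sum_tupleProb_mul_prod_le hs (fun i c => if i ∈ I then f i c else 1)
    (fun i => if i ∈ I then 2 * q i else 1) ?_ ?_ ?_ ?_
  · simpa [Finset.prod_ite_mem] using key
  · intro i c
    split_ifs
    exacts [f0 i c, zero_le_one]
  · intro i c c' h
    split_ifs with hi
    exacts [hf i hi c c' h, rfl]
  · intro i
    split_ifs
    exacts [mul_nonneg zero_le_two (hq0 i), zero_le_one]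
  · intro i c hc
    split_ifs with hi
    -- An average over the available elements is at most twice the average over `T`, as `f` is
    -- nonnegative and at least half of `T` is available.
    · calc _ ≤ ∑ z ∈ T, f i (Function.update c i z) :=
            Finset.sum_le_sum_of_subset_of_nonneg (avail_subset _ _) fun _ _ _ => f0 _ _
        _ ≤ q i * T.card := hq i hi c hc
        _ = 2 * q i * (T.card / 2) := by ring
        _ ≤ _ := mul_le_mul_of_nonneg_left (card_avail_ge hs hc) (mul_nonneg zero_le_two (hq0 i))
    · simp

theorem sum_tupleProb_le_one (hs : Sparse T good M κ) : ∑ c : Fin M → S, tupleProb T good c ≤ 1 := by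
  simpa using sum_tupleProb_mul_prod_subset_le (M := M) hs ∅ (fun _ _ => 0) (fun _ => 0)
    (by simp) (by simp) (by simp) (by simp)

theorem mem_of_tupleProb_ne_zero {c : Fin M → S} (h : tupleProb T good c ≠ 0) (i : Fin M) :
    c i ∈ avail T good c i :=
  mem_of_stepProb_ne_zero (Finset.prod_ne_zero_iff.mp h i (Finset.mem_univ i))

/-- The implication is needed only for tuples of positive probability. This is how membership in `T`
and the pairwise constraints become available inside probability estimates. -/
theorem prob_mono {p p' : (Fin M → S) → Prop}
    (h : ∀ c, (∀ i, c i ∈ avail T good c i) → p c → p' c) :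
    prob T good p ≤ prob T good p' := by
  refine Finset.sum_le_sum fun c _ => ?_
  by_cases hc : tupleProb T good c = 0
  · simp [hc]
  · have := h c (mem_of_tupleProb_ne_zero hc)
    by_cases hp : p c
    · simp [hp, this hp]
    · simp only [hp, if_false]
      split_ifs
      exacts [tupleProb_nonneg c, le_rfl]

theorem prob_or_le (p p' : (Fin M → S) → Prop) :
    prob T good (fun c => p c ∨ p' c) ≤ prob T good p + prob T good p' := by
  unfold prob
  rw [← Finset.sum_add_distrib]
  refine Finset.sum_le_sum fun c _ => ?_
  have := tupleProb_nonneg (T := T) (good := good) c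
  by_cases h1 : p c <;> by_cases h2 : p' c <;> simp [h1, h2, this]

theorem prob_exists_le {ι : Type*} (s : Finset ι) (p : ι → (Fin M → S) → Prop) :
    prob T good (fun c => ∃ a ∈ s, p a c) ≤ ∑ a ∈ s, prob T good (p a) := by
  induction s using Finset.induction_on with
  | empty => simp [prob]
  | insert a s ha ih =>
    rw [Finset.sum_insert ha]
    refine le_trans (prob_mono fun c _ h => ?_) ((prob_or_le (p a) _).trans (add_le_add_right ih _))
    simpa using h

/-- Markov's inequality. -/
theorem prob_le_of_sum_le {p : (Fin M → S) → Prop} {h : (Fin M → S) → ℝ} {a b : ℝ}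
    (ha : 0 < a) (h0 : ∀ c, 0 ≤ h c) (hp : ∀ c, p c → a ≤ h c)
    (hb : ∑ c, tupleProb T good c * h c ≤ b) : prob T good p ≤ b / a := by
  rw [le_div_iff₀ ha]
  refine le_trans ?_ hb
  unfold prob
  rw [Finset.sum_mul]
  refine Finset.sum_le_sum fun c _ => ?_
  split_ifs with hc
  · exact mul_le_mul_of_nonneg_left (hp c hc) (tupleProb_nonneg c)
  · simpa using mul_nonneg (tupleProb_nonneg c) (h0 c)

/-- Chernoff bound for sums of adapted functions with values in `[0, 1]`. -/
theorem prob_sum_ge_le (hs : Sparse T good M κ) (f : Fin M → (Fin M → S) → ℝ) {q : ℝ} (t : ℝ)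
    (f0 : ∀ i c, 0 ≤ f i c) (f1 : ∀ i c, f i c ≤ 1) (hf : ∀ i, AdaptedTo i (f i)) (hq0 : 0 ≤ q)
    (hq : ∀ i, ∀ c : Fin M → S, (∀ j < i, c j ∈ T) →
      ∑ z ∈ T, f i (Function.update c i z) ≤ q * T.card) :
    prob T good (fun c => t ≤ ∑ i, f i c) ≤ Real.exp (4 * q * M - t) := by
  have key := sum_tupleProb_mul_prod_le hs (fun i c => Real.exp (f i c))
    (fun _ => Real.exp (4 * q)) (fun i c => (Real.exp_pos _).le)
    (fun i c c' h => by dsimp only; rw [hf i c c' h]) (fun _ => (Real.exp_pos _).le) ?_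
  · rw [Real.exp_sub]
    refine prob_le_of_sum_le (Real.exp_pos t) (h := fun c => ∏ i, Real.exp (f i c))
      (fun c => Finset.prod_nonneg fun i _ => (Real.exp_pos _).le) (fun c hc => ?_)
      (key.trans (le_of_eq ?_))
    · rw [← Real.exp_sum]
      exact Real.exp_le_exp.mpr hc
    · rw [Finset.prod_const, Finset.card_univ, Fintype.card_fin, ← Real.exp_nat_mul, mul_comm]
  · intro i c hc
    -- Linearizing the exponential on [0, 1] costs one factor 2 and the comparison of `T` with the
    -- available set another, so the conditional exponential moment is at most 1 + 4q.
    have hexp : ∀ u : ℝ, 0 ≤ u → u ≤ 1 → Real.exp u ≤ 1 + 2 * u := by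
      intro u hu0 hu1
      have h1 : |u| ≤ 1 := by rwa [abs_of_nonneg hu0]
      have := (abs_le.mp (Real.abs_exp_sub_one_le h1)).2
      rw [abs_of_nonneg hu0] at this
      linarith
    have hcard := card_avail_ge hs hc
    calc _ ≤ ∑ z ∈ avail T good c i, (1 + 2 * f i (Function.update c i z)) :=
          Finset.sum_le_sum fun z _ => hexp _ (f0 _ _) (f1 _ _)
      _ = (avail T good c i).card + 2 * ∑ z ∈ avail T good c i, f i (Function.update c i z) := by
          rw [Finset.sum_add_distrib, ← Finset.mul_sum]
          simp
      _ ≤ (avail T good c i).card + 2 * ∑ z ∈ T, f i (Function.update c i z) := by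
          gcongr
          exacts [fun _ _ _ => f0 _ _, avail_subset _ _]
      _ ≤ (avail T good c i).card + 2 * (q * T.card) := by
          gcongr
          exact hq i c hc
      _ ≤ (1 + 4 * q) * (avail T good c i).card := by nlinarith
      _ ≤ _ := by
          gcongr
          linarith [Real.add_one_le_exp (4 * q)]

/-- The number of entries of `c` in `A`. -/
def countIn (A : Finset S) (c : Fin M → S) : ℕ := (Finset.univ.filter fun i => c i ∈ A).card

theorem countIn_eq_sum (A : Finset S) (c : Fin M → S) :
    (countIn A c : ℝ) = ∑ i, if c i ∈ A then (1 : ℝ) else 0 := by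
  simp [countIn]

theorem sum_ite_mem_card (A T : Finset S) :
    ∑ z ∈ T, (if z ∈ A then (1 : ℝ) else 0) = ((T ∩ A).card : ℝ) := by
  simp

/-- Upper tail for the number of entries in a set. -/
theorem prob_countIn_ge_le (hs : Sparse T good M κ) (A : Finset S) {q : ℝ} (t : ℝ) (hq0 : 0 ≤ q)
    (hq : ((T ∩ A).card : ℝ) ≤ q * T.card) :
    prob (M := M) T good (fun c => t ≤ countIn A c) ≤ Real.exp (4 * q * M - t) := by
  simp only [countIn_eq_sum]
  refine prob_sum_ge_le hs (fun i c => if c i ∈ A then (1 : ℝ) else 0) t ?_ ?_ ?_ hq0 ?_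
  · intro i c; split_ifs <;> norm_num
  · intro i c; split_ifs <;> norm_num
  · intro i c c' h
    simp only [h i le_rfl]
  · intro i c _
    simp only [Function.update_self]
    rwa [sum_ite_mem_card]

/-- Lower tail for the number of entries in a set. -/
theorem prob_countIn_lt_le (hs : Sparse T good M κ) {A : Finset S} (hA : A ⊆ T) {p : ℝ}
    (hp : 0 < p) (hAp : (A.card : ℝ) = p * T.card) :
    prob (M := M) T good (fun c => (countIn A c : ℝ) < p * M / 8) ≤ 2 * Real.exp (-(p * M / 8)) := by
  have hT : (0 : ℝ) < T.card := by exact_mod_cast hs.nonempty.card_pos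
  -- A step hits `A` with conditional probability at least p/2 as long as at most half of `A` has
  -- been excluded. Excluding more than half would take an atypically large sum of the conflict
  -- counts `w (c j)`, which the Chernoff bound rules out; on the remaining tuples an exponential
  -- moment is used.
  set b : ℝ := κ * T.card with hb
  have hbpos : 0 < b := mul_pos hs.pos hT
  have hκ := hs.pos
  -- the number of elements of `A` that conflict with `x`
  let w : S → ℝ := fun x => ((A.filter fun z => ¬ good z x).card : ℝ)
  have hw0 : ∀ x, 0 ≤ w x := fun x => Nat.cast_nonneg _
  have hwT : ∀ x ∈ T, w x ≤ b := fun x hx =>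
    le_trans (Nat.cast_le.mpr (Finset.card_le_card (Finset.filter_subset_filter _ hA)))
      (hs.left x hx)
  have hwsum : ∑ x ∈ T, w x ≤ A.card * b := by
    -- Double counting of conflicting pairs: the average of `w` over `T` is at most p b, far below
    -- its pointwise bound `b`.
    have : ∑ x ∈ T, w x = ∑ z ∈ A, ((T.filter fun x => ¬ good z x).card : ℝ) := by
      simp only [w, Finset.card_filter, Nat.cast_sum]
      rw [Finset.sum_comm]
    rw [this, ← nsmul_eq_mul]
    exact Finset.sum_le_card_nsmul _ _ _ fun z hz => hs.right z (hA hz)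
  have hM := hs.small
  -- the number of elements of `A` excluded before step `i`
  let F : Fin M → (Fin M → S) → ℝ := fun i c =>
    ((A.filter fun z => ∃ j < i, ¬ good z (c j)).card : ℝ)
  have hF : ∀ i c, F i c ≤ ∑ j, w (c j) := by
    intro i c
    have : (A.filter fun z => ∃ j < i, ¬ good z (c j)) ⊆
        Finset.univ.biUnion fun j => A.filter fun z => ¬ good z (c j) := by
      intro z hz
      simp only [Finset.mem_filter, Finset.mem_biUnion, Finset.mem_univ, true_and] at hz ⊢
      obtain ⟨hzA, j, _, hj⟩ := hz
      exact ⟨j, hzA, hj⟩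
    simp only [F, w]
    exact_mod_cast (Finset.card_le_card this).trans Finset.card_biUnion_le
  -- The threshold is |A|/2 measured in units of `b`. The truncation at 1 is inactive on `T`, but
  -- the Chernoff bound asks for values in [0, 1] on all tuples.
  have h1 : prob (M := M) T good (fun c => p / (2 * κ) ≤ ∑ i, min (w (c i) / b) 1) ≤
      Real.exp (4 * p * M - p / (2 * κ)) := by
    refine prob_sum_ge_le hs (fun i c => min (w (c i) / b) 1) _ ?_ ?_ ?_ hp.le ?_
    · intro i c; exact le_min (div_nonneg (hw0 _) hbpos.le) zero_le_one
    · intro i c; exact min_le_right _ _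
    · intro i c c' h; simp only [h i le_rfl]
    · intro i c _
      simp only [Function.update_self]
      calc _ ≤ ∑ z ∈ T, w z / b := Finset.sum_le_sum fun z _ => min_le_left _ _
        _ ≤ _ := by
          rw [← Finset.sum_div, div_le_iff₀ hbpos, ← hAp]
          exact hwsum
  have h2 : prob (M := M) T good
      (fun c => (countIn A c : ℝ) < p * M / 8 ∧ ∀ i, F i c ≤ A.card / 2) ≤
      Real.exp (-(p / 4) * M) / Real.exp (-(p * M / 8)) := by
    -- The factor drops to zero once more than half of `A` is excluded, so only the good case needs
    -- a conditional estimate. There at least a fraction p/2 of the available elements lies in `A`,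
    -- and since e^{-1} ≤ 1/2 the conditional mean is at most 1 - p/4.
    have key := sum_tupleProb_mul_prod_le hs
      (fun i c => if F i c ≤ A.card / 2 then Real.exp (-(if c i ∈ A then (1 : ℝ) else 0)) else 0)
      (fun _ => Real.exp (-(p / 4))) ?_ ?_ (fun _ => (Real.exp_pos _).le) ?_
    · refine prob_le_of_sum_le (Real.exp_pos _) (h := fun c => ∏ i,
        if F i c ≤ A.card / 2 then Real.exp (-(if c i ∈ A then (1 : ℝ) else 0)) else 0)
        (fun c => Finset.prod_nonneg fun i _ => ?_) (fun c hc => ?_) (key.trans (le_of_eq ?_))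
      · split_ifs <;> positivity
      · have : ∀ i, (if F i c ≤ A.card / 2 then
            Real.exp (-(if c i ∈ A then (1 : ℝ) else 0)) else 0) =
            Real.exp (-(if c i ∈ A then (1 : ℝ) else 0)) := fun i => if_pos (hc.2 i)
        simp only [this]
        rw [← Real.exp_sum, Finset.sum_neg_distrib, ← countIn_eq_sum]
        exact Real.exp_le_exp.mpr (neg_le_neg hc.1.le)
      · rw [Finset.prod_const, Finset.card_univ, Fintype.card_fin, ← Real.exp_nat_mul, mul_comm]
    · intro i c; split_ifs <;> positivity
    · intro i c c' h
      have : F i c = F i c' := by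
        simp only [F]
        congr 2
        refine Finset.filter_congr fun z _ => exists_congr fun j => and_congr_right fun hj => ?_
        rw [h j hj.le]
      simp only [this, h i le_rfl]
    · intro i c hc
      have hFu : ∀ z, F i (Function.update c i z) = F i c := by
        intro z
        simp only [F]
        congr 2
        refine Finset.filter_congr fun z _ => exists_congr fun j => and_congr_right fun hj => ?_
        rw [Function.update_of_ne hj.ne]
      simp only [hFu, Function.update_self]
      by_cases hFc : F i c ≤ A.card / 2
      · simp only [hFc, if_true]
        set V := avail T good c i
        have hVT : (V.card : ℝ) ≤ T.card := by exact_mod_cast Finset.card_le_card (avail_subset _ _)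
        have hVA : (A.card : ℝ) / 2 ≤ (V ∩ A).card := by
          have : A ⊆ (V ∩ A) ∪ A.filter fun z => ∃ j < i, ¬ good z (c j) := by
            intro z hz
            by_cases h : ∀ j < i, good z (c j)
            · exact Finset.mem_union_left _ (Finset.mem_inter.mpr
                ⟨Finset.mem_filter.mpr ⟨hA hz, h⟩, hz⟩)
            · push Not at h
              exact Finset.mem_union_right _ (Finset.mem_filter.mpr ⟨hz, h⟩)
          have h3 : (A.card : ℝ) ≤ (V ∩ A).card + F i c := by
            simp only [F]
            exact_mod_cast (Finset.card_le_card this).trans (Finset.card_union_le _ _)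
          linarith
        have he : Real.exp (-1) ≤ 1 / 2 := by
          have := Real.exp_neg_one_lt_d9
          linarith
        calc ∑ z ∈ V, Real.exp (-(if z ∈ A then (1 : ℝ) else 0))
            ≤ ∑ z ∈ V, (1 - 1 / 2 * (if z ∈ A then (1 : ℝ) else 0)) := by
              refine Finset.sum_le_sum fun z _ => ?_
              split_ifs
              · linarith
              · simp
          _ = V.card - 1 / 2 * (V ∩ A).card := by
              rw [Finset.sum_sub_distrib, ← Finset.mul_sum, sum_ite_mem_card]
              simp
          _ ≤ (1 - p / 4) * V.card := by nlinarith
          _ ≤ _ := by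
              gcongr
              linarith [Real.add_one_le_exp (-(p / 4))]
      · simp only [hFc, if_false]
        simp only [Finset.sum_const_zero]
        positivity
  have h3 : prob (M := M) T good (fun c => (countIn A c : ℝ) < p * M / 8) ≤
      Real.exp (4 * p * M - p / (2 * κ)) + Real.exp (-(p / 4) * M) / Real.exp (-(p * M / 8)) := by
    refine le_trans (prob_mono fun c hc h => ?_) ((prob_or_le _ _).trans (add_le_add h1 h2))
    by_cases hall : ∀ i, F i c ≤ A.card / 2
    · exact Or.inr ⟨h, hall⟩
    · left
      push Not at hall
      obtain ⟨i, hi⟩ := hall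
      have hcT : ∀ j, c j ∈ T := fun j => avail_subset _ _ (hc j)
      have h4 : ∑ j, min (w (c j) / b) 1 = (∑ j, w (c j)) / b := by
        rw [Finset.sum_div]
        refine Finset.sum_congr rfl fun j _ => min_eq_left ?_
        rw [div_le_one hbpos]
        exact hwT _ (hcT j)
      rw [h4, le_div_iff₀ hbpos]
      have h5 : p / (2 * κ) * b = A.card / 2 := by
        rw [hAp, hb]
        field_simp
      linarith [hF i c]
  refine h3.trans ?_
  rw [← Real.exp_sub, two_mul (Real.exp _)]
  -- This is where the constant 1/16 in `Sparse` is used: the deviation p/(2κ) is at least twice the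
  -- term 4pM in the Chernoff exponent.
  have h6 : 8 * (p * M) ≤ p / (2 * κ) := by
    rw [le_div_iff₀ (by positivity)]
    nlinarith
  have h7 : 0 ≤ p * M := by positivity
  exact add_le_add (Real.exp_le_exp.mpr (by linarith)) (Real.exp_le_exp.mpr (by linarith))

end Ensemble


/-! ### Pairs of entries in a given relation -/

section Pairs

variable {S : Type*} [Fintype S] {M : ℕ} {T : Finset S} {good : S → S → Prop} {κ : ℝ}

/-- The number of pairs `i < j` for which `c i` and `c j` are in the relation `r`. -/
def pairCount (r : S → S → Prop) (c : Fin M → S) : ℕ :=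
  (Finset.univ.filter fun p : Fin M × Fin M => p.1 < p.2 ∧ r (c p.1) (c p.2)).card

/-- Indicator of the event that the pair `(c i, c j)` is in the relation `r`. -/
def pairInd (r : S → S → Prop) (i j : Fin M) (c : Fin M → S) : ℝ :=
  if r (c i) (c j) then 1 else 0

theorem pairInd_nonneg (r : S → S → Prop) (i j : Fin M) (c : Fin M → S) :
    0 ≤ pairInd r i j c := by
  unfold pairInd
  split_ifs <;> norm_num

theorem pairInd_adapted (r : S → S → Prop) {i j : Fin M} (hij : i < j) :
    AdaptedTo j (pairInd (M := M) r i j) := by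
  intro c c' h
  unfold pairInd
  rw [h i hij.le, h j le_rfl]

theorem pairCount_eq_sum (r : S → S → Prop) (c : Fin M → S) :
    (pairCount r c : ℝ) =
      ∑ p ∈ Finset.univ.filter (fun p : Fin M × Fin M => p.1 < p.2), pairInd r p.1 p.2 c := by
  simp only [pairCount, pairInd, Finset.sum_ite, Finset.sum_const_zero, add_zero,
    Finset.filter_filter, Finset.sum_const, nsmul_eq_mul, mul_one]

theorem sum_pairInd_update_le {r : S → S → Prop} {q : ℝ}
    (hq : ∀ x ∈ T, ((T.filter fun z => r x z).card : ℝ) ≤ q * T.card) {i j : Fin M}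
    (hij : i < j) {c : Fin M → S} (hc : ∀ j' < j, c j' ∈ T) :
    ∑ z ∈ T, pairInd r i j (Function.update c j z) ≤ q * T.card := by
  refine le_trans (le_of_eq ?_) (hq (c i) (hc i hij))
  simp [pairInd, Function.update_of_ne hij.ne]

theorem sum_tupleProb_mul_pairInd_le (hs : Sparse T good M κ) {r : S → S → Prop} {q : ℝ}
    (hq0 : 0 ≤ q) (hq : ∀ x ∈ T, ((T.filter fun z => r x z).card : ℝ) ≤ q * T.card)
    {i j : Fin M} (hij : i < j) :
    ∑ c, tupleProb T good c * pairInd r i j c ≤ 2 * q := by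
  simpa using sum_tupleProb_mul_prod_subset_le hs {j} (fun _ => pairInd r i j) (fun _ => q)
    (fun _ c => pairInd_nonneg r i j c)
    (fun l hl => by rw [Finset.mem_singleton.mp hl]; exact pairInd_adapted r hij) (fun _ => hq0)
    (fun l hl c hc => by
      rw [Finset.mem_singleton.mp hl] at hc ⊢
      exact sum_pairInd_update_le hq hij hc)

/-- First moment method: the count is an integer, and each of at most M² pairs is in the relation
with probability at most 2q. -/
theorem prob_pairCount_pos_le (hs : Sparse T good M κ) {r : S → S → Prop} {q : ℝ}
    (hq0 : 0 ≤ q) (hq : ∀ x ∈ T, ((T.filter fun z => r x z).card : ℝ) ≤ q * T.card) :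
    prob (M := M) T good (fun c => 0 < pairCount r c) ≤ 2 * q * (M : ℝ) ^ 2 := by
  refine (prob_le_of_sum_le one_pos (h := fun c => (pairCount r c : ℝ))
    (fun c => Nat.cast_nonneg _) (fun c hc => by exact_mod_cast hc)
    (b := 2 * q * (M : ℝ) ^ 2) ?_).trans (by simp)
  simp only [pairCount_eq_sum, Finset.mul_sum]
  rw [Finset.sum_comm]
  calc _ ≤ ∑ p ∈ Finset.univ.filter (fun p : Fin M × Fin M => p.1 < p.2), 2 * q :=
        Finset.sum_le_sum fun p hp =>
          sum_tupleProb_mul_pairInd_le hs hq0 hq (Finset.mem_filter.mp hp).2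
    _ ≤ ∑ p : Fin M × Fin M, 2 * q :=
        Finset.sum_le_sum_of_subset_of_nonneg (Finset.filter_subset _ _) fun _ _ _ => by positivity
    _ = _ := by
        simp
        ring

/-- Upper tail for the number of pairs in a relation. -/
theorem prob_pairCount_ge_le (hs : Sparse T good M κ) {r : S → S → Prop} {q : ℝ}
    (hq0 : 0 ≤ q) (hq : ∀ x ∈ T, ((T.filter fun z => r x z).card : ℝ) ≤ q * T.card)
    (hq' : ∀ z ∈ T, ((T.filter fun x => r x z).card : ℝ) ≤ q * T.card) (t : ℝ) {B : ℝ}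
    (hB : 0 < B) :
    prob (M := M) T good (fun c => t ≤ pairCount r c) ≤
      T.card * Real.exp (4 * q * M - B) + Real.exp ((4 * q * (M : ℝ) ^ 2 - t) / B) := by
  -- `N j` counts the earlier partners of entry `j`, and these numbers add up to the pair count.
  -- Either some element of `T` has at least `B` partners in the tuple, which a union bound over `T`
  -- handles, or every `N j / B` lies in [0, 1] and has conditional mean at most Mq/B given the
  -- past, up to the factor absorbed in the Chernoff bound.
  let N : Fin M → (Fin M → S) → ℝ := fun j c =>
    ∑ i ∈ Finset.univ.filter (· < j), pairInd r i j c
  have hN0 : ∀ j c, 0 ≤ N j c := fun j c => Finset.sum_nonneg fun i _ => pairInd_nonneg r i j c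
  have h1 : prob (M := M) T good
      (fun c => ∃ x ∈ T, B ≤ countIn (T.filter fun z => r z x) c) ≤
      T.card * Real.exp (4 * q * M - B) := by
    refine (prob_exists_le T _).trans ?_
    rw [← nsmul_eq_mul]
    refine Finset.sum_le_card_nsmul _ _ _ fun x hx => prob_countIn_ge_le hs _ _ hq0 ?_
    rw [Finset.inter_eq_right.mpr (Finset.filter_subset _ _)]
    exact hq' x hx
  have h2 : prob (M := M) T good (fun c => t / B ≤ ∑ j, min (N j c / B) 1) ≤
      Real.exp (4 * (M * q / B) * M - t / B) := by
    refine prob_sum_ge_le hs (fun j c => min (N j c / B) 1) _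
      (fun j c => le_min (div_nonneg (hN0 j c) hB.le) zero_le_one) (fun j c => min_le_right _ _)
      (fun j c c' h => ?_) (by positivity) fun j c hc => ?_
    · have : N j c = N j c' := Finset.sum_congr rfl fun i hi =>
        pairInd_adapted r (Finset.mem_filter.mp hi).2 c c' h
      simp only [this]
    · calc _ ≤ ∑ z ∈ T, N j (Function.update c j z) / B :=
            Finset.sum_le_sum fun z _ => min_le_left _ _
        _ = (∑ i ∈ Finset.univ.filter (· < j),
              ∑ z ∈ T, pairInd r i j (Function.update c j z)) / B := by
            rw [← Finset.sum_div, Finset.sum_comm]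
        _ ≤ (∑ i : Fin M, q * T.card) / B := by
            gcongr
            refine (Finset.sum_le_sum fun i hi =>
              sum_pairInd_update_le hq (Finset.mem_filter.mp hi).2 hc).trans ?_
            exact Finset.sum_le_sum_of_subset_of_nonneg (Finset.filter_subset _ _)
              fun _ _ _ => by positivity
        _ = _ := by
            simp
            ring
  refine le_trans (prob_mono fun c hc h => ?_) ((prob_or_le _ _).trans (add_le_add h1
    (h2.trans (le_of_eq ?_))))
  · by_cases hall : ∀ j, N j c ≤ B
    · right
      have h3 : ∑ j, min (N j c / B) 1 = (∑ j, N j c) / B := by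
        rw [Finset.sum_div]
        exact Finset.sum_congr rfl fun j _ => min_eq_left ((div_le_one hB).mpr (hall j))
      have h4 : (pairCount r c : ℝ) = ∑ j, N j c := by
        rw [pairCount_eq_sum, Finset.sum_filter, Fintype.sum_prod_type_right]
        exact Finset.sum_congr rfl fun j _ => (Finset.sum_filter _ _).symm
      rw [h3, ← h4]
      gcongr
    · left
      push Not at hall
      obtain ⟨j, hj⟩ := hall
      refine ⟨c j, avail_subset _ _ (hc j), hj.le.trans ?_⟩
      rw [countIn_eq_sum]
      refine (Finset.sum_le_sum_of_subset_of_nonneg (Finset.filter_subset _ _)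
        fun i _ _ => pairInd_nonneg r i j c).trans (Finset.sum_le_sum fun i _ => ?_)
      have := avail_subset _ _ (hc i)
      simp [pairInd, this]
  · congr 1
    ring

/-- When the later indices differ, each indicator is revealed at its own step and costs a factor 2q
given everything before it, even if the two pairs share another entry. -/
theorem sum_tupleProb_mul_pairInd_mul_of_ne (hs : Sparse T good M κ) {r : S → S → Prop} {q : ℝ}
    (hq0 : 0 ≤ q) (hq : ∀ x ∈ T, ((T.filter fun z => r x z).card : ℝ) ≤ q * T.card)
    {i j k l : Fin M} (hij : i < j) (hkl : k < l) (hjl : j ≠ l) :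
    ∑ c, tupleProb T good c * (pairInd r i j c * pairInd r k l c) ≤ 4 * q ^ 2 := by
  have key := sum_tupleProb_mul_prod_subset_le hs {j, l}
    (fun m => if m = j then pairInd r i j else pairInd r k l) (fun _ => q)
    (fun m c => by split_ifs <;> exact pairInd_nonneg _ _ _ _) (fun m hm => ?_)
    (fun _ => hq0) (fun m hm c hc => ?_)
  · simp only [Finset.prod_pair hjl, if_true, hjl.symm, if_false] at key
    linarith
  · split_ifs with h
    · rw [h]; exact pairInd_adapted r hij
    · obtain rfl : m = l := by simpa [h] using hm
      exact pairInd_adapted r hkl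
  · split_ifs with h
    · rw [h] at hc ⊢; exact sum_pairInd_update_le hq hij hc
    · obtain rfl : m = l := by simpa [h] using hm
      exact sum_pairInd_update_le hq hkl hc

/-- Both indicators are revealed at the same step, so conditioning on the past gives only one factor
q. Instead the value x of the common entry is prescribed: that costs 2/|T|, and for fixed x the two
earlier entries cost 2q each through the transposed sections. Summing over x gives 8q². -/
theorem sum_tupleProb_mul_pairInd_mul_same (hs : Sparse T good M κ) {r : S → S → Prop} {q : ℝ}
    (hq0 : 0 ≤ q) (hq' : ∀ z ∈ T, ((T.filter fun x => r x z).card : ℝ) ≤ q * T.card)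
    {i j k : Fin M} (hij : i < j) (hkj : k < j) (hik : i ≠ k) :
    ∑ c, tupleProb T good c * (pairInd r i j c * pairInd r k j c) ≤ 8 * q ^ 2 := by
  have hT : (0 : ℝ) < T.card := by exact_mod_cast hs.nonempty.card_pos
  let f : S → Fin M → (Fin M → S) → ℝ := fun x m c =>
    if m = j then (if c m = x then 1 else 0) else (if r (c m) x then 1 else 0)
  have h1 : ∀ x ∈ T, ∑ c, tupleProb T good c * ∏ m ∈ {i, k, j}, f x m c ≤
      ∏ m ∈ {i, k, j}, (2 * (if m = j then (T.card : ℝ)⁻¹ else q)) := by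
    intro x hx
    refine sum_tupleProb_mul_prod_subset_le hs _ (f x) _ (fun m c => ?_) (fun m _ c c' h => ?_)
      (fun m => ?_) (fun m _ c hc => ?_)
    · simp only [f]; split_ifs <;> norm_num
    · simp only [f, h m le_rfl]
    · split_ifs
      exacts [by positivity, hq0]
    · simp only [f, Function.update_self]
      split_ifs with hm
      · rw [inv_mul_cancel₀ hT.ne']
        simp [hx]
      · refine le_trans (le_of_eq ?_) (hq' x hx)
        simp
  have hprod : ∀ (u : Fin M → ℝ), ∏ m ∈ {i, k, j}, u m = u i * (u k * u j) := by
    intro u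
    rw [Finset.prod_insert (by simp [hik, hij.ne]), Finset.prod_pair hkj.ne]
  calc _ = ∑ c, tupleProb T good c * ∑ x ∈ T, ∏ m ∈ {i, k, j}, f x m c := by
        refine Finset.sum_congr rfl fun c _ => ?_
        by_cases hc : tupleProb T good c = 0
        · simp [hc]
        · congr 1
          have hcj := avail_subset _ _ (mem_of_tupleProb_ne_zero hc j)
          rw [Finset.sum_eq_single (c j)]
          · simp [hprod, f, pairInd, hij.ne, hkj.ne]
          · intro x _ hx
            simp [hprod, f, hx.symm]
          · exact fun h => absurd hcj h
    _ = ∑ x ∈ T, ∑ c, tupleProb T good c * ∏ m ∈ {i, k, j}, f x m c := by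
        simp only [Finset.mul_sum]
        rw [Finset.sum_comm]
    _ ≤ ∑ x ∈ T, (8 * q ^ 2) / T.card := by
        refine Finset.sum_le_sum fun x hx => (h1 x hx).trans (le_of_eq ?_)
        simp only [hprod, hij.ne, hkj.ne, if_true, if_false]
        field_simp
        ring
    _ = _ := by
        simp
        field_simp

/-- Second moment of the number of pairs in a relation. -/
theorem sum_tupleProb_mul_pairCount_sq_le (hs : Sparse T good M κ) {r : S → S → Prop} {q : ℝ}
    (hq0 : 0 ≤ q) (hq : ∀ x ∈ T, ((T.filter fun z => r x z).card : ℝ) ≤ q * T.card)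
    (hq' : ∀ z ∈ T, ((T.filter fun x => r x z).card : ℝ) ≤ q * T.card) :
    ∑ c : Fin M → S, tupleProb T good c * (pairCount r c : ℝ) ^ 2 ≤
      8 * q ^ 2 * (M : ℝ) ^ 4 + 2 * q * (M : ℝ) ^ 2 := by
  set I := Finset.univ.filter (fun p : Fin M × Fin M => p.1 < p.2)
  have hI : (I.card : ℝ) ≤ (M : ℝ) ^ 2 := by
    have := Finset.card_le_card (Finset.filter_subset (fun p : Fin M × Fin M => p.1 < p.2)
      Finset.univ)
    have h2 : I.card ≤ M ^ 2 := this.trans (by simp [pow_two])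
    exact_mod_cast h2
  calc _ = ∑ p ∈ I, ∑ p' ∈ I,
        ∑ c : Fin M → S, tupleProb T good c * (pairInd r p.1 p.2 c * pairInd r p'.1 p'.2 c) := by
        simp only [pairCount_eq_sum, pow_two]
        simp only [Finset.sum_mul_sum]
        simp only [Finset.mul_sum]
        rw [Finset.sum_comm]
        exact Finset.sum_congr rfl fun p _ => Finset.sum_comm
    -- Off the diagonal both cases of coinciding or different later indices are covered by 8q²; on
    -- the diagonal the square of an indicator is the indicator.
    _ ≤ ∑ p ∈ I, ∑ p' ∈ I, (8 * q ^ 2 + if p = p' then 2 * q else 0) := by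
        refine Finset.sum_le_sum fun p hp => Finset.sum_le_sum fun p' hp' => ?_
        obtain ⟨i, j⟩ := p
        obtain ⟨k, l⟩ := p'
        have hij : i < j := (Finset.mem_filter.mp hp).2
        have hkl : k < l := (Finset.mem_filter.mp hp').2
        by_cases hjl : j = l
        · subst hjl
          by_cases hik : i = k
          · subst hik
            have h1 := sum_tupleProb_mul_pairInd_le hs hq0 hq hij
            have h2 : ∀ c, pairInd r i j c * pairInd r i j c = pairInd r i j c := by
              intro c
              unfold pairInd
              split_ifs <;> norm_num
            simp only [h2, if_true]
            nlinarith
          · simpa [hik] using sum_tupleProb_mul_pairInd_mul_same hs hq0 hq' hij hkl hik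
        · have := sum_tupleProb_mul_pairInd_mul_of_ne hs hq0 hq hij hkl hjl
          simp only [Prod.mk.injEq, hjl, and_false, if_false]
          nlinarith
    _ = 8 * q ^ 2 * (I.card : ℝ) ^ 2 + 2 * q * I.card := by
        simp only [Finset.sum_add_distrib, Finset.sum_const, nsmul_eq_mul, Finset.sum_ite_eq]
        simp
        ring
    _ ≤ _ := by
        have : (I.card : ℝ) ^ 2 ≤ (M : ℝ) ^ 4 := by
          calc _ ≤ ((M : ℝ) ^ 2) ^ 2 := by gcongr
            _ = _ := by ring
        gcongr

/-- A prescribed compatible pair of values at two positions. -/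
theorem prob_pair_ge (hs : Sparse T good M κ) {i j : Fin M} (hij : i < j) {x z : S}
    (hx : x ∈ T) (hz : z ∈ T) (hzx : good z x) :
    3 / 4 / (T.card : ℝ) ^ 2 ≤
      ∑ c : Fin M → S, tupleProb T good c * if c i = x ∧ c j = z then 1 else 0 := by
  have hT : (0 : ℝ) < T.card := by exact_mod_cast hs.nonempty.card_pos
  have : Nonempty S := ⟨x⟩
  -- Change of measure: `k` is the law of the construction with entries `i` and `j` forced to be x
  -- and z without checking availability, all other entries being drawn as before. Its mass is at
  -- least 1. Some other entry conflicts with x or z with `k`-probability at most 4Mκ ≤ 1/4, and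
  -- otherwise the true weight is the `k`-weight times two step probabilities of at least 1/|T|;
  -- this leaves 3/4.
  let k : Fin M → (Fin M → S) → ℝ := fun l c =>
    if l = i then (if c l = x then 1 else 0) else if l = j then (if c l = z then 1 else 0)
      else stepProb T good l c
  have hk0 : ∀ l c, 0 ≤ k l c := by
    intro l c
    simp only [k]
    split_ifs <;> first | exact stepProb_nonneg _ _ | norm_num
  have hkad : ∀ l, AdaptedTo l (k l) := by
    intro l c c' h
    simp only [k, h l le_rfl, stepProb_adapted l c c' h]
  have hkT : ∀ l c, k l c ≠ 0 → c l ∈ T := by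
    intro l c h
    simp only [k] at h
    split_ifs at h with h1 h2 h3 h4
    · rwa [h2]
    · exact absurd rfl h
    · rwa [h4]
    · exact absurd rfl h
    · exact avail_subset _ _ (mem_of_stepProb_ne_zero h)
  have hksum : ∀ l (c : Fin M → S), (∀ j < l, c j ∈ T) →
      ∑ w, k l (Function.update c l w) = 1 := by
    intro l c hc
    simp only [k, Function.update_self]
    split_ifs with h1 h2
    · simp
    · simp
    · have := sum_stepProb_mul (T := T) (good := good) c l fun _ => 1
      simp only [mul_one, Finset.sum_const, nsmul_eq_mul] at this
      rw [this, inv_mul_cancel₀ (card_avail_pos hs hc).ne']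
  have hmass : 1 ≤ ∑ c, ∏ l, k l c := by
    simpa using prod_le_sum_prod_of_adapted k (fun _ => 1) hk0 hkad (fun _ => zero_le_one) fun l c hc =>
      (hksum l c fun j hj => hkT j c (hc j hj)).ge
  -- the event that entry `l` excludes the value `u`
  let bad : S → Fin M → (Fin M → S) → ℝ := fun u l c =>
    if l ≠ i ∧ l ≠ j ∧ ¬ good u (c l) then 1 else 0
  have hbad0 : ∀ u l c, 0 ≤ bad u l c := by
    intro u l c
    simp only [bad]
    split_ifs <;> norm_num
  have hbad : ∀ u ∈ T, ∀ l, ∑ c, (∏ l', k l' c) * bad u l c ≤ 2 * κ := by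
    intro u hu l
    by_cases hl : l ≠ i ∧ l ≠ j
    · have key := sum_prod_le_prod_of_adapted (fun l' c => k l' c * if l' = l then bad u l c else 1)
        (fun l' => if l' = l then 2 * κ else 1) ?_ ?_ ?_ ?_
      · simpa only [Finset.prod_mul_distrib, Finset.prod_ite_eq', Finset.mem_univ, if_true] using key
      · intro l' c
        refine mul_nonneg (hk0 _ _) ?_
        split_ifs
        exacts [hbad0 _ _ _, zero_le_one]
      · intro l' c c' h
        dsimp only
        rw [hkad l' c c' h]
        by_cases hl' : l' = l
        · subst hl'
          simp only [bad, h l' le_rfl]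
        · simp [hl']
      · intro l'
        split_ifs
        exacts [by have := hs.pos; positivity, zero_le_one]
      · intro l' c hc
        have hcT : ∀ j < l', c j ∈ T := fun j hj => hkT j c (left_ne_zero_of_mul (hc j hj))
        by_cases hl' : l' = l
        · subst hl'
          simp only [if_true]
          have hkl : ∀ c, k l' c = stepProb T good l' c := by
            intro c; simp [k, hl.1, hl.2]
          simp only [hkl]
          rw [sum_stepProb_mul, inv_mul_le_iff₀ (card_avail_pos hs hcT)]
          calc _ ≤ ∑ w ∈ T, bad u l' (Function.update c l' w) :=
                Finset.sum_le_sum_of_subset_of_nonneg (avail_subset _ _) fun _ _ _ => hbad0 _ _ _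
            _ = ((T.filter fun w => ¬ good u w).card : ℝ) := by simp [bad, hl.1, hl.2, Finset.card_filter, ite_not]
            _ ≤ κ * T.card := hs.right u hu
            _ = (T.card / 2) * (2 * κ) := by ring
            _ ≤ _ := mul_le_mul_of_nonneg_right (card_avail_ge hs hcT)
              (by have := hs.pos; positivity)
        · simp only [hl', if_false, mul_one]
          exact (hksum l' c hcT).le
    · have : ∀ c, bad u l c = 0 := by
        intro c
        simp only [bad]
        exact if_neg fun h => hl ⟨h.1, h.2.1⟩
      simp only [this, mul_zero, Finset.sum_const_zero]
      linarith [hs.pos]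
  -- Pointwise form of the comparison. If some other entry is bad, the subtracted sum already
  -- exceeds the `k`-weight; if none is, both prescribed values are available when they are drawn.
  have hpt : ∀ c : Fin M → S, (∏ l, k l c) - ∑ l, ((∏ l', k l' c) * bad x l c +
      (∏ l', k l' c) * bad z l c) ≤
      (tupleProb T good c * if c i = x ∧ c j = z then 1 else 0) * (T.card : ℝ) ^ 2 := by
    intro c
    have hR : 0 ≤ (tupleProb T good c * if c i = x ∧ c j = z then (1 : ℝ) else 0) *
        (T.card : ℝ) ^ 2 := by
      have := tupleProb_nonneg (T := T) (good := good) c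
      split_ifs <;> positivity
    by_cases hm : ∏ l, k l c = 0
    · simpa [hm] using hR
    have hkne : ∀ l, k l c ≠ 0 := fun l => Finset.prod_ne_zero_iff.mp hm l (Finset.mem_univ l)
    have hci : c i = x := by
      have := hkne i
      simp only [k, if_true] at this
      by_contra h
      simp [h] at this
    have hcj : c j = z := by
      have := hkne j
      simp only [k, hij.ne', if_true, if_false] at this
      by_contra h
      simp [h] at this
    have hm0 : 0 ≤ ∏ l, k l c := Finset.prod_nonneg fun l _ => hk0 l c
    by_cases hb : ∃ l, 1 ≤ bad x l c + bad z l c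
    · obtain ⟨l, hl⟩ := hb
      refine le_trans ?_ hR
      have : (∏ l, k l c) * 1 ≤ ∑ l, ((∏ l', k l' c) * bad x l c + (∏ l', k l' c) * bad z l c) := by
        refine le_trans ?_ (Finset.single_le_sum (f := fun l =>
          (∏ l', k l' c) * bad x l c + (∏ l', k l' c) * bad z l c) (fun l _ => ?_)
          (Finset.mem_univ l))
        · rw [← mul_add]
          exact mul_le_mul_of_nonneg_left hl hm0
        · exact add_nonneg (mul_nonneg hm0 (hbad0 _ _ _)) (mul_nonneg hm0 (hbad0 _ _ _))
      linarith
    · push Not at hb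
      have hgood : ∀ u, u = x ∨ u = z → ∀ l, l ≠ i → l ≠ j → good u (c l) := by
        intro u hu l hli hlj
        by_contra h
        have h1 : bad u l c = 1 := by simp only [bad]; exact if_pos ⟨hli, hlj, h⟩
        have h2 := hb l
        rcases hu with rfl | rfl
        · linarith [hbad0 z l c]
        · linarith [hbad0 x l c]
      have hstep : ∀ l, c l ∈ avail T good c l → (T.card : ℝ)⁻¹ ≤ stepProb T good l c := by
        intro l hl
        unfold stepProb
        rw [if_pos hl]
        have hp : 0 < (avail T good c l).card := Finset.card_pos.mpr ⟨_, hl⟩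
        have hle := Finset.card_le_card (avail_subset (T := T) (good := good) c l)
        exact inv_anti₀ (by exact_mod_cast hp) (by exact_mod_cast hle)
      have hai : c i ∈ avail T good c i := by
        refine Finset.mem_filter.mpr ⟨hci ▸ hx, fun l hl => ?_⟩
        exact hgood _ (Or.inl hci) l hl.ne (hl.trans hij).ne
      have haj : c j ∈ avail T good c j := by
        refine Finset.mem_filter.mpr ⟨hcj ▸ hz, fun l hl => ?_⟩
        by_cases hli : l = i
        · rw [hli, hci, hcj]; exact hzx
        · exact hgood _ (Or.inr hcj) l hli hl.ne
      have hprod : tupleProb T good c = (∏ l, k l c) * (stepProb T good i c * stepProb T good j c) := by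
        have h1 : ∀ l, stepProb T good l c =
            k l c * if l ∈ ({i, j} : Finset (Fin M)) then stepProb T good l c else 1 := by
          intro l
          by_cases hli : l = i
          · subst hli; simp [k, hci]
          · by_cases hlj : l = j
            · subst hlj; simp [k, hcj, hli]
            · simp [k, hli, hlj]
        unfold tupleProb
        rw [Finset.prod_congr rfl fun l _ => h1 l, Finset.prod_mul_distrib, Finset.prod_ite_mem,
          Finset.univ_inter, Finset.prod_pair hij.ne]
      have hlow : (T.card : ℝ)⁻¹ * (T.card : ℝ)⁻¹ ≤ stepProb T good i c * stepProb T good j c :=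
        mul_le_mul (hstep i hai) (hstep j haj) (by positivity) (stepProb_nonneg _ _)
      have hS : 0 ≤ ∑ l, ((∏ l', k l' c) * bad x l c + (∏ l', k l' c) * bad z l c) :=
        Finset.sum_nonneg fun l _ =>
          add_nonneg (mul_nonneg hm0 (hbad0 _ _ _)) (mul_nonneg hm0 (hbad0 _ _ _))
      rw [if_pos ⟨hci, hcj⟩, mul_one, hprod]
      calc _ ≤ ∏ l, k l c := by linarith
        _ = (∏ l, k l c) * ((T.card : ℝ)⁻¹ * (T.card : ℝ)⁻¹) * (T.card : ℝ) ^ 2 := by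
            field_simp
        _ ≤ _ := by gcongr
  have htot : ∑ c, ∑ l, ((∏ l', k l' c) * bad x l c + (∏ l', k l' c) * bad z l c) ≤ 1 / 4 := by
    rw [Finset.sum_comm]
    calc _ ≤ ∑ _l : Fin M, (2 * κ + 2 * κ) := by
          refine Finset.sum_le_sum fun l _ => ?_
          rw [Finset.sum_add_distrib]
          exact add_le_add (hbad x hx l) (hbad z hz l)
      _ = 4 * (M * κ) := by
          simp
          ring
      _ ≤ _ := by linarith [hs.small]
  rw [div_le_iff₀ (by positivity), Finset.sum_mul]
  refine le_trans ?_ (Finset.sum_le_sum fun c _ => hpt c)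
  rw [Finset.sum_sub_distrib]
  linarith

theorem card_filter_lt (hM : 2 ≤ M) :
    (M : ℝ) ^ 2 / 4 ≤ ((Finset.univ.filter fun p : Fin M × Fin M => p.1 < p.2).card : ℝ) := by
  have h1 : (Finset.univ.filter fun p : Fin M × Fin M => p.1 < p.2).card = ∑ i ∈ Finset.range M, i := by
    rw [Finset.card_filter, Fintype.sum_prod_type_right, ← Fin.sum_univ_eq_sum_range]
    refine Finset.sum_congr rfl fun j _ => ?_
    rw [← Finset.card_filter, ← Fin.card_Iio]
    congr 1
    ext
    simp
  have h2 := Finset.sum_range_id_mul_two M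
  rw [← h1] at h2
  have h3 : ((Finset.univ.filter fun p : Fin M × Fin M => p.1 < p.2).card : ℝ) * 2 = M * (M - 1) := by
    have : ((M - 1 : ℕ) : ℝ) = (M : ℝ) - 1 := by
      rw [Nat.cast_sub (by omega)]
      simp
    rw [← this]
    exact_mod_cast h2
  have h4 : (2 : ℝ) ≤ M := by exact_mod_cast hM
  nlinarith

/-- First moment of the number of pairs in a relation. -/
theorem sum_tupleProb_mul_pairCount_ge (hs : Sparse T good M κ) (hM : 2 ≤ M) {r : S → S → Prop}
    {q : ℝ} (hq0 : 0 ≤ q)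
    (hq : q * (T.card : ℝ) ^ 2 ≤ ((T ×ˢ T).filter fun p => r p.1 p.2).card)
    (hr : ∀ x ∈ T, ∀ z ∈ T, r x z → good z x) :
    q * (M : ℝ) ^ 2 / 8 ≤ ∑ c : Fin M → S, tupleProb T good c * (pairCount r c : ℝ) := by
  have hT : (0 : ℝ) < T.card := by exact_mod_cast hs.nonempty.card_pos
  -- Summing `prob_pair_ge` over the related pairs of values, of which there are at least q|T|²,
  -- cancels the factor |T|^{-2}.
  have h1 : ∀ i j : Fin M, i < j → 3 / 4 * q ≤ ∑ c, tupleProb T good c * pairInd r i j c := by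
    intro i j hij
    calc 3 / 4 * q = (3 / 4 / (T.card : ℝ) ^ 2) * (q * (T.card : ℝ) ^ 2) := by field_simp
      _ ≤ (3 / 4 / (T.card : ℝ) ^ 2) * ((T ×ˢ T).filter fun p => r p.1 p.2).card := by gcongr
      _ = ∑ _p ∈ (T ×ˢ T).filter fun p => r p.1 p.2, 3 / 4 / (T.card : ℝ) ^ 2 := by
          simp [mul_comm]
      _ ≤ ∑ p ∈ (T ×ˢ T).filter fun p => r p.1 p.2,
          ∑ c : Fin M → S, tupleProb T good c * if c i = p.1 ∧ c j = p.2 then 1 else 0 := by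
          refine Finset.sum_le_sum fun p hp => ?_
          obtain ⟨hp1, hp2⟩ := Finset.mem_filter.mp hp
          obtain ⟨ha, hb⟩ := Finset.mem_product.mp hp1
          exact prob_pair_ge hs hij ha hb (hr _ ha _ hb hp2)
      _ = ∑ c : Fin M → S, tupleProb T good c *
          ∑ p ∈ (T ×ˢ T).filter fun p => r p.1 p.2, if c i = p.1 ∧ c j = p.2 then 1 else 0 := by
          rw [Finset.sum_comm]
          simp only [Finset.mul_sum]
      _ ≤ _ := by
          refine Finset.sum_le_sum fun c _ => mul_le_mul_of_nonneg_left ?_ (tupleProb_nonneg c)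
          have h2 : ∀ p : S × S, (if c i = p.1 ∧ c j = p.2 then (1 : ℝ) else 0) =
              if (c i, c j) = p then 1 else 0 := fun p => by
            simp only [Prod.ext_iff]
          simp only [h2, Finset.sum_ite_eq, pairInd]
          split_ifs with h3 h4
          · exact le_rfl
          · exact absurd (Finset.mem_filter.mp h3).2 h4
          · exact zero_le_one
          · exact le_rfl
  simp only [pairCount_eq_sum, Finset.mul_sum]
  rw [Finset.sum_comm]
  have h5 := card_filter_lt hM
  calc q * (M : ℝ) ^ 2 / 8 ≤ (3 / 4 * q) * ((M : ℝ) ^ 2 / 4) := by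
        have : 0 ≤ q * (M : ℝ) ^ 2 := by positivity
        linarith
    _ ≤ (3 / 4 * q) * ((Finset.univ.filter fun p : Fin M × Fin M => p.1 < p.2).card : ℝ) := by
        gcongr
    _ = ∑ _p ∈ Finset.univ.filter (fun p : Fin M × Fin M => p.1 < p.2), 3 / 4 * q := by
        simp [mul_comm]
    _ ≤ _ := Finset.sum_le_sum fun p hp => h1 _ _ (Finset.mem_filter.mp hp).2

/-- The Paley-Zygmund inequality for finite sums. -/
theorem paley_zygmund {ι : Type*} [Fintype ι] {w N : ι → ℝ} (hw : ∀ c, 0 ≤ w c)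
    (hw1 : ∑ c, w c ≤ 1) {μ s : ℝ} (hμ : 0 < μ) (hs : 0 < s)
    (h1 : μ ≤ ∑ c, w c * N c) (h2 : ∑ c, w c * N c ^ 2 ≤ s) :
    μ ^ 2 / (4 * s) ≤ ∑ c, if μ / 2 ≤ N c then w c else 0 := by
  rw [← Finset.sum_filter]
  set A := Finset.univ.filter fun c => μ / 2 ≤ N c
  -- Values below μ/2 carry at most μ/2 of the mean, because the total weight is at most 1;
  -- Cauchy-Schwarz on the rest gives the claim.
  have h3 : μ / 2 ≤ ∑ c ∈ A, w c * N c := by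
    have h4 : ∑ c ∈ Finset.univ.filter (fun c => ¬ μ / 2 ≤ N c), w c * N c ≤ μ / 2 := by
      calc _ ≤ ∑ c ∈ Finset.univ.filter (fun c => ¬ μ / 2 ≤ N c), w c * (μ / 2) := by
            refine Finset.sum_le_sum fun c hc => mul_le_mul_of_nonneg_left ?_ (hw c)
            exact (not_le.mp (Finset.mem_filter.mp hc).2).le
        _ ≤ ∑ c, w c * (μ / 2) :=
            Finset.sum_le_sum_of_subset_of_nonneg (Finset.filter_subset _ _) fun c _ _ =>
              mul_nonneg (hw c) (by positivity)
        _ ≤ _ := by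
            rw [← Finset.sum_mul]
            nlinarith
    have h5 := Finset.sum_filter_add_sum_filter_not Finset.univ (fun c => μ / 2 ≤ N c)
      (fun c => w c * N c)
    linarith
  have h6 : (∑ c ∈ A, w c * N c) ^ 2 ≤ (∑ c ∈ A, w c) * ∑ c ∈ A, w c * N c ^ 2 :=
    Finset.sum_sq_le_sum_mul_sum_of_sq_le_mul _ (fun c _ => hw c)
      (fun c _ => mul_nonneg (hw c) (sq_nonneg _)) fun c _ => le_of_eq (by ring)
  have h7 : ∑ c ∈ A, w c * N c ^ 2 ≤ s :=
    (Finset.sum_le_sum_of_subset_of_nonneg (Finset.filter_subset _ _) fun c _ _ =>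
      mul_nonneg (hw c) (sq_nonneg _)).trans h2
  have h8 : 0 ≤ ∑ c ∈ A, w c := Finset.sum_nonneg fun c _ => hw c
  rw [div_le_iff₀ (by positivity)]
  nlinarith

/-- Lower bound for the probability of many pairs in a relation. -/
theorem prob_pairCount_ge_ge (hs : Sparse T good M κ) (hM : 2 ≤ M) {r : S → S → Prop} {q q' : ℝ}
    (hq0 : 0 < q) (hq'0 : 0 < q')
    (hq₁ : ∀ x ∈ T, ((T.filter fun z => r x z).card : ℝ) ≤ q * T.card)
    (hq₂ : ∀ z ∈ T, ((T.filter fun x => r x z).card : ℝ) ≤ q * T.card)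
    (hq' : q' * (T.card : ℝ) ^ 2 ≤ ((T ×ˢ T).filter fun p => r p.1 p.2).card)
    (hr : ∀ x ∈ T, ∀ z ∈ T, r x z → good z x) :
    (q' * (M : ℝ) ^ 2 / 8) ^ 2 / (4 * (8 * q ^ 2 * (M : ℝ) ^ 4 + 2 * q * (M : ℝ) ^ 2)) ≤
      prob (M := M) T good (fun c => q' * (M : ℝ) ^ 2 / 16 ≤ pairCount r c) := by
  have hM0 : (0 : ℝ) < M := by exact_mod_cast (by omega : 0 < M)
  have key := paley_zygmund (w := tupleProb (M := M) T good)
    (N := fun c => (pairCount r c : ℝ)) (fun c => tupleProb_nonneg c)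
    (sum_tupleProb_le_one hs) (μ := q' * (M : ℝ) ^ 2 / 8)
    (s := 8 * q ^ 2 * (M : ℝ) ^ 4 + 2 * q * (M : ℝ) ^ 2) (by positivity) (by positivity)
    (sum_tupleProb_mul_pairCount_ge hs hM hq'0.le hq' hr)
    (sum_tupleProb_mul_pairCount_sq_le hs hq0.le hq₁ hq₂)
  refine key.trans (le_of_eq ?_)
  unfold prob
  refine Finset.sum_congr rfl fun c _ => ?_
  have : q' * (M : ℝ) ^ 2 / 8 / 2 = q' * (M : ℝ) ^ 2 / 16 := by ring
  simp only [this]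

end Pairs


/-! ### The method of types -/

section Types

variable {A B : Type*} [Fintype A] [Fintype B] {n : ℕ}

/-- The number of occurrences of the letter `a`. -/
def occ (x : Fin n → A) (a : A) : ℕ := (Finset.univ.filter fun i => x i = a).card

theorem empirical_eq_occ (x : Fin n → A) (a : A) : empirical x a = (occ x a : ℝ) / n := rfl

theorem occ_eq_sum (x : Fin n → A) (a : A) : (occ x a : ℝ) = ∑ i, if x i = a then (1 : ℝ) else 0 := by
  simp [occ]

theorem occ_eq_mul (x : Fin n → A) (a : A) : (occ x a : ℝ) = n * empirical x a := by
  rcases Nat.eq_zero_or_pos n with rfl | hn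
  · simp [occ]
  · rw [empirical_eq_occ]
    field_simp

theorem occ_eq_of_empirical_eq {x x' : Fin n → A} (h : empirical x = empirical x') (a : A) :
    occ x a = occ x' a := by
  have := occ_eq_mul x a
  rw [h, ← occ_eq_mul] at this
  exact_mod_cast this

theorem empirical_eq_iff {x x' : Fin n → A} : empirical x = empirical x' ↔ occ x = occ x' := by
  constructor
  · exact fun h => funext fun a => occ_eq_of_empirical_eq h a
  · intro h
    funext a
    rw [empirical_eq_occ, empirical_eq_occ, h]

theorem sum_comp_eq (x : Fin n → A) (f : A → ℝ) : ∑ i, f (x i) = n * ∑ a, empirical x a * f a := by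
  have : ∀ i, f (x i) = ∑ a, (if x i = a then 1 else 0) * f a := by
    intro i
    simp
  simp only [this]
  rw [Finset.sum_comm, Finset.mul_sum]
  refine Finset.sum_congr rfl fun a _ => ?_
  rw [← Finset.sum_mul, ← occ_eq_sum, occ_eq_mul, mul_assoc]

theorem empirical_comp (p : A → B) (x : Fin n → A) (b : B) :
    empirical (p ∘ x) b = ∑ a, if p a = b then empirical x a else 0 := by
  have h := sum_comp_eq x fun a => if p a = b then (1 : ℝ) else 0
  rw [empirical_eq_occ, occ_eq_sum]
  simp only [Function.comp_apply, h, mul_ite, mul_one, mul_zero]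
  rcases Nat.eq_zero_or_pos n with rfl | hn
  · simp [empirical]
  · field_simp

theorem sum_occ (x : Fin n → A) : ∑ a, occ x a = n := by
  have : (∑ a, occ x a : ℝ) = n := by
    simp only [occ_eq_sum]
    rw [Finset.sum_comm]
    simp
  exact_mod_cast this

theorem occ_le (x : Fin n → A) (a : A) : occ x a ≤ n := by
  simpa [occ] using Finset.card_filter_le (Finset.univ : Finset (Fin n)) fun i => x i = a

theorem empirical_mem_stdSimplex (hn : 0 < n) (x : Fin n → A) : empirical x ∈ stdSimplex ℝ A := by
  refine ⟨fun a => by rw [empirical_eq_occ]; positivity, ?_⟩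
  simp only [empirical_eq_occ]
  rw [← Finset.sum_div]
  have : (∑ a, (occ x a : ℝ)) = n := by exact_mod_cast sum_occ x
  rw [this, div_self]
  positivity

theorem empirical_nonneg (x : Fin n → A) (a : A) : 0 ≤ empirical x a := by
  rw [empirical_eq_occ]; positivity

theorem empirical_apply_pos (x : Fin n → A) (i : Fin n) : 0 < empirical x (x i) := by
  have hn : 0 < n := i.pos
  rw [empirical_eq_occ]
  have : 0 < occ x (x i) := Finset.card_pos.mpr ⟨i, by simp⟩
  positivity

theorem exists_of_empirical_ne_zero {x : Fin n → A} {a : A} (h : empirical x a ≠ 0) :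
    ∃ i, x i = a := by
  by_contra hne
  push Not at hne
  apply h
  rw [empirical_eq_occ]
  simp [occ, hne]

/-! #### Permutations -/

theorem exists_perm_of_occ_eq {x x' : Fin n → A} (h : occ x = occ x') :
    ∃ σ : Equiv.Perm (Fin n), x ∘ σ = x' := by
  have hc : ∀ a, Nonempty ({i // x' i = a} ≃ {i // x i = a}) := by
    intro a
    refine ⟨Fintype.equivOfCardEq ?_⟩
    rw [Fintype.card_subtype, Fintype.card_subtype]
    exact (congrFun h a).symm
  have e := fun a => (hc a).some
  refine ⟨((Equiv.sigmaFiberEquiv x').symm.trans (Equiv.sigmaCongrRight e)).trans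
    (Equiv.sigmaFiberEquiv x), ?_⟩
  funext i
  exact (e (x' i) ⟨i, rfl⟩).2

theorem occ_comp_perm (x : Fin n → A) (σ : Equiv.Perm (Fin n)) : occ (x ∘ σ) = occ x := by
  funext a
  have : (occ (x ∘ σ) a : ℝ) = occ x a := by
    rw [occ_eq_sum, occ_eq_sum]
    exact Equiv.sum_comp σ fun i => if x i = a then (1 : ℝ) else 0
  exact_mod_cast this

/-- The type class of the sequence `x`. -/
def typeOf (x : Fin n → A) : Finset (Fin n → A) :=
  Finset.univ.filter fun x' => empirical x' = empirical x

theorem mem_typeOf {x x' : Fin n → A} : x' ∈ typeOf x ↔ empirical x' = empirical x := by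
  simp [typeOf]

theorem self_mem_typeOf (x : Fin n → A) : x ∈ typeOf x := mem_typeOf.mpr rfl

/-- Orbit-stabilizer: permutations of positions act transitively on a type class, and the stabilizer
of a sequence is the product of the symmetric groups on its level sets. -/
theorem card_typeOf_mul (x : Fin n → A) :
    (typeOf x).card * ∏ a, (occ x a).factorial = n.factorial := by
  have h1 : (Finset.univ : Finset (Equiv.Perm (Fin n))).card =
      ∑ x' ∈ typeOf x, (Finset.univ.filter fun σ : Equiv.Perm (Fin n) => x ∘ σ = x').card :=
    Finset.card_eq_sum_card_fiberwise fun σ _ =>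
      mem_typeOf.mpr (empirical_eq_iff.mpr (occ_comp_perm x σ))
  have h2 : ∀ x' ∈ typeOf x,
      (Finset.univ.filter fun σ : Equiv.Perm (Fin n) => x ∘ σ = x').card =
        ∏ a, (occ x a).factorial := by
    intro x' hx'
    obtain ⟨τ, rfl⟩ := exists_perm_of_occ_eq (empirical_eq_iff.mp (mem_typeOf.mp hx').symm)
    have h3 := DomMulAct.stabilizer_card x
    rw [Fintype.card_subtype] at h3
    have h4 : ∀ a, Fintype.card {i // x i = a} = occ x a := fun a => Fintype.card_subtype _
    simp only [h4] at h3
    rw [← h3]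
    refine Finset.card_bij' (fun σ _ => σ * τ⁻¹) (fun σ _ => σ * τ) ?_ ?_ ?_ ?_
    · intro σ hσ
      simp only [Finset.mem_filter, Finset.mem_univ, true_and] at hσ ⊢
      funext i
      have := congrFun hσ (τ⁻¹ i)
      simpa using this
    · intro σ hσ
      simp only [Finset.mem_filter, Finset.mem_univ, true_and] at hσ ⊢
      funext i
      exact congrFun hσ (τ i)
    · intro σ _; simp
    · intro σ _; simp
  rw [Finset.sum_congr rfl h2, Finset.sum_const, smul_eq_mul] at h1
  rw [← h1, Finset.card_univ, Fintype.card_perm, Fintype.card_fin]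

/-- A letterwise map sends a type class onto a type class, and permutations of positions carry any
fibre to any other, so all fibres have the same size. Taking coordinate projections for `p` gives
the conditional type classes used below. -/
theorem card_typeOf_eq_mul (p : A → B) (x : Fin n → A) :
    (typeOf x).card = (typeOf (p ∘ x)).card *
      ((typeOf x).filter fun x' => p ∘ x' = p ∘ x).card := by
  have h1 : (typeOf x).card =
      ∑ y ∈ typeOf (p ∘ x), ((typeOf x).filter fun x' => p ∘ x' = y).card := by
    refine Finset.card_eq_sum_card_fiberwise fun x' hx' => ?_
    refine mem_typeOf.mpr (funext fun b => ?_)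
    rw [empirical_comp, empirical_comp, mem_typeOf.mp hx']
  rw [h1, ← smul_eq_mul]
  refine Finset.sum_const_nat fun y hy => ?_
  obtain ⟨τ, rfl⟩ := exists_perm_of_occ_eq (empirical_eq_iff.mp (mem_typeOf.mp hy).symm)
  refine Finset.card_bij' (fun x' _ => x' ∘ (τ⁻¹ : Equiv.Perm _)) (fun x' _ => x' ∘ τ) ?_ ?_ ?_ ?_
  · intro x' hx'
    obtain ⟨h2, h3⟩ := Finset.mem_filter.mp hx'
    refine Finset.mem_filter.mpr ⟨mem_typeOf.mpr ?_, ?_⟩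
    · rw [← mem_typeOf.mp h2, empirical_eq_iff, occ_comp_perm]
    · rw [← Function.comp_assoc, h3, Function.comp_assoc]
      funext i; simp
  · intro x' hx'
    obtain ⟨h2, h3⟩ := Finset.mem_filter.mp hx'
    refine Finset.mem_filter.mpr ⟨mem_typeOf.mpr ?_, ?_⟩
    · rw [← mem_typeOf.mp h2, empirical_eq_iff, occ_comp_perm]
    · rw [← Function.comp_assoc, h3]
  · intro x' _; funext i; simp
  · intro x' _; funext i; simp

/-! #### Entropy -/

/-- Entropy (in nats). -/
def ent (P : A → ℝ) : ℝ := ∑ a, Real.negMulLog (P a)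

/-- The logarithmic error term of the method of types. -/
def slack (n : ℕ) : ℝ := 2 * Real.log (n + 1) + 1

theorem slack_pos (n : ℕ) : 0 < slack n := by
  have : 0 ≤ Real.log ((n : ℝ) + 1) := Real.log_nonneg (by linarith [n.cast_nonneg (α := ℝ)])
  unfold slack
  linarith

theorem slack_mono {m n : ℕ} (h : m ≤ n) : slack m ≤ slack n := by
  unfold slack
  have : (m : ℝ) ≤ n := by exact_mod_cast h
  gcongr

/-- A single term of the exponential series: n^n / n! ≤ e^n. -/
theorem le_log_factorial (n : ℕ) : n * Real.log n - n ≤ Real.log n.factorial := by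
  rcases Nat.eq_zero_or_pos n with rfl | hn
  · simp
  have hn' : (0 : ℝ) < n := by exact_mod_cast hn
  have h := Real.pow_div_factorial_le_exp (n : ℝ) hn'.le n
  have hf : (0 : ℝ) < n.factorial := by exact_mod_cast n.factorial_pos
  have h2 := Real.log_le_log (by positivity) h
  rw [Real.log_exp, Real.log_div (by positivity) hf.ne', Real.log_pow] at h2
  linarith

/-- The coefficient 2 in `slack` makes the induction close: n log(1 + 1/n) falls short of 1 by at
most 1/(n+1), while 2 log(n+1) grows by at least 2/(n+2), which is no smaller. -/
theorem log_factorial_le (n : ℕ) : Real.log n.factorial ≤ n * Real.log n - n + slack n := by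
  induction n with
  | zero => simp [slack]
  | succ n ih =>
    rcases Nat.eq_zero_or_pos n with rfl | hn
    · have : 0 ≤ Real.log (1 + 1 : ℝ) := Real.log_nonneg (by norm_num)
      simp [slack]
      linarith
    have hn' : (0 : ℝ) < n := by exact_mod_cast hn
    rw [Nat.factorial_succ, Nat.cast_mul, Real.log_mul (by positivity)
      (by exact_mod_cast n.factorial_ne_zero)]
    unfold slack at ih ⊢
    push_cast
    -- the increment of the right side is at least `log (n + 1)`
    have h1 : Real.log (n / (n + 1)) ≤ n / (n + 1) - 1 := Real.log_le_sub_one_of_pos (by positivity)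
    have h2 : Real.log ((n + 1) / (n + 1 + 1)) ≤ (n + 1) / (n + 1 + 1) - 1 :=
      Real.log_le_sub_one_of_pos (by positivity)
    rw [Real.log_div (by positivity) (by positivity)] at h1 h2
    have h3 : (n : ℝ) * (n / (n + 1) - 1) + 2 * ((n + 1) / (n + 1 + 1) - 1) ≤ -1 := by
      have h4 : (n : ℝ) * (n / (n + 1) - 1) = -1 + 1 / (n + 1) := by field_simp; ring
      have h5 : 2 * (((n : ℝ) + 1) / (n + 1 + 1) - 1) = -(2 / (n + 2)) := by field_simp; ring
      have h6 : 1 / ((n : ℝ) + 1) ≤ 2 / (n + 2) := by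
        rw [div_le_div_iff₀ (by positivity) (by positivity)]
        linarith
      linarith
    have h7 := mul_le_mul_of_nonneg_left h1 hn'.le
    linarith

/-- The multinomial coefficient is estimated by the two factorial bounds; the linear terms cancel
because the occurrences add up to `n`. -/
theorem log_card_typeOf (x : Fin n → A) :
    |Real.log (typeOf x).card - n * ent (empirical x)| ≤ (Fintype.card A + 1) * slack n := by
  have h := card_typeOf_mul x
  have hf : ∀ m : ℕ, (m.factorial : ℝ) ≠ 0 := fun m => by exact_mod_cast m.factorial_ne_zero
  have hcard : ((typeOf x).card : ℝ) ≠ 0 := by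
    have := Finset.card_pos.mpr ⟨x, self_mem_typeOf x⟩
    exact_mod_cast this.ne'
  have h1 : Real.log (typeOf x).card + ∑ a, Real.log (occ x a).factorial =
      Real.log n.factorial := by
    rw [← h, Nat.cast_mul, Nat.cast_prod, Real.log_mul hcard
      (Finset.prod_ne_zero_iff.mpr fun a _ => hf _), Real.log_prod fun a _ => hf _]
  have h2 : n * ent (empirical x) = n * Real.log n - ∑ a, occ x a * Real.log (occ x a) := by
    rcases Nat.eq_zero_or_pos n with rfl | hn
    · simp [occ]
    have hn' : (n : ℝ) ≠ 0 := by positivity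
    have hterm : ∀ a, (n : ℝ) * Real.negMulLog (empirical x a) =
        occ x a * Real.log n - occ x a * Real.log (occ x a) := by
      intro a
      rw [empirical_eq_occ, Real.negMulLog]
      by_cases h0 : occ x a = 0
      · simp [h0]
      · rw [Real.log_div (by exact_mod_cast h0) hn']
        field_simp
        ring
    unfold ent
    rw [Finset.mul_sum, Finset.sum_congr rfl fun a _ => hterm a, Finset.sum_sub_distrib,
      ← Finset.sum_mul]
    congr 2
    exact_mod_cast sum_occ x
  have h3 : (∑ a, (occ x a : ℝ)) = n := by exact_mod_cast sum_occ x
  have h4 : ∑ a, ((occ x a : ℝ) * Real.log (occ x a) - occ x a) ≤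
      ∑ a, Real.log (occ x a).factorial := Finset.sum_le_sum fun a _ => le_log_factorial _
  have h5 : ∑ a, Real.log (occ x a).factorial ≤
      ∑ a, ((occ x a : ℝ) * Real.log (occ x a) - occ x a + slack n) :=
    Finset.sum_le_sum fun a _ => (log_factorial_le _).trans (by linarith [slack_mono (occ_le x a)])
  rw [Finset.sum_sub_distrib, h3] at h4
  rw [Finset.sum_add_distrib, Finset.sum_sub_distrib, h3] at h5
  simp only [Finset.sum_const, Finset.card_univ, nsmul_eq_mul] at h5
  have h6 := le_log_factorial n
  have h7 := log_factorial_le n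
  have h8 := slack_pos n
  have h9 : 0 ≤ (Fintype.card A : ℝ) * slack n := by positivity
  rw [abs_le, h2]
  constructor <;> linarith

/-- Size of a conditional type class. -/
theorem log_card_cond (p : A → B) (x : Fin n → A) :
    |Real.log ((typeOf x).filter fun x' => p ∘ x' = p ∘ x).card -
      n * (ent (empirical x) - ent (empirical (p ∘ x)))| ≤
      (Fintype.card A + Fintype.card B + 2) * slack n := by
  have h := card_typeOf_eq_mul p x
  have h1 : (((typeOf x).filter fun x' => p ∘ x' = p ∘ x).card : ℝ) ≠ 0 := by
    have := Finset.card_pos.mpr (⟨x, Finset.mem_filter.mpr ⟨self_mem_typeOf x, rfl⟩⟩ :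
      ((typeOf x).filter fun x' => p ∘ x' = p ∘ x).Nonempty)
    exact_mod_cast this.ne'
  have h2 : ((typeOf (p ∘ x)).card : ℝ) ≠ 0 := by
    have := Finset.card_pos.mpr ⟨_, self_mem_typeOf (p ∘ x)⟩
    exact_mod_cast this.ne'
  have h3 : Real.log (typeOf x).card = Real.log (typeOf (p ∘ x)).card +
      Real.log ((typeOf x).filter fun x' => p ∘ x' = p ∘ x).card := by
    rw [h, Nat.cast_mul, Real.log_mul h2 h1]
  have h4 := abs_le.mp (log_card_typeOf x)
  have h5 := abs_le.mp (log_card_typeOf (p ∘ x))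
  rw [abs_le]
  constructor <;> linarith

/-- The number of types. -/
theorem card_image_empirical_le :
    (Finset.univ.image fun x : Fin n → A => empirical x).card ≤ (n + 1) ^ Fintype.card A := by
  have : (Finset.univ.image fun x : Fin n → A => empirical x) ⊆
      Finset.univ.image fun k : A → Fin (n + 1) => fun a => ((k a : ℕ) : ℝ) / n := by
    intro P hP
    obtain ⟨x, _, rfl⟩ := Finset.mem_image.mp hP
    exact Finset.mem_image.mpr ⟨fun a => ⟨occ x a, Nat.lt_succ_of_le (occ_le x a)⟩,
      Finset.mem_univ _, rfl⟩
  refine (Finset.card_le_card this).trans (Finset.card_image_le.trans ?_)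
  simp

/-! #### Sequences with prescribed statistics -/

/-- Inside each level set of `u` the positions are split into blocks of sizes `k a`, one for each
letter `a` above the given letter; the counts match by assumption. -/
theorem exists_seq_occ_eq (p : A → B) (u : Fin n → B) (k : A → ℕ)
    (hk : ∀ b, (∑ a, if p a = b then k a else 0) = occ u b) :
    ∃ w : Fin n → A, p ∘ w = u ∧ occ w = k := by
  have hc : ∀ b, Nonempty ({i // u i = b} ≃ Σ a : {a // p a = b}, Fin (k a)) := by
    intro b
    refine ⟨Fintype.equivOfCardEq ?_⟩
    rw [Fintype.card_subtype, Fintype.card_sigma]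
    simp only [Fintype.card_fin]
    rw [← Finset.sum_subtype (Finset.univ.filter fun a => p a = b) (by simp) k,
      Finset.sum_filter, hk]
    rfl
  have e := fun b => (hc b).some
  let w : Fin n → A := fun i => (e (u i) ⟨i, rfl⟩).1
  have hw : ∀ i, p (w i) = u i := fun i => (e (u i) ⟨i, rfl⟩).1.2
  refine ⟨w, funext hw, funext fun a => ?_⟩
  have h1 : Fintype.card {i // w i = a} = Fintype.card (Fin (k a)) := by
    refine Fintype.card_congr ?_
    refine Equiv.trans (β := {s : Σ a' : {a' // p a' = p a}, Fin (k a') // s.1 = ⟨a, rfl⟩})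
      (Equiv.trans (β := {j : {i // u i = p a} // (e (p a) j).1 = ⟨a, rfl⟩}) ?_
        ((e (p a)).subtypeEquiv fun j => Iff.rfl)) ?_
    · have hiff : ∀ i (h : u i = p a), (e (p a) ⟨i, h⟩).1 = ⟨a, rfl⟩ ↔ w i = a := by
        intro i h
        rw [Subtype.ext_iff]
        have : ∀ b (hb : u i = b), ((e b ⟨i, hb⟩).1 : A) = w i := by
          rintro _ rfl; rfl
        simp only [this]
      exact {
        toFun := fun i => ⟨⟨i.1, by rw [← hw, i.2]⟩, (hiff _ _).mpr i.2⟩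
        invFun := fun j => ⟨j.1.1, (hiff _ j.1.2).mp j.2⟩
        left_inv := fun i => rfl
        right_inv := fun j => rfl }
    · exact Equiv.sigmaSubtype (β := fun a' : {a' // p a' = p a} => Fin (k a')) ⟨a, rfl⟩
  rw [Fintype.card_subtype, Fintype.card_fin] at h1
  exact h1

end Types


/-! ### Rounding distributions to types -/

section Rounding

variable {A B : Type*} [Fintype A] [Fintype B] {n : ℕ}

theorem occ_comp (p : A → B) (x : Fin n → A) (b : B) :
    occ (p ∘ x) b = ∑ a, if p a = b then occ x a else 0 := by
  have h : (occ (p ∘ x) b : ℝ) = ∑ a, if p a = b then (occ x a : ℝ) else 0 := by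
    rw [occ_eq_mul, empirical_comp, Finset.mul_sum]
    refine Finset.sum_congr rfl fun a _ => ?_
    rw [occ_eq_mul x a]
    split_ifs <;> simp
  exact_mod_cast h

theorem exists_seq_occ (k : A → ℕ) : ∃ u : Fin (∑ a, k a) → A, occ u = k := by
  obtain ⟨w, _, hw⟩ := exists_seq_occ_eq (fun _ : A => ()) (fun _ : Fin (∑ a, k a) => ()) k
    (by intro b; simp [occ])
  exact ⟨w, hw⟩

/-- All values are rounded down, and the missing mass, at most the number of letters, is placed on a
single letter where `v` is nonzero. No support is added, which later keeps channel likelihoods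
positive. -/
theorem exists_nat_near (s : Finset A) (v : A → ℝ) (hv0 : ∀ a, 0 ≤ v a) (N : ℕ)
    (hv : ∑ a ∈ s, v a = N) :
    ∃ k : A → ℕ, ∑ a ∈ s, k a = N ∧
      ∀ a ∈ s, |(k a : ℝ) - v a| ≤ Fintype.card A + 1 ∧ (k a ≠ 0 → v a ≠ 0) := by
  by_cases h : ∃ a₀ ∈ s, v a₀ ≠ 0
  · obtain ⟨a₀, ha₀, hva₀⟩ := h
    have hf : ∀ a, (⌊v a⌋₊ : ℝ) ≤ v a := fun a => Nat.floor_le (hv0 a)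
    have hf' : ∀ a, v a < ⌊v a⌋₊ + 1 := fun a => Nat.lt_floor_add_one _
    have hle : ∑ a ∈ s, ⌊v a⌋₊ ≤ N := by
      have : (∑ a ∈ s, (⌊v a⌋₊ : ℝ)) ≤ N := hv ▸ Finset.sum_le_sum fun a _ => hf a
      exact_mod_cast this
    have hr : ((N - ∑ a ∈ s, ⌊v a⌋₊ : ℕ) : ℝ) ≤ Fintype.card A := by
      rw [Nat.cast_sub hle, ← hv]
      push_cast
      rw [← Finset.sum_sub_distrib]
      calc _ ≤ ∑ a ∈ s, (1 : ℝ) := Finset.sum_le_sum fun a _ => by linarith [hf' a]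
        _ ≤ _ := by
          simp only [Finset.sum_const, nsmul_eq_mul, mul_one]
          exact_mod_cast Finset.card_le_univ s
    refine ⟨fun a => ⌊v a⌋₊ + if a = a₀ then N - ∑ a ∈ s, ⌊v a⌋₊ else 0, ?_, fun a _ => ⟨?_, ?_⟩⟩
    · rw [Finset.sum_add_distrib, Finset.sum_ite_eq' s a₀, if_pos ha₀]
      omega
    · have h1 := hf a
      have h2 := hf' a
      have h3 : (0 : ℝ) ≤ ((N - ∑ a ∈ s, ⌊v a⌋₊ : ℕ) : ℝ) := Nat.cast_nonneg _
      have h4 : (0 : ℝ) ≤ Fintype.card A := Nat.cast_nonneg _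
      rw [abs_le]
      dsimp only
      split_ifs
      · rw [Nat.cast_add]
        constructor <;> linarith
      · rw [add_zero]
        constructor <;> linarith
    · intro hk hva
      have hne : a ≠ a₀ := fun h => hva₀ (h ▸ hva)
      simp [hva, hne] at hk
  · push Not at h
    have hN : N = 0 := by
      have : (N : ℝ) = 0 := by rw [← hv]; exact Finset.sum_eq_zero h
      exact_mod_cast this
    refine ⟨fun _ => 0, by simp [hN], fun a ha => ⟨?_, by simp⟩⟩
    rw [h a ha]
    simp
    positivity

/-- A distribution whose image under `p` is the type of `u` is close to the type of a sequence
over `u`, with no additional support. -/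
theorem exists_seq_near_over (hn : 0 < n) (p : A → B) (u : Fin n → B) (J : A → ℝ)
    (hJ0 : ∀ a, 0 ≤ J a) (hJ : ∀ b, (∑ a, if p a = b then J a else 0) = empirical u b) :
    ∃ w : Fin n → A, p ∘ w = u ∧ ∀ a, |empirical w a - J a| ≤ (Fintype.card A + 1) / n ∧
      (empirical w a ≠ 0 → J a ≠ 0) := by
  have hn' : (0 : ℝ) < n := by exact_mod_cast hn
  have h : ∀ b, ∃ k : A → ℕ, ∑ a ∈ Finset.univ.filter (fun a => p a = b), k a = occ u b ∧
      ∀ a ∈ Finset.univ.filter (fun a => p a = b),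
        |(k a : ℝ) - n * J a| ≤ Fintype.card A + 1 ∧ (k a ≠ 0 → n * J a ≠ 0) := by
    intro b
    refine exists_nat_near _ (fun a => n * J a) (fun a => mul_nonneg hn'.le (hJ0 a)) _ ?_
    rw [← Finset.mul_sum, Finset.sum_filter, hJ, ← occ_eq_mul]
  choose k hk using h
  obtain ⟨w, hw, hwk⟩ := exists_seq_occ_eq p u (fun a => k (p a) a) (fun b => by
    rw [← (hk b).1, Finset.sum_filter]
    refine Finset.sum_congr rfl fun a _ => ?_
    split_ifs with h
    · rw [h]
    · rfl)
  refine ⟨w, hw, fun a => ?_⟩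
  obtain ⟨h1, h2⟩ := (hk (p a)).2 a (by simp)
  rw [empirical_eq_occ, hwk]
  constructor
  · have : (k (p a) a : ℝ) / n - J a = (k (p a) a - n * J a) / n := by field_simp
    rw [this, abs_div, abs_of_pos hn']
    gcongr
  · intro h3 h4
    refine h2 (fun h5 => h3 (by simp [h5])) (by simp [h4])

theorem margFst_eq (P : A × B → ℝ) (a : A) : margFst P a = ∑ p, if p.1 = a then P p else 0 := by
  rw [Fintype.sum_prod_type_right]
  simp [margFst]

theorem margSnd_eq (P : A × B → ℝ) (b : B) : margSnd P b = ∑ p, if p.2 = b then P p else 0 := by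
  rw [Fintype.sum_prod_type]
  simp [margSnd]

theorem margFst_jointEmpirical (x : Fin n → A) (y : Fin n → B) :
    margFst (jointEmpirical x y) = empirical x := by
  funext a
  rw [margFst_eq]
  exact (empirical_comp Prod.fst (fun i => (x i, y i)) a).symm

theorem margSnd_jointEmpirical (x : Fin n → A) (y : Fin n → B) :
    margSnd (jointEmpirical x y) = empirical y := by
  funext b
  rw [margSnd_eq]
  exact (empirical_comp Prod.snd (fun i => (x i, y i)) b).symm

theorem jointEmpirical_mem_couplings (hn : 0 < n) (x : Fin n → A) (y : Fin n → B) :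
    jointEmpirical x y ∈ couplings (empirical x) (empirical y) :=
  ⟨empirical_mem_stdSimplex hn _, margFst_jointEmpirical x y, margSnd_jointEmpirical x y⟩

/-- A coupling of two types is close to the joint type of two sequences, one of them given. -/
theorem exists_seq_near_coupling (hn : 0 < n) (x₀ : Fin n → A) (y : Fin n → B) {P : A × B → ℝ}
    (hP : P ∈ couplings (empirical x₀) (empirical y)) :
    ∃ x : Fin n → A, empirical x = empirical x₀ ∧
      ∀ p, |jointEmpirical x y p - P p| ≤ (Fintype.card B + 1) / n := by
  have hn' : (0 : ℝ) < n := by exact_mod_cast hn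
  obtain ⟨⟨hP0, -⟩, hP1, hP2⟩ := hP
  -- Entries are rounded down. The row and column deficits have equal totals, so any pairing `z` of
  -- them completes `f` to a table with exact margins; a row deficit is at most the number of
  -- columns. Unlike the rounding over a fixed sequence, this one may enlarge the support.
  let f : A × B → ℕ := fun p => ⌊n * P p⌋₊
  have hf : ∀ p, (f p : ℝ) ≤ n * P p := fun p => Nat.floor_le (mul_nonneg hn'.le (hP0 p))
  have hf' : ∀ p, n * P p < f p + 1 := fun p => Nat.lt_floor_add_one _
  have hrow : ∀ a, ∑ b, n * P (a, b) = occ x₀ a := by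
    intro a
    rw [← Finset.mul_sum, occ_eq_mul, ← hP1, margFst]
  have hcol : ∀ b, ∑ a, n * P (a, b) = occ y b := by
    intro b
    rw [← Finset.mul_sum, occ_eq_mul, ← hP2, margSnd]
  have hr : ∀ a, ∑ b, f (a, b) ≤ occ x₀ a := by
    intro a
    have : (∑ b, (f (a, b) : ℝ)) ≤ occ x₀ a := (hrow a) ▸ Finset.sum_le_sum fun b _ => hf _
    exact_mod_cast this
  have hc : ∀ b, ∑ a, f (a, b) ≤ occ y b := by
    intro b
    have : (∑ a, (f (a, b) : ℝ)) ≤ occ y b := (hcol b) ▸ Finset.sum_le_sum fun a _ => hf _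
    exact_mod_cast this
  let r : A → ℕ := fun a => occ x₀ a - ∑ b, f (a, b)
  let c : B → ℕ := fun b => occ y b - ∑ a, f (a, b)
  have hrc : ∑ b, c b = ∑ a, r a := by
    have h1 : ∑ a, r a + ∑ a, ∑ b, f (a, b) = n := by
      rw [← Finset.sum_add_distrib, ← sum_occ x₀]
      exact Finset.sum_congr rfl fun a _ => Nat.sub_add_cancel (hr a)
    have h2 : ∑ b, c b + ∑ b, ∑ a, f (a, b) = n := by
      rw [← Finset.sum_add_distrib, ← sum_occ y]
      exact Finset.sum_congr rfl fun b _ => Nat.sub_add_cancel (hc b)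
    rw [Finset.sum_comm] at h2
    omega
  obtain ⟨u, hu⟩ := exists_seq_occ r
  obtain ⟨v, hv⟩ : ∃ v : Fin (∑ a, r a) → B, occ v = c := by
    rw [← hrc]
    exact exists_seq_occ c
  let z : A × B → ℕ := occ fun i => (u i, v i)
  have hz1 : ∀ a, ∑ b, z (a, b) = r a := by
    intro a
    rw [← hu]
    refine Eq.trans ?_ (occ_comp Prod.fst (fun i => (u i, v i)) a).symm
    rw [Fintype.sum_prod_type_right]
    simp [z]
  have hz2 : ∀ b, ∑ a, z (a, b) = c b := by
    intro b
    rw [← hv]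
    refine Eq.trans ?_ (occ_comp Prod.snd (fun i => (u i, v i)) b).symm
    rw [Fintype.sum_prod_type]
    simp [z]
  obtain ⟨w, hwy, hw⟩ := exists_seq_occ_eq Prod.snd y (fun p => f p + z p) (fun b => by
    rw [Fintype.sum_prod_type]
    simp only [Finset.sum_ite_eq', Finset.mem_univ, if_true, Finset.sum_add_distrib, hz2]
    exact Nat.add_sub_cancel' (hc b))
  have hwx : jointEmpirical (Prod.fst ∘ w) y = empirical w := by
    rw [← hwy]
    rfl
  refine ⟨Prod.fst ∘ w, ?_, fun p => ?_⟩
  · rw [empirical_eq_iff]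
    funext a
    rw [occ_comp, Fintype.sum_prod_type_right]
    simp only [Finset.sum_ite_eq', Finset.mem_univ, if_true, hw, Finset.sum_add_distrib, hz1]
    exact Nat.add_sub_cancel' (hr a)
  · obtain ⟨a, b⟩ := p
    have hzr : (z (a, b) : ℝ) ≤ Fintype.card B := by
      have h1 : (z (a, b) : ℝ) ≤ r a := by
        have := Finset.single_le_sum (f := fun b => z (a, b)) (fun _ _ => Nat.zero_le _)
          (Finset.mem_univ b)
        rw [hz1] at this
        exact_mod_cast this
      refine h1.trans ?_
      simp only [r]
      rw [Nat.cast_sub (hr a), ← hrow]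
      push_cast
      rw [← Finset.sum_sub_distrib]
      calc _ ≤ ∑ b : B, (1 : ℝ) := Finset.sum_le_sum fun b _ => by linarith [hf' (a, b)]
        _ = _ := by simp
    rw [hwx, empirical_eq_occ, hw]
    have h0 : (0 : ℝ) ≤ z (a, b) := Nat.cast_nonneg _
    have h1 := hf (a, b)
    have h2 := hf' (a, b)
    have h4 : (0 : ℝ) ≤ Fintype.card B := Nat.cast_nonneg _
    have : ((f (a, b) + z (a, b) : ℕ) : ℝ) / n - P (a, b) =
        (f (a, b) + z (a, b) - n * P (a, b)) / n := by
      push_cast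
      field_simp
    rw [this, abs_div, abs_of_pos hn']
    gcongr
    rw [abs_le]
    constructor <;> linarith

end Rounding

/-! ### Information measures in terms of entropies -/

section Information

variable {A B X Y : Type*} [Fintype A] [Fintype B] [Fintype X] [Fintype Y]

theorem continuous_ent : Continuous (ent : (A → ℝ) → ℝ) :=
  continuous_finsetSum _ fun a _ => Real.continuous_negMulLog.comp (continuous_apply a)

theorem continuous_margFst : Continuous (margFst : (A × B → ℝ) → A → ℝ) :=
  continuous_pi fun _ => continuous_finsetSum _ fun _ _ => continuous_apply _

theorem continuous_margSnd : Continuous (margSnd : (A × B → ℝ) → B → ℝ) :=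
  continuous_pi fun _ => continuous_finsetSum _ fun _ _ => continuous_apply _

theorem le_margFst {P : A × B → ℝ} (hP : ∀ p, 0 ≤ P p) (a : A) (b : B) : P (a, b) ≤ margFst P a :=
  Finset.single_le_sum (f := fun b => P (a, b)) (fun _ _ => hP _) (Finset.mem_univ b)

theorem le_margSnd {P : A × B → ℝ} (hP : ∀ p, 0 ≤ P p) (a : A) (b : B) : P (a, b) ≤ margSnd P b :=
  Finset.single_le_sum (f := fun a => P (a, b)) (fun _ _ => hP _) (Finset.mem_univ a)

/-- In terms of entropies no quotient and no logarithm of zero remains, so continuity up to the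
boundary of the simplex follows from that of t log t. -/
theorem mutualInfo_eq {P : A × B → ℝ} (hP : ∀ p, 0 ≤ P p) :
    mutualInfo P = ent (margFst P) + ent (margSnd P) - ent P := by
  have hterm : ∀ a b, P (a, b) * Real.log (P (a, b) / (margFst P a * margSnd P b)) =
      -(P (a, b) * Real.log (margFst P a)) - P (a, b) * Real.log (margSnd P b) -
        Real.negMulLog (P (a, b)) := by
    intro a b
    rw [Real.negMulLog]
    by_cases h : P (a, b) = 0
    · simp [h]
    have h0 : 0 < P (a, b) := lt_of_le_of_ne (hP _) (Ne.symm h)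
    have h1 := h0.trans_le (le_margFst hP a b)
    have h2 := h0.trans_le (le_margSnd hP a b)
    rw [Real.log_div h (by positivity), Real.log_mul h1.ne' h2.ne']
    ring
  have h1 : ∑ a, ∑ b, P (a, b) * Real.log (margFst P a) = -ent (margFst P) := by
    simp only [← Finset.sum_mul, ent, Real.negMulLog, ← Finset.sum_neg_distrib]
    refine Finset.sum_congr rfl fun a _ => ?_
    simp [margFst]
  have h2 : ∑ a, ∑ b, P (a, b) * Real.log (margSnd P b) = -ent (margSnd P) := by
    rw [Finset.sum_comm]
    simp only [← Finset.sum_mul, ent, Real.negMulLog, ← Finset.sum_neg_distrib]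
    refine Finset.sum_congr rfl fun a _ => ?_
    simp [margSnd]
  have h3 : ∑ a, ∑ b, Real.negMulLog (P (a, b)) = ent P := by
    rw [ent, Fintype.sum_prod_type]
  unfold mutualInfo
  simp only [hterm, Finset.sum_sub_distrib, Finset.sum_neg_distrib, h1, h2, h3]
  ring

theorem continuousOn_mutualInfo : ContinuousOn (mutualInfo : (A × B → ℝ) → ℝ)
    (stdSimplex ℝ (A × B)) := by
  refine ContinuousOn.congr (f := fun P => ent (margFst P) + ent (margSnd P) - ent P) ?_
    fun P hP => mutualInfo_eq hP.1
  exact (((continuous_ent.comp continuous_margFst).add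
    (continuous_ent.comp continuous_margSnd)).sub continuous_ent).continuousOn

theorem ent_mix {P P' : A → ℝ} (hP : ∀ a, 0 ≤ P a) (hP' : ∀ a, 0 ≤ P' a) {t : ℝ} (h0 : 0 ≤ t)
    (h1 : t ≤ 1) : (1 - t) * ent P + t * ent P' ≤ ent fun a => (1 - t) * P a + t * P' a := by
  unfold ent
  rw [Finset.mul_sum, Finset.mul_sum, ← Finset.sum_add_distrib]
  refine Finset.sum_le_sum fun a _ => ?_
  simpa using Real.concaveOn_negMulLog.2 (Set.mem_Ici.mpr (hP a)) (Set.mem_Ici.mpr (hP' a))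
    (sub_nonneg.mpr h1) h0 (by ring)

theorem prod_mem_couplings {p : A → ℝ} {q : B → ℝ} (hp : p ∈ stdSimplex ℝ A)
    (hq : q ∈ stdSimplex ℝ B) : (fun ab : A × B => p ab.1 * q ab.2) ∈ couplings p q := by
  refine ⟨⟨fun ab => mul_nonneg (hp.1 _) (hq.1 _), ?_⟩, ?_, ?_⟩
  · rw [Fintype.sum_prod_type]
    simp [← Finset.mul_sum, hq.2, hp.2]
  · funext a
    simp [margFst, ← Finset.mul_sum, hq.2]
  · funext b
    simp [margSnd, ← Finset.sum_mul, hp.2]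

theorem mutualInfo_prod {p : A → ℝ} {q : B → ℝ} (hp : p ∈ stdSimplex ℝ A)
    (hq : q ∈ stdSimplex ℝ B) : mutualInfo (fun ab : A × B => p ab.1 * q ab.2) = 0 := by
  obtain ⟨-, h1, h2⟩ := prod_mem_couplings hp hq
  unfold mutualInfo
  rw [h1, h2]
  refine Finset.sum_eq_zero fun a _ => Finset.sum_eq_zero fun b _ => ?_
  by_cases h : p a * q b = 0
  · simp [h]
  · simp [div_self h]

theorem couplings_mix {p : A → ℝ} {q : B → ℝ} {P P' : A × B → ℝ} (hP : P ∈ couplings p q)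
    (hP' : P' ∈ couplings p q) {t : ℝ} (h0 : 0 ≤ t) (h1 : t ≤ 1) :
    (fun a => (1 - t) * P a + t * P' a) ∈ couplings p q := by
  obtain ⟨hPs, hP1, hP2⟩ := hP
  obtain ⟨hPs', hP1', hP2'⟩ := hP'
  refine ⟨?_, ?_, ?_⟩
  · exact convex_stdSimplex ℝ (A × B) hPs hPs' (sub_nonneg.mpr h1) h0 (by ring)
  · funext a
    have e1 := congrFun hP1 a
    have e2 := congrFun hP1' a
    simp only [margFst] at e1 e2 ⊢
    rw [Finset.sum_add_distrib, ← Finset.mul_sum, ← Finset.mul_sum, e1, e2]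
    ring
  · funext a
    have e1 := congrFun hP2 a
    have e2 := congrFun hP2' a
    simp only [margSnd] at e1 e2 ⊢
    rw [Finset.sum_add_distrib, ← Finset.mul_sum, ← Finset.mul_sum, e1, e2]
    ring

/-- With fixed marginals mutual information is a constant minus the entropy, hence convex, and it
vanishes at the product coupling. -/
theorem mutualInfo_mix_prod_le {p : A → ℝ} {q : B → ℝ} (hp : p ∈ stdSimplex ℝ A)
    (hq : q ∈ stdSimplex ℝ B) {P : A × B → ℝ} (hP : P ∈ couplings p q) {t : ℝ} (h0 : 0 ≤ t)
    (h1 : t ≤ 1) :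
    mutualInfo (fun ab : A × B => (1 - t) * P ab + t * (p ab.1 * q ab.2)) ≤
      (1 - t) * mutualInfo P := by
  have hprod := prod_mem_couplings hp hq
  have hz := mutualInfo_prod hp hq
  have hm := couplings_mix hP hprod h0 h1
  have hent := ent_mix hP.1.1 hprod.1.1 h0 h1
  rw [mutualInfo_eq hprod.1.1, hprod.2.1, hprod.2.2] at hz
  rw [mutualInfo_eq hm.1.1, mutualInfo_eq hP.1.1, hm.2.1, hm.2.2, hP.2.1, hP.2.2]
  nlinarith

theorem condMutualInfo_eq {J : X × X × Y → ℝ} (hJ : ∀ p, 0 ≤ J p) :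
    condMutualInfo J = ent (lawXX' J) + ent (lawXY J) - ent J - ent (margFst (lawXY J)) := by
  have hXX : ∀ x x' y, J (x, x', y) ≤ lawXX' J (x, x') := fun x x' y =>
    Finset.single_le_sum (f := fun y => J (x, x', y)) (fun _ _ => hJ _) (Finset.mem_univ y)
  have hXY : ∀ x x' y, J (x, x', y) ≤ lawXY J (x, y) := fun x x' y =>
    Finset.single_le_sum (f := fun x' => J (x, x', y)) (fun _ _ => hJ _) (Finset.mem_univ x')
  have hXY0 : ∀ p, 0 ≤ lawXY J p := fun p => Finset.sum_nonneg fun _ _ => hJ _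
  have hterm : ∀ x x' y, J (x, x', y) *
      Real.log (J (x, x', y) * margFst (lawXY J) x / (lawXX' J (x, x') * lawXY J (x, y))) =
      J (x, x', y) * Real.log (margFst (lawXY J) x) - Real.negMulLog (J (x, x', y)) -
        J (x, x', y) * Real.log (lawXX' J (x, x')) - J (x, x', y) * Real.log (lawXY J (x, y)) := by
    intro x x' y
    rw [Real.negMulLog]
    by_cases h : J (x, x', y) = 0
    · simp [h]
    have h0 : 0 < J (x, x', y) := lt_of_le_of_ne (hJ _) (Ne.symm h)
    have h1 := h0.trans_le (hXX x x' y)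
    have h2 := h0.trans_le (hXY x x' y)
    have h3 := h2.trans_le (le_margFst hXY0 x y)
    rw [Real.log_div (by positivity) (by positivity), Real.log_mul h h3.ne',
      Real.log_mul h1.ne' h2.ne']
    ring
  have h1 : ∑ x, ∑ x', ∑ y, J (x, x', y) * Real.log (margFst (lawXY J) x) =
      -ent (margFst (lawXY J)) := by
    simp only [← Finset.sum_mul, ent, Real.negMulLog, ← Finset.sum_neg_distrib]
    refine Finset.sum_congr rfl fun a _ => ?_
    rw [Finset.sum_comm]
    simp [margFst, lawXY]
  have h2 : ∑ x, ∑ x', ∑ y, J (x, x', y) * Real.log (lawXX' J (x, x')) = -ent (lawXX' J) := by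
    simp only [← Finset.sum_mul, ent, Real.negMulLog, ← Finset.sum_neg_distrib]
    rw [Fintype.sum_prod_type]
    simp [lawXX']
  have h3 : ∑ x, ∑ x', ∑ y, J (x, x', y) * Real.log (lawXY J (x, y)) = -ent (lawXY J) := by
    simp only [ent, Real.negMulLog, ← Finset.sum_neg_distrib]
    rw [Fintype.sum_prod_type]
    refine Finset.sum_congr rfl fun a _ => ?_
    rw [Finset.sum_comm]
    simp only [← Finset.sum_mul]
    simp [lawXY]
  have h4 : ∑ x, ∑ x', ∑ y, Real.negMulLog (J (x, x', y)) = ent J := by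
    rw [ent, Fintype.sum_prod_type]
    simp only [Fintype.sum_prod_type]
  unfold condMutualInfo
  simp only [hterm, Finset.sum_sub_distrib, h1, h2, h3, h4]
  ring

theorem condDiv_eq {W : X → Y → ℝ} {P : X × Y → ℝ} (hP : ∀ p, 0 ≤ P p)
    (hW : ∀ x y, P (x, y) ≠ 0 → W x y ≠ 0) :
    condDiv W P = ((ent (margFst P) - ent P - ∑ p, P p * Real.log (W p.1 p.2) : ℝ) : EReal) := by
  have hno : ¬ ∃ x y, P (x, y) ≠ 0 ∧ W x y = 0 := by
    rintro ⟨x, y, h1, h2⟩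
    exact hW x y h1 h2
  unfold condDiv
  rw [if_neg hno]
  congr 1
  have hterm : ∀ x y, P (x, y) * Real.log (P (x, y) / (margFst P x * W x y)) =
      -Real.negMulLog (P (x, y)) - P (x, y) * Real.log (margFst P x) -
        P (x, y) * Real.log (W x y) := by
    intro x y
    rw [Real.negMulLog]
    by_cases h : P (x, y) = 0
    · simp [h]
    have h0 : 0 < P (x, y) := lt_of_le_of_ne (hP _) (Ne.symm h)
    have h1 := h0.trans_le (le_margFst hP x y)
    rw [Real.log_div h (mul_ne_zero h1.ne' (hW x y h)), Real.log_mul h1.ne' (hW x y h)]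
    ring
  have h1 : ∑ a, ∑ b, P (a, b) * Real.log (margFst P a) = -ent (margFst P) := by
    simp only [← Finset.sum_mul, ent, Real.negMulLog, ← Finset.sum_neg_distrib]
    refine Finset.sum_congr rfl fun a _ => ?_
    simp [margFst]
  simp only [hterm, Finset.sum_sub_distrib, Finset.sum_neg_distrib, h1, ent, Fintype.sum_prod_type]
  ring

end Information


/-! ### The functions `α` and `β` -/

section AlphaBeta

variable {X Y : Type*} [Fintype X] [Fintype Y] {g : (X × Y → ℝ) → ℝ} {Q : X → ℝ}

theorem abs_sub_le_one_of_mem_stdSimplex {A : Type*} [Fintype A] {P P' : A → ℝ}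
    (hP : P ∈ stdSimplex ℝ A) (hP' : P' ∈ stdSimplex ℝ A) (a : A) : |P' a - P a| ≤ 1 := by
  have h1 : P a ≤ 1 := hP.2 ▸ Finset.single_le_sum (f := P) (fun _ _ => hP.1 _) (Finset.mem_univ a)
  have h2 : P' a ≤ 1 := hP'.2 ▸ Finset.single_le_sum (f := P') (fun _ _ => hP'.1 _) (Finset.mem_univ a)
  have h3 := hP.1 a
  have h4 := hP'.1 a
  rw [abs_le]
  constructor <;> linarith

/-- The value `α(R, P_Y)` is nearly attained by the joint type of `y` with a sequence of
composition `Q` whose mutual information with `y` stays away from `R`. -/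
theorem exists_seq_alpha (hg : ContinuousOn g (stdSimplex ℝ (X × Y))) {R : ℝ} (hR : 0 < R)
    {η : ℝ} (hη : 0 < η) :
    ∃ ε > 0, ∃ N₀ : ℕ, ∀ n ≥ N₀, 0 < n → ∀ (x₀ : Fin n → X) (y : Fin n → Y), empirical x₀ = Q →
      ∃ x : Fin n → X, empirical x = Q ∧ mutualInfo (jointEmpirical x y) ≤ R - ε ∧
        alpha g Q R (empirical y) - η ≤
          g (jointEmpirical x y) - mutualInfo (jointEmpirical x y) + R := by
  have hK := isCompact_stdSimplex ℝ (X × Y)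
  have hI : ContinuousOn (mutualInfo : (X × Y → ℝ) → ℝ) (stdSimplex ℝ (X × Y)) :=
    continuousOn_mutualInfo
  obtain ⟨δ₁, hδ₁, h₁⟩ := Metric.uniformContinuousOn_iff.mp
    (hK.uniformContinuousOn_of_continuous (hg.sub hI)) (η / 2) (by positivity)
  -- Mixing a near-maximizer with a fraction t of the product coupling lowers its mutual information
  -- to at most (1-t)R. Half of the margin tR absorbs the rounding to a type, and t ≤ δ₁/4 keeps the
  -- objective within the allowed error.
  set t : ℝ := min (δ₁ / 2) 1 / 2 with ht
  have ht0 : 0 < t := by positivity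
  have ht1 : t ≤ 1 := by
    have := min_le_right (δ₁ / 2) 1
    linarith
  have htδ : t ≤ δ₁ / 4 := by
    have := min_le_left (δ₁ / 2) 1
    linarith
  obtain ⟨δ₂, hδ₂, h₂⟩ := Metric.uniformContinuousOn_iff.mp
    (hK.uniformContinuousOn_of_continuous hI) (t * R / 2) (by positivity)
  obtain ⟨N₀, hN₀⟩ := exists_nat_gt ((Fintype.card Y + 1) / (min (δ₁ / 4) δ₂ / 2))
  refine ⟨t * R / 2, by positivity, N₀, fun n hn hn0 x₀ y hx₀ => ?_⟩
  have hn' : (0 : ℝ) < n := by exact_mod_cast hn0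
  have hQ : Q ∈ stdSimplex ℝ X := hx₀ ▸ empirical_mem_stdSimplex hn0 x₀
  have hy := empirical_mem_stdSimplex hn0 y
  have hprod := prod_mem_couplings hQ hy
  obtain ⟨_, ⟨P, ⟨hP, hPR⟩, rfl⟩, hPα⟩ := exists_lt_of_lt_csSup
    (s := (fun P => g P - mutualInfo P) '' {P | P ∈ couplings Q (empirical y) ∧ mutualInfo P ≤ R})
    ⟨_, _, ⟨hprod, (mutualInfo_prod hQ hy).trans_le hR.le⟩, rfl⟩
    (sub_lt_self _ (half_pos hη))
  have hmix := couplings_mix hP hprod ht0.le ht1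
  have hImix := mutualInfo_mix_prod_le hQ hy hP ht0.le ht1
  set P' : X × Y → ℝ := fun ab => (1 - t) * P ab + t * (Q ab.1 * empirical y ab.2) with hP'
  have hsmall : (Fintype.card Y + 1 : ℝ) / n ≤ min (δ₁ / 4) δ₂ / 2 := by
    have h3 : (Fintype.card Y + 1 : ℝ) / (min (δ₁ / 4) δ₂ / 2) ≤ n :=
      hN₀.le.trans (by exact_mod_cast hn)
    have h4 : 0 < min (δ₁ / 4) δ₂ / 2 := by positivity
    rw [div_le_iff₀ hn']
    rw [div_le_iff₀ h4] at h3
    linarith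
  have hmin : 0 < min (δ₁ / 4) δ₂ := by positivity
  obtain ⟨x, hx, hxP⟩ := exists_seq_near_coupling hn0 x₀ y (hx₀ ▸ hmix)
  have hd1 : dist (jointEmpirical x y) P' ≤ min (δ₁ / 4) δ₂ / 2 :=
    (dist_pi_le_iff (by positivity)).mpr fun p => (hxP p).trans hsmall
  have hd2 : dist P' P ≤ t := by
    refine (dist_pi_le_iff ht0.le).mpr fun p => ?_
    have h5 := abs_sub_le_one_of_mem_stdSimplex hP.1 hprod.1 p
    have h6 : P' p - P p = t * (Q p.1 * empirical y p.2 - P p) := by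
      simp only [hP']
      ring
    rw [Real.dist_eq, h6, abs_mul, abs_of_pos ht0]
    nlinarith
  have hxs : jointEmpirical x y ∈ stdSimplex ℝ (X × Y) := empirical_mem_stdSimplex hn0 _
  have e1 := h₁ _ hxs _ hP.1 (by
    have := dist_triangle (jointEmpirical x y) P' P
    have := min_le_left (δ₁ / 4) δ₂
    linarith)
  have e2 := h₂ _ hxs _ hmix.1 (by
    have := min_le_right (δ₁ / 4) δ₂
    linarith)
  rw [Real.dist_eq] at e1 e2
  have e1' := (abs_lt.mp e1).1
  have e2' := (abs_lt.mp e2).2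
  simp only [Pi.sub_apply] at e1'
  refine ⟨x, hx.trans hx₀, ?_, ?_⟩
  · nlinarith
  · unfold alpha
    linarith

theorem continuousOn_betaFun (hg : ContinuousOn g (stdSimplex ℝ (X × Y))) (R : ℝ) :
    ContinuousOn (fun P => g P + max (R - mutualInfo P) 0) (stdSimplex ℝ (X × Y)) :=
  hg.add ((continuousOn_const.sub continuousOn_mutualInfo).sup continuousOn_const)

theorem le_beta (hg : ContinuousOn g (stdSimplex ℝ (X × Y))) {R : ℝ} {q : Y → ℝ} {P : X × Y → ℝ}
    (hP : P ∈ couplings Q q) : g P + max (R - mutualInfo P) 0 ≤ beta g Q R q := by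
  refine le_csSup ?_ (Set.mem_image_of_mem _ hP)
  exact ((isCompact_stdSimplex ℝ (X × Y)).bddAbove_image (continuousOn_betaFun hg R)).mono
    (Set.image_mono fun P hP => hP.1)

/-- The function `β(R, ·)` is upper semicontinuous. -/
theorem beta_upper (hg : ContinuousOn g (stdSimplex ℝ (X × Y))) (R : ℝ) (q : Y → ℝ)
    {η : ℝ} (hη : 0 < η) :
    ∀ᶠ q' in 𝓝 q, (couplings Q q').Nonempty → beta g Q R q' ≤ beta g Q R q + η := by
  set F : (X × Y → ℝ) → ℝ := fun P => g P + max (R - mutualInfo P) 0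
  -- Couplings with first marginal `Q` and value at least β + η form a compact set. Its second
  -- marginals form a closed set that misses q, hence also a neighbourhood of q.
  set K : Set (X × Y → ℝ) := (stdSimplex ℝ (X × Y) ∩ F ⁻¹' Set.Ici (beta g Q R q + η)) ∩
    margFst ⁻¹' {Q}
  have hK : IsCompact K := by
    have h1 : IsClosed (stdSimplex ℝ (X × Y) ∩ F ⁻¹' Set.Ici (beta g Q R q + η)) :=
      (continuousOn_betaFun hg R).preimage_isClosed_of_isClosed (isClosed_stdSimplex ℝ _)
        isClosed_Ici
    refine (isCompact_stdSimplex ℝ (X × Y)).of_isClosed_subset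
      (h1.inter (isClosed_singleton.preimage continuous_margFst)) fun P hP => hP.1.1
  have hclosed : IsClosed (margSnd '' K) := (hK.image continuous_margSnd).isClosed
  have hq : q ∉ margSnd '' K := by
    rintro ⟨P, ⟨⟨hP, hF⟩, hQ⟩, hq⟩
    have := le_beta (R := R) hg (show P ∈ couplings Q q from ⟨hP, hQ, hq⟩)
    have h2 : beta g Q R q + η ≤ g P + max (R - mutualInfo P) 0 := hF
    linarith
  filter_upwards [hclosed.isOpen_compl.mem_nhds hq] with q' hq' hne
  -- Nonemptiness matters because the supremum of the empty set of reals is 0 by convention.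
  refine csSup_le (hne.image _) ?_
  rintro _ ⟨P, hP, rfl⟩
  by_contra h
  push Not at h
  exact hq' ⟨P, ⟨⟨hP.1, h.le⟩, hP.2.1⟩, hP.2.2⟩

end AlphaBeta

/-! ### Triple types -/

section Triples

variable {A B X Y : Type*} [Fintype A] [Fintype B] [Fintype X] [Fintype Y] {n : ℕ}

/-- The joint type of three sequences. -/
def tripleType (x x' : Fin n → X) (y : Fin n → Y) : X × X × Y → ℝ :=
  empirical fun i => (x i, x' i, y i)

theorem lawXX'_eq (J : X × X × Y → ℝ) (p : X × X) :
    lawXX' J p = ∑ a, if (a.1, a.2.1) = p then J a else 0 := by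
  obtain ⟨u, v⟩ := p
  symm
  simp only [Fintype.sum_prod_type, Prod.mk.injEq, lawXX', ite_and]
  rw [Finset.sum_eq_single u (fun b _ hb => by simp [hb]) (by simp)]
  rw [Finset.sum_eq_single v (fun b _ hb => by simp [hb]) (by simp)]
  simp

theorem lawXY_eq (J : X × X × Y → ℝ) (p : X × Y) :
    lawXY J p = ∑ a, if (a.1, a.2.2) = p then J a else 0 := by
  obtain ⟨u, v⟩ := p
  symm
  simp only [Fintype.sum_prod_type, Prod.mk.injEq, lawXY, ite_and]
  rw [Finset.sum_eq_single u (fun b _ hb => by simp [hb]) (by simp)]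
  simp

theorem lawX'Y_eq (J : X × X × Y → ℝ) (p : X × Y) :
    lawX'Y J p = ∑ a, if (a.2.1, a.2.2) = p then J a else 0 := by
  obtain ⟨u, v⟩ := p
  symm
  simp only [Fintype.sum_prod_type, Prod.mk.injEq, lawX'Y, ite_and]
  refine Finset.sum_congr rfl fun x _ => ?_
  rw [Finset.sum_eq_single u (fun b _ hb => by simp [hb]) (by simp)]
  simp

theorem lawXX'_tripleType (x x' : Fin n → X) (y : Fin n → Y) :
    lawXX' (tripleType x x' y) = jointEmpirical x x' := by
  funext p
  rw [lawXX'_eq]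
  refine Eq.trans ?_ (empirical_comp (fun a : X × X × Y => (a.1, a.2.1)) (fun i => (x i, x' i, y i)) p).symm
  congr!

theorem lawXY_tripleType (x x' : Fin n → X) (y : Fin n → Y) :
    lawXY (tripleType x x' y) = jointEmpirical x y := by
  funext p
  rw [lawXY_eq]
  refine Eq.trans ?_ (empirical_comp (fun a : X × X × Y => (a.1, a.2.2)) (fun i => (x i, x' i, y i)) p).symm
  congr!

theorem lawX'Y_tripleType (x x' : Fin n → X) (y : Fin n → Y) :
    lawX'Y (tripleType x x' y) = jointEmpirical x' y := by
  funext p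
  rw [lawX'Y_eq]
  refine Eq.trans ?_ (empirical_comp (fun a : X × X × Y => (a.2.1, a.2.2)) (fun i => (x i, x' i, y i)) p).symm
  congr!

theorem lawY_tripleType (x x' : Fin n → X) (y : Fin n → Y) :
    lawY (tripleType x x' y) = empirical y := by
  rw [lawY, lawXY_tripleType, margSnd_jointEmpirical]

theorem continuous_lawXX' : Continuous (lawXX' : (X × X × Y → ℝ) → X × X → ℝ) :=
  continuous_pi fun _ => continuous_finsetSum _ fun _ _ => continuous_apply _

theorem continuous_lawXY : Continuous (lawXY : (X × X × Y → ℝ) → X × Y → ℝ) :=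
  continuous_pi fun _ => continuous_finsetSum _ fun _ _ => continuous_apply _

theorem continuous_lawX'Y : Continuous (lawX'Y : (X × X × Y → ℝ) → X × Y → ℝ) :=
  continuous_pi fun _ => continuous_finsetSum _ fun _ _ => continuous_apply _

theorem continuous_lawY : Continuous (lawY : (X × X × Y → ℝ) → Y → ℝ) :=
  continuous_margSnd.comp continuous_lawXY

theorem lawXX'_mem_stdSimplex {J : X × X × Y → ℝ} (hJ : J ∈ stdSimplex ℝ (X × X × Y)) :
    lawXX' J ∈ stdSimplex ℝ (X × X) := by
  refine ⟨fun p => Finset.sum_nonneg fun _ _ => hJ.1 _, ?_⟩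
  rw [← hJ.2]
  simp only [Fintype.sum_prod_type, lawXX']

theorem lawX'Y_mem_stdSimplex {J : X × X × Y → ℝ} (hJ : J ∈ stdSimplex ℝ (X × X × Y)) :
    lawX'Y J ∈ stdSimplex ℝ (X × Y) := by
  refine ⟨fun p => Finset.sum_nonneg fun _ _ => hJ.1 _, ?_⟩
  rw [← hJ.2]
  simp only [Fintype.sum_prod_type, lawX'Y]
  exact (Finset.sum_comm.trans (Finset.sum_congr rfl fun u _ => Finset.sum_comm)).symm

/-- The exponent `D(P_{Y|X} ‖ W | P_X) + I(X'; Y | X)` of a joint law compatible with `W`. -/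
def channelExp (W : X → Y → ℝ) (J : X × X × Y → ℝ) : ℝ :=
  ent (lawXX' J) - ent J - ∑ p, lawXY J p * Real.log (W p.1 p.2)

theorem continuous_channelExp (W : X → Y → ℝ) : Continuous (channelExp W) := by
  refine ((continuous_ent.comp continuous_lawXX').sub continuous_ent).sub ?_
  exact continuous_finsetSum _ fun p _ =>
    ((continuous_apply p).comp continuous_lawXY).mul continuous_const

/-- The entropies of X and of (X, Y) cancel. What remains is minus the conditional entropy of Y
given (X, X') minus the mean log-likelihood, the exponent of the total probability of the outputs of
one joint type. -/
theorem condDiv_add_condMutualInfo {W : X → Y → ℝ} {J : X × X × Y → ℝ} (hJ : ∀ p, 0 ≤ J p)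
    (hW : ∀ x y, lawXY J (x, y) ≠ 0 → W x y ≠ 0) (c : ℝ) :
    condDiv W (lawXY J) + ((condMutualInfo J + c : ℝ) : EReal) =
      ((channelExp W J + c : ℝ) : EReal) := by
  rw [condDiv_eq (P := lawXY J) (fun p => Finset.sum_nonneg fun _ _ => hJ _) hW, condMutualInfo_eq hJ,
    ← EReal.coe_add]
  congr 1
  unfold channelExp
  ring

theorem jointEmpirical_ne_zero_iff {x : Fin n → A} {y : Fin n → B} {a : A} {b : B} :
    jointEmpirical x y (a, b) ≠ 0 ↔ ∃ i, x i = a ∧ y i = b := by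
  constructor
  · intro h
    obtain ⟨i, hi⟩ := exists_of_empirical_ne_zero h
    exact ⟨i, (Prod.mk.inj hi).1, (Prod.mk.inj hi).2⟩
  · rintro ⟨i, rfl, rfl⟩
    exact (empirical_apply_pos (fun i => (x i, y i)) i).ne'

theorem card_same_jointType (x : Fin n → A) (y : Fin n → B) :
    (Finset.univ.filter fun x' : Fin n → A => jointEmpirical x' y = jointEmpirical x y).card =
      ((typeOf fun i => (x i, y i)).filter fun w =>
        Prod.snd ∘ w = Prod.snd ∘ fun i => (x i, y i)).card := by
  refine Finset.card_bij' (fun x' _ i => (x' i, y i)) (fun w _ => Prod.fst ∘ w) ?_ ?_ ?_ ?_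
  · intro x' hx'
    refine Finset.mem_filter.mpr ⟨mem_typeOf.mpr (Finset.mem_filter.mp hx').2, rfl⟩
  · intro w hw
    obtain ⟨h1, h2⟩ := Finset.mem_filter.mp hw
    refine Finset.mem_filter.mpr ⟨Finset.mem_univ _, ?_⟩
    have : (fun i => ((Prod.fst ∘ w) i, y i)) = w := by
      funext i
      exact Prod.ext rfl (congrFun h2 i).symm
    unfold jointEmpirical
    rw [this]
    exact mem_typeOf.mp h1
  · intro x' _; rfl
  · intro w hw
    funext i
    exact Prod.ext rfl (congrFun (Finset.mem_filter.mp hw).2 i).symm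

/-- The fraction of a type class with a given joint type with `y`. -/
theorem log_card_same_jointType (x : Fin n → A) (y : Fin n → B) :
    |Real.log (Finset.univ.filter fun x' : Fin n → A =>
        jointEmpirical x' y = jointEmpirical x y).card - Real.log (typeOf x).card +
      n * mutualInfo (jointEmpirical x y)| ≤
      (Fintype.card (A × B) + Fintype.card A + Fintype.card B + 3) * slack n := by
  have h1 := abs_le.mp (log_card_cond Prod.snd fun i => (x i, y i))
  have h2 := abs_le.mp (log_card_typeOf x)
  rw [← card_same_jointType] at h1
  have h3 : mutualInfo (jointEmpirical x y) =
      ent (empirical x) + ent (empirical y) - ent (jointEmpirical x y) := by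
    rw [mutualInfo_eq (P := jointEmpirical x y) (fun p => empirical_nonneg _ _), margFst_jointEmpirical,
      margSnd_jointEmpirical]
  have h4 : ent (empirical (Prod.snd ∘ fun i => (x i, y i))) = ent (empirical y) := rfl
  have h5 : ent (empirical fun i => (x i, y i)) = ent (jointEmpirical x y) := rfl
  rw [h4, h5] at h1
  rw [h3, abs_le]
  constructor <;> linarith

theorem mutualInfo_comm {P : A × B → ℝ} : mutualInfo (fun p : B × A => P p.swap) = mutualInfo P := by
  unfold mutualInfo
  rw [Finset.sum_comm]
  refine Finset.sum_congr rfl fun a _ => Finset.sum_congr rfl fun b _ => ?_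
  have h1 : margFst (fun p : B × A => P p.swap) b = margSnd P b := rfl
  have h2 : margSnd (fun p : B × A => P p.swap) a = margFst P a := rfl
  rw [h1, h2, mul_comm (margSnd P b)]
  rfl

theorem jointEmpirical_swap (x : Fin n → A) (y : Fin n → B) :
    (fun p => jointEmpirical x y p.swap) = jointEmpirical y x := by
  funext p
  unfold jointEmpirical
  rw [empirical_eq_occ, empirical_eq_occ]
  congr 2
  unfold occ
  congr 1
  ext i
  simp [Prod.ext_iff, and_comm]

theorem jointEmpirical_swap_eq_iff (x x' : Fin n → A) (y y' : Fin n → B) :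
    jointEmpirical x y = jointEmpirical x' y' ↔ jointEmpirical y x = jointEmpirical y' x' := by
  rw [← jointEmpirical_swap x y, ← jointEmpirical_swap x' y']
  constructor
  · intro h
    rw [h]
  · intro h
    funext p
    exact congrFun h p.swap

theorem mutualInfo_jointEmpirical_comm (x : Fin n → A) (y : Fin n → B) :
    mutualInfo (jointEmpirical y x) = mutualInfo (jointEmpirical x y) := by
  rw [← jointEmpirical_swap x y, mutualInfo_comm]

theorem card_same_tripleType (x x' : Fin n → X) (y : Fin n → Y) :
    (Finset.univ.filter fun y' : Fin n → Y => tripleType x x' y' = tripleType x x' y).card =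
      ((typeOf fun i => (x i, x' i, y i)).filter fun w =>
        (fun a : X × X × Y => (a.1, a.2.1)) ∘ w =
          (fun a : X × X × Y => (a.1, a.2.1)) ∘ fun i => (x i, x' i, y i)).card := by
  have hw : ∀ w : Fin n → X × X × Y, (fun a : X × X × Y => (a.1, a.2.1)) ∘ w =
          (fun a : X × X × Y => (a.1, a.2.1)) ∘ (fun i => (x i, x' i, y i)) →
      (fun i => (x i, x' i, (w i).2.2)) = w := by
    intro w h
    funext i
    have := Prod.mk.inj (congrFun h i)
    exact Prod.ext this.1.symm (Prod.ext this.2.symm rfl)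
  refine Finset.card_bij' (fun y' _ i => (x i, x' i, y' i)) (fun w _ i => (w i).2.2) ?_ ?_ ?_ ?_
  · intro y' hy'
    exact Finset.mem_filter.mpr ⟨mem_typeOf.mpr (Finset.mem_filter.mp hy').2, rfl⟩
  · intro w h
    obtain ⟨h1, h2⟩ := Finset.mem_filter.mp h
    refine Finset.mem_filter.mpr ⟨Finset.mem_univ _, ?_⟩
    unfold tripleType
    rw [hw w h2]
    exact mem_typeOf.mp h1
  · intro y' _; rfl
  · intro w h
    exact hw w (Finset.mem_filter.mp h).2

/-- Total probability of the channel outputs of a given joint type. -/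
theorem log_sum_prod_tripleType {W : X → Y → ℝ} (hW : ∀ x y, 0 ≤ W x y) (x x' : Fin n → X)
    (y : Fin n → Y) (hpos : ∀ i, W (x i) (y i) ≠ 0) :
    0 < ∑ y' ∈ Finset.univ.filter (fun y' : Fin n → Y => tripleType x x' y' = tripleType x x' y),
        ∏ i, W (x i) (y' i) ∧
    |Real.log (∑ y' ∈ Finset.univ.filter
        (fun y' : Fin n → Y => tripleType x x' y' = tripleType x x' y), ∏ i, W (x i) (y' i)) +
      n * channelExp W (tripleType x x' y)| ≤
      (Fintype.card (X × X × Y) + Fintype.card (X × X) + 2) * slack n := by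
  set V := Finset.univ.filter (fun y' : Fin n → Y => tripleType x x' y' = tripleType x x' y)
  -- Under a memoryless channel the likelihood depends only on the joint type of input and output,
  -- so it is constant on the class.
  have hterm : ∀ y' ∈ V, ∏ i, W (x i) (y' i) =
      Real.exp (n * ∑ p, jointEmpirical x y p * Real.log (W p.1 p.2)) := by
    intro y' hy'
    have h1 : jointEmpirical x y' = jointEmpirical x y := by
      rw [← lawXY_tripleType x x' y', (Finset.mem_filter.mp hy').2, lawXY_tripleType]
    have h2 : ∀ i, W (x i) (y' i) ≠ 0 := by
      intro i
      obtain ⟨j, hj1, hj2⟩ := jointEmpirical_ne_zero_iff.mp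
        (h1 ▸ jointEmpirical_ne_zero_iff.mpr ⟨i, rfl, rfl⟩ : jointEmpirical x y (x i, y' i) ≠ 0)
      rw [← hj1, ← hj2]
      exact hpos j
    rw [← h1]
    have h3 := sum_comp_eq (fun i => (x i, y' i)) fun p => Real.log (W p.1 p.2)
    change _ = Real.exp (n * ∑ p, empirical (fun i => (x i, y' i)) p * Real.log (W p.1 p.2))
    rw [← h3, Real.exp_sum]
    exact Finset.prod_congr rfl fun i _ =>
      (Real.exp_log (lt_of_le_of_ne (hW _ _) (Ne.symm (h2 i)))).symm
  have hVpos : 0 < (V.card : ℝ) := by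
    have : y ∈ V := by simp [V]
    exact_mod_cast Finset.card_pos.mpr ⟨y, this⟩
  have hsum : ∑ y' ∈ V, ∏ i, W (x i) (y' i) =
      V.card * Real.exp (n * ∑ p, jointEmpirical x y p * Real.log (W p.1 p.2)) := by
    rw [Finset.sum_congr rfl hterm]
    simp
  rw [hsum]
  refine ⟨by positivity, ?_⟩
  rw [Real.log_mul hVpos.ne' (Real.exp_ne_zero _), Real.log_exp]
  have h1 : |Real.log V.card - n * (ent (empirical fun i => (x i, x' i, y i)) -
      ent (empirical ((fun a : X × X × Y => (a.1, a.2.1)) ∘ fun i => (x i, x' i, y i))))| ≤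
      (Fintype.card (X × X × Y) + Fintype.card (X × X) + 2) * slack n := by
    rw [card_same_tripleType]
    convert log_card_cond (fun a : X × X × Y => (a.1, a.2.1)) fun i => (x i, x' i, y i)
  refine le_trans (le_of_eq ?_) h1
  unfold channelExp
  rw [lawXY_tripleType, lawXX'_tripleType]
  congr 1
  have h4 : ent (empirical ((fun a : X × X × Y => (a.1, a.2.1)) ∘ fun i => (x i, x' i, y i))) =
    ent (jointEmpirical x x') := rfl
  have h5 : ent (empirical fun i => (x i, x' i, y i)) = ent (tripleType x x' y) := rfl
  rw [h4, h5]
  ring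

end Triples


/-! ### Exponential inequalities -/

section Exponential

/-- Testing against real numbers L below E treats finite and infinite exponents alike. -/
theorem expLE_of_eventually {l : Filter ℕ} (hl : l ≤ atTop) {p : ℕ → ℝ} {E : EReal}
    (h : ∀ L : ℝ, (L : EReal) < E → ∀ᶠ n in l, p n ≤ Real.exp (-(n * L))) :
    ExpLE l (fun n => ENNReal.ofReal (p n)) E := by
  unfold ExpLE
  by_contra hlt
  push Not at hlt
  obtain ⟨r, hr1, hr2⟩ := EReal.lt_iff_exists_real_btwn.mp hlt
  have hL : ((-r : ℝ) : EReal) < E := by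
    rw [EReal.coe_neg]
    exact EReal.neg_lt_comm.mp hr1
  refine absurd hr2 (not_lt.mpr (limsup_le_of_le (by isBoundedDefault) ?_))
  filter_upwards [h _ hL, hl (eventually_gt_atTop 0)] with n hn hn0
  have h0 : (0 : EReal) < (n : EReal) := by exact_mod_cast hn0
  rw [EReal.div_le_iff_le_mul h0 (EReal.natCast_ne_top n)]
  calc ENNReal.log (ENNReal.ofReal (p n)) ≤ ENNReal.log (ENNReal.ofReal (Real.exp (n * r))) := by
        apply ENNReal.log_le_log
        apply ENNReal.ofReal_le_ofReal
        simpa using hn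
    _ = _ := by
        rw [ENNReal.log_ofReal_of_pos (Real.exp_pos _), Real.log_exp, EReal.coe_mul]
        rfl

theorem expGE_of_eventually {l : Filter ℕ} (hl : l ≤ atTop) {p : ℕ → ℝ} {E : EReal}
    (h : ∀ L : ℝ, E < (L : EReal) → ∀ᶠ n : ℕ in l, Real.exp (-(n * L)) ≤ p n) :
    ExpGE l (fun n => ENNReal.ofReal (p n)) E := by
  unfold ExpGE
  by_contra hlt
  push Not at hlt
  obtain ⟨r, hr1, hr2⟩ := EReal.lt_iff_exists_real_btwn.mp hlt
  have hL : E < ((-r : ℝ) : EReal) := by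
    rw [EReal.coe_neg]
    exact EReal.lt_neg_comm.mp hr2
  refine absurd hr1 (not_lt.mpr (le_liminf_of_le (by isBoundedDefault) ?_))
  filter_upwards [h _ hL, hl (eventually_gt_atTop 0)] with n hn hn0
  have h0 : (0 : EReal) < (n : EReal) := by exact_mod_cast hn0
  rw [EReal.le_div_iff_mul_le h0 (EReal.natCast_ne_top n)]
  calc (r : EReal) * n = ENNReal.log (ENNReal.ofReal (Real.exp (n * r))) := by
        rw [ENNReal.log_ofReal_of_pos (Real.exp_pos _), Real.log_exp, EReal.coe_mul, mul_comm]
        rfl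
    _ ≤ _ := by
        apply ENNReal.log_le_log
        apply ENNReal.ofReal_le_ofReal
        simpa using hn

theorem eventually_slack_le (K : ℝ) {η : ℝ} (hη : 0 < η) :
    ∀ᶠ n : ℕ in atTop, K * slack n ≤ n * η := by
  have hc : 0 < η / (4 * (|K| + 1)) := by positivity
  have h1 := (Real.isLittleO_log_id_atTop.bound hc)
  have h2 : Tendsto (fun n : ℕ => (n : ℝ) + 1) atTop atTop :=
    tendsto_atTop_add_const_right _ _ tendsto_natCast_atTop_atTop
  have h3 : ∀ᶠ n : ℕ in atTop, (|K| + η) * 4 / η ≤ n :=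
    tendsto_natCast_atTop_atTop.eventually_ge_atTop _
  filter_upwards [h2.eventually h1, h3] with n hn hn3
  have hn0 : (0 : ℝ) ≤ n := Nat.cast_nonneg n
  simp only [Real.norm_eq_abs, id] at hn
  rw [abs_of_nonneg (by linarith : (0 : ℝ) ≤ n + 1)] at hn
  have hlog : Real.log (n + 1) ≤ η / (4 * (|K| + 1)) * (n + 1) := (le_abs_self _).trans hn
  have hlog0 : 0 ≤ Real.log ((n : ℝ) + 1) := Real.log_nonneg (by linarith)
  rw [div_le_iff₀ hη] at hn3
  have hK := abs_nonneg K
  have h5 : |K| * Real.log (n + 1) ≤ η / 4 * (n + 1) := by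
    calc |K| * Real.log (n + 1) ≤ (|K| + 1) * (η / (4 * (|K| + 1)) * (n + 1)) := by
          gcongr
          linarith
      _ = _ := by field_simp
  calc K * slack n ≤ |K| * slack n := by
        gcongr
        · exact (slack_pos n).le
        · exact le_abs_self K
    _ = 2 * (|K| * Real.log (n + 1)) + |K| := by unfold slack; ring
    _ ≤ _ := by linarith

theorem eventually_le_exp (K : ℝ) {η : ℝ} (hη : 0 < η) :
    ∀ᶠ n : ℕ in atTop, K ≤ Real.exp (n * η) := by
  have h : Tendsto (fun n : ℕ => Real.exp (n * η)) atTop atTop :=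
    Real.tendsto_exp_atTop.comp (tendsto_natCast_atTop_atTop.atTop_mul_const hη)
  exact h.eventually_ge_atTop K

theorem eventually_mul_le_exp (K : ℝ) {c η : ℝ} (hc : 0 < c) (hη : 0 < η) :
    ∀ᶠ n : ℕ in atTop, n * K ≤ c * Real.exp (n * η) := by
  filter_upwards [tendsto_natCast_atTop_atTop.eventually_ge_atTop (2 * |K| / (c * η ^ 2))] with n hn
  have hn0 : (0 : ℝ) ≤ n := Nat.cast_nonneg n
  have h1 := Real.quadratic_le_exp_of_nonneg (by positivity : 0 ≤ (n : ℝ) * η)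
  rw [div_le_iff₀ (by positivity)] at hn
  have h3 : 0 ≤ n * η := by positivity
  calc n * K ≤ n * |K| := by gcongr; exact le_abs_self K
    _ ≤ n * (n * (c * η ^ 2) / 2) := by gcongr; linarith
    _ = c * ((n * η) ^ 2 / 2) := by ring
    _ ≤ _ := by gcongr; linarith

theorem eventually_types_le {A : Type*} [Fintype A] {η : ℝ} (hη : 0 < η) :
    ∀ᶠ n : ℕ in atTop,
      ((Finset.univ.image fun x : Fin n → A => empirical x).card : ℝ) ≤ Real.exp (n * η) := by
  filter_upwards [eventually_slack_le (Fintype.card A) hη] with n hn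
  have h1 : ((Finset.univ.image fun x : Fin n → A => empirical x).card : ℝ) ≤
      ((n : ℝ) + 1) ^ Fintype.card A := by exact_mod_cast card_image_empirical_le
  refine h1.trans ?_
  rw [← Real.exp_log (by positivity : (0 : ℝ) < n + 1), ← Real.exp_nat_mul]
  refine Real.exp_le_exp.mpr (le_trans (mul_le_mul_of_nonneg_left ?_ (Nat.cast_nonneg _)) hn)
  have : 0 ≤ Real.log ((n : ℝ) + 1) := Real.log_nonneg (by linarith [n.cast_nonneg (α := ℝ)])
  unfold slack
  linarith

/-- Sizes of conditional type classes, to first order in the exponent. -/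
theorem eventually_card_jointType {A B : Type*} [Fintype A] [Fintype B] {η : ℝ} (hη : 0 < η) :
    ∀ᶠ n : ℕ in atTop, ∀ (x : Fin n → A) (y : Fin n → B),
      Real.exp (-(n * (mutualInfo (jointEmpirical x y) + η))) * (typeOf x).card ≤
        (Finset.univ.filter fun x' : Fin n → A =>
          jointEmpirical x' y = jointEmpirical x y).card ∧
      ((Finset.univ.filter fun x' : Fin n → A =>
          jointEmpirical x' y = jointEmpirical x y).card : ℝ) ≤
        Real.exp (-(n * (mutualInfo (jointEmpirical x y) - η))) * (typeOf x).card := by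
  filter_upwards [eventually_slack_le
    (Fintype.card (A × B) + Fintype.card A + Fintype.card B + 3) hη] with n hn x y
  have h := abs_le.mp ((log_card_same_jointType x y).trans hn)
  set N := (Finset.univ.filter fun x' : Fin n → A => jointEmpirical x' y = jointEmpirical x y)
  have hN : (0 : ℝ) < N.card := by
    have : x ∈ N := by simp [N]
    exact_mod_cast Finset.card_pos.mpr ⟨x, this⟩
  have hT : (0 : ℝ) < (typeOf x).card := by
    exact_mod_cast Finset.card_pos.mpr ⟨x, self_mem_typeOf x⟩
  constructor
  · rw [← Real.exp_log hN]
    nth_rewrite 1 [← Real.exp_log hT]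
    rw [← Real.exp_add]
    exact Real.exp_le_exp.mpr (by linarith [h.1])
  · rw [← Real.exp_log hN]
    nth_rewrite 1 [← Real.exp_log hT]
    rw [← Real.exp_add]
    exact Real.exp_le_exp.mpr (by linarith [h.2])

/-- Total output probability of a joint type, to first order in the exponent. -/
theorem eventually_sum_prod_tripleType {X Y : Type*} [Fintype X] [Fintype Y] {W : X → Y → ℝ}
    (hW : ∀ x y, 0 ≤ W x y) {η : ℝ} (hη : 0 < η) :
    ∀ᶠ n : ℕ in atTop, ∀ (x x' : Fin n → X) (y : Fin n → Y), (∀ i, W (x i) (y i) ≠ 0) →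
      Real.exp (-(n * (channelExp W (tripleType x x' y) + η))) ≤
        ∑ y' ∈ Finset.univ.filter
          (fun y' : Fin n → Y => tripleType x x' y' = tripleType x x' y), ∏ i, W (x i) (y' i) ∧
      ∑ y' ∈ Finset.univ.filter
          (fun y' : Fin n → Y => tripleType x x' y' = tripleType x x' y), ∏ i, W (x i) (y' i) ≤
        Real.exp (-(n * (channelExp W (tripleType x x' y) - η))) := by
  filter_upwards [eventually_slack_le
    (Fintype.card (X × X × Y) + Fintype.card (X × X) + 2) hη] with n hn x x' y hy
  obtain ⟨h0, h1⟩ := log_sum_prod_tripleType hW x x' y hy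
  have h := abs_le.mp (h1.trans hn)
  constructor
  · rw [← Real.le_log_iff_exp_le h0]
    linarith [h.1]
  · rw [← Real.log_le_iff_le_exp h0]
    linarith [h.2]

end Exponential

/-! ### The random Gilbert-Varshamov ensemble as a sequential ensemble -/

section Code

variable {X Y : Type*} [Fintype X] [Fintype Y] {n M : ℕ}

/-- The type class of `Q` as a finset. -/
def seqs (Q : X → ℝ) (n : ℕ) : Finset (Fin n → X) := Finset.univ.filter fun x => empirical x = Q

theorem mem_seqs {Q : X → ℝ} {x : Fin n → X} : x ∈ seqs Q n ↔ empirical x = Q := by simp [seqs]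

theorem seqs_eq_typeOf {Q : X → ℝ} {x : Fin n → X} (hx : x ∈ seqs Q n) : seqs Q n = typeOf x := by
  ext x'
  rw [mem_seqs, mem_typeOf, mem_seqs.mp hx]

/-- The relation between a codeword and an earlier one that the construction enforces. -/
def farApart (d : (X × X → ℝ) → ℝ) (Δ : ℝ) (z x : Fin n → X) : Prop := Δ < d (jointEmpirical z x)

theorem admissible_eq (Q : X → ℝ) (d : (X × X → ℝ) → ℝ) (Δ : ℝ) (c : Code X M n) (i : Fin M) :
    admissible Q d Δ c i = avail (seqs Q n) (farApart d Δ) c i := by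
  ext x
  constructor
  · intro h
    obtain ⟨_, h1, h2⟩ := Finset.mem_filter.mp h
    exact Finset.mem_filter.mpr ⟨mem_seqs.mpr h1, h2⟩
  · intro h
    obtain ⟨h1, h2⟩ := Finset.mem_filter.mp h
    exact Finset.mem_filter.mpr ⟨Finset.mem_univ _, mem_seqs.mp h1, h2⟩

theorem codeProb_eq (Q : X → ℝ) (d : (X × X → ℝ) → ℝ) (Δ : ℝ) (c : Code X M n) :
    codeProb Q d Δ c = ENNReal.ofReal (tupleProb (seqs Q n) (farApart d Δ) c) := by
  unfold codeProb tupleProb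
  rw [ENNReal.ofReal_prod_of_nonneg fun i _ => stepProb_nonneg i c]
  refine Finset.prod_congr rfl fun i _ => ?_
  unfold stepProb
  rw [admissible_eq]
  split_ifs with h
  · have : (0 : ℝ) < (avail (seqs Q n) (farApart d Δ) c i).card := by
      exact_mod_cast Finset.card_pos.mpr ⟨_, h⟩
    rw [ENNReal.ofReal_inv_of_pos this, ENNReal.ofReal_natCast]
  · simp

theorem lowerTail_eq (W : X → Y → ℝ) (g : (X × Y → ℝ) → ℝ) (Q : X → ℝ) (d : (X × X → ℝ) → ℝ)
    (Δ E₀ : ℝ) (M n : ℕ) :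
    lowerTail W g Q d Δ E₀ M n = ENNReal.ofReal (prob (M := M) (seqs Q n) (farApart d Δ)
      fun c => errorExponent W g c ≤ E₀) := by
  unfold lowerTail ensembleProb prob
  rw [ENNReal.ofReal_sum_of_nonneg fun c _ => by
    split_ifs
    exacts [tupleProb_nonneg c, le_rfl]]
  refine Finset.sum_congr rfl fun c _ => ?_
  simp only [Set.mem_ofPred_eq, codeProb_eq]
  split_ifs <;> simp

/-- The basic device of the method of types: a sum is at most the number of classes times the
largest class sum. -/
theorem sum_le_card_mul {ι κ : Type*} [DecidableEq κ] {s : Finset ι} {t : Finset κ} {φ : ι → κ} {f : ι → ℝ} {V : ℝ}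
    (hφ : ∀ a ∈ s, φ a ∈ t) (h : ∀ a ∈ s, ∑ a' ∈ s.filter (fun a' => φ a' = φ a), f a' ≤ V)
    (hV : 0 ≤ V) : ∑ a ∈ s, f a ≤ t.card * V := by
  rw [← Finset.sum_fiberwise_of_maps_to hφ, ← nsmul_eq_mul]
  refine Finset.sum_le_card_nsmul _ _ _ fun b _ => ?_
  by_cases hb : ∃ a ∈ s, φ a = b
  · obtain ⟨a, ha, rfl⟩ := hb
    exact h a ha
  · push Not at hb
    rw [Finset.filter_eq_empty_iff.mpr fun a ha => hb a ha]
    simpa using hV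

/-- Sections of the relation "having a given joint type". -/
theorem card_section_le {Q : X → ℝ} {η : ℝ}
    (hcard : ∀ x y : Fin n → X, ((Finset.univ.filter fun x' : Fin n → X =>
          jointEmpirical x' y = jointEmpirical x y).card : ℝ) ≤
        Real.exp (-(n * (mutualInfo (jointEmpirical x y) - η))) * (typeOf x).card)
    (P : X × X → ℝ) (y : Fin n → X) :
    (((seqs Q n).filter fun x' => jointEmpirical x' y = P).card : ℝ) ≤
      Real.exp (-(n * (mutualInfo P - η))) * (seqs Q n).card ∧
    (((seqs Q n).filter fun x' => jointEmpirical y x' = P).card : ℝ) ≤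
      Real.exp (-(n * (mutualInfo P - η))) * (seqs Q n).card := by
  constructor
  · by_cases h : ∃ x ∈ seqs Q n, jointEmpirical x y = P
    · obtain ⟨x, hx, rfl⟩ := h
      rw [seqs_eq_typeOf hx]
      refine le_trans ?_ (hcard x y)
      exact_mod_cast Finset.card_le_card (Finset.filter_subset_filter _ (Finset.subset_univ _))
    · push Not at h
      rw [Finset.filter_eq_empty_iff.mpr fun x hx => h x hx]
      simp only [Finset.card_empty, Nat.cast_zero]
      positivity
  · by_cases h : ∃ x ∈ seqs Q n, jointEmpirical y x = P
    · obtain ⟨x, hx, rfl⟩ := h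
      rw [seqs_eq_typeOf hx, ← mutualInfo_jointEmpirical_comm]
      refine le_trans ?_ (hcard x y)
      norm_cast
      refine Finset.card_le_card fun x' hx' => ?_
      rw [Finset.mem_filter] at hx' ⊢
      exact ⟨Finset.mem_univ _, (jointEmpirical_swap_eq_iff _ _ _ _).mp hx'.2⟩
    · push Not at h
      rw [Finset.filter_eq_empty_iff.mpr fun x hx => h x hx]
      simp only [Finset.card_empty, Nat.cast_zero]
      positivity

theorem blockLengths_le (Q : X → ℝ) : blockLengths Q ≤ atTop := inf_le_left

theorem eventually_blockLengths_nonempty (Q : X → ℝ) :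
    ∀ᶠ n in blockLengths Q, (seqs Q n).Nonempty := by
  have : ∀ᶠ n in 𝓟 {n | (typeClass Q n).Nonempty}, (typeClass Q n).Nonempty :=
    eventually_principal.mpr fun n hn => hn
  filter_upwards [(inf_le_right : blockLengths Q ≤ _) this] with n hn
  obtain ⟨x, hx⟩ := hn
  exact ⟨x, mem_seqs.mpr hx⟩

theorem eventually_rate {Q : X → ℝ} {R : ℝ} {M : ℕ → ℕ} (hR : 0 < R)
    (hM : Tendsto (fun n => Real.log (M n) / n) (blockLengths Q) (𝓝 R)) {η : ℝ} (hη : 0 < η) :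
    ∀ᶠ n : ℕ in blockLengths Q, Real.exp (n * (R - η)) ≤ M n ∧ (M n : ℝ) ≤ Real.exp (n * (R + η)) ∧
      2 ≤ M n := by
  -- The bound R/2 keeps the empirical rate positive, which yields at least two codewords.
  have hη' : 0 < min η (R / 2) := by positivity
  filter_upwards [Metric.tendsto_nhds.mp hM _ hη', blockLengths_le Q (eventually_gt_atTop 0),
    blockLengths_le Q (eventually_le_exp 2 (half_pos hR))] with n hn hn0 hn2
  have hn' : (0 : ℝ) < n := by exact_mod_cast hn0
  rw [Real.dist_eq, abs_lt] at hn
  have h1 : R - min η (R / 2) < Real.log (M n) / n := by linarith [hn.1]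
  have h2 : Real.log (M n) / n < R + min η (R / 2) := by linarith [hn.2]
  rw [lt_div_iff₀ hn'] at h1
  rw [div_lt_iff₀ hn'] at h2
  have hm1 := min_le_left η (R / 2)
  have hm2 := min_le_right η (R / 2)
  -- Since `Real.log 0 = 0`, having no codewords would mean rate 0.
  have hMpos : (0 : ℝ) < M n := by
    rcases Nat.eq_zero_or_pos (M n) with h | h
    · rw [h] at h1
      simp only [Nat.cast_zero, Real.log_zero] at h1
      nlinarith
    · exact_mod_cast h
  refine ⟨?_, ?_, ?_⟩
  · rw [← Real.le_log_iff_exp_le hMpos]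
    nlinarith
  · rw [← Real.log_le_iff_le_exp hMpos]
    nlinarith
  · have : (2 : ℝ) ≤ M n := by
      refine hn2.trans ?_
      rw [← Real.le_log_iff_exp_le hMpos]
      nlinarith
    exact_mod_cast this

/-- Under the rate condition the excluded parts of the type class are negligible. -/
theorem eventually_sparse {d : (X × X → ℝ) → ℝ}
    (hdsymm : ∀ P ∈ stdSimplex ℝ (X × X), d (fun p => P p.swap) = d P) {Δ : ℝ} {Q : X → ℝ} {R : ℝ}
    (hR : 0 < R) {M : ℕ → ℕ}
    (hM : Tendsto (fun n => Real.log (M n) / n) (blockLengths Q) (𝓝 R))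
    (hkey : ∃ δ > 0, ∀ n, ∀ P ∈ jointTypes Q n, d P ≤ Δ → R ≤ mutualInfo P - 2 * δ) :
    ∀ᶠ n in blockLengths Q, ∃ κ, Sparse (seqs Q n) (farApart d Δ) (M n) κ := by
  obtain ⟨δ, hδ, hkey⟩ := hkey
  have hη : 0 < δ / 2 := by positivity
  filter_upwards [eventually_blockLengths_nonempty Q, eventually_rate hR hM hη,
    blockLengths_le Q (eventually_gt_atTop 0), blockLengths_le Q (eventually_le_exp 16 hη),
    blockLengths_le Q (eventually_types_le (A := X × X) hη),
    blockLengths_le Q (eventually_card_jointType (A := X) (B := X) hη)]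
    with n hne hrate hn0 h16 htypes hcard
  have hn' : (0 : ℝ) < n := by exact_mod_cast hn0
  -- The sequences too close to x split into shells of types with d ≤ Δ, each a fraction at most
  -- e^{-n(R + 2δ - δ/2)} of the type class by the rate condition. The number of types costs another
  -- δ/2, so κ = e^{-n(R+δ)} works, and Mκ ≤ e^{-nδ/2}.
  have hleft : ∀ x ∈ seqs Q n, (((seqs Q n).filter fun z => ¬ farApart d Δ z x).card : ℝ) ≤
      Real.exp (-(n * (R + δ))) * (seqs Q n).card := by
    intro x hx
    have h1 : (((seqs Q n).filter fun z => ¬ farApart d Δ z x).card : ℝ) =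
        ∑ z ∈ (seqs Q n).filter fun z => ¬ farApart d Δ z x, (1 : ℝ) := by simp
    rw [h1]
    refine (sum_le_card_mul (φ := fun z => jointEmpirical z x)
      (t := Finset.univ.image fun x : Fin n → X × X => empirical x)
      (V := Real.exp (-(n * (R + 2 * δ - δ / 2))) * (seqs Q n).card)
      (fun z _ => Finset.mem_image.mpr ⟨_, Finset.mem_univ _, rfl⟩) (fun z hz => ?_)
      (by positivity)).trans ?_
    · obtain ⟨hzT, hzd⟩ := Finset.mem_filter.mp hz
      have hI := hkey n (jointEmpirical z x) ⟨⟨z, x, rfl⟩,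
        (margFst_jointEmpirical z x).trans (mem_seqs.mp hzT),
        (margSnd_jointEmpirical z x).trans (mem_seqs.mp hx)⟩ (not_lt.mp hzd)
      have h2 := (card_section_le (Q := Q) (fun x y => (hcard x y).2) (jointEmpirical z x) x).1
      simp only [Finset.sum_const, nsmul_eq_mul, mul_one]
      calc _ ≤ (((seqs Q n).filter fun x' => jointEmpirical x' x = jointEmpirical z x).card : ℝ) := by
            exact Nat.cast_le.mpr (Finset.card_le_card fun z' hz' => by
              obtain ⟨h3, h4⟩ := Finset.mem_filter.mp hz'
              exact Finset.mem_filter.mpr ⟨(Finset.mem_filter.mp h3).1, h4⟩)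
        _ ≤ _ := h2
        _ ≤ _ := by
            gcongr
            linarith
    · calc _ ≤ Real.exp (n * (δ / 2)) *
            (Real.exp (-(n * (R + 2 * δ - δ / 2))) * (seqs Q n).card) := by gcongr
        _ = _ := by
            rw [← mul_assoc, ← Real.exp_add]
            congr 2
            ring
  refine ⟨Real.exp (-(n * (R + δ))), hne, Real.exp_pos _, ?_, hleft, fun x hx => ?_⟩
  · calc (M n : ℝ) * Real.exp (-(n * (R + δ))) ≤
          Real.exp (n * (R + δ / 2)) * Real.exp (-(n * (R + δ))) := by
          gcongr
          exact hrate.2.1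
      _ = (Real.exp (n * (δ / 2)))⁻¹ := by
          rw [← Real.exp_add, ← Real.exp_neg]
          congr 1
          ring
      _ ≤ _ := by
          rw [one_div]
          exact inv_anti₀ (by norm_num) h16
  · have : ∀ z, farApart d Δ x z ↔ farApart d Δ z x := by
      intro z
      unfold farApart
      rw [← jointEmpirical_swap z x, hdsymm (jointEmpirical z x) (empirical_mem_stdSimplex hn0 _)]
    simp only [this]
    exact hleft x hx

end Code


/-! ### Typical behaviour of the code -/

section Typical

variable {X Y : Type*} [Fintype X] [Fintype Y] {Q : X → ℝ} {d : (X × X → ℝ) → ℝ} {Δ R : ℝ}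
  {M : ℕ → ℕ}

/-- The sequences that have the same joint type with `y` as `x` has. -/
def shell {n : ℕ} (x : Fin n → X) (y : Fin n → Y) : Finset (Fin n → X) :=
  Finset.univ.filter fun x' => jointEmpirical x' y = jointEmpirical x y

theorem mem_shell {n : ℕ} {x x' : Fin n → X} {y : Fin n → Y} :
    x' ∈ shell x y ↔ jointEmpirical x' y = jointEmpirical x y := by
  simp [shell]

theorem shell_subset {n : ℕ} {x : Fin n → X} (hx : x ∈ seqs Q n) (y : Fin n → Y) :
    shell x y ⊆ seqs Q n := by
  intro x' hx'
  rw [mem_seqs, ← margFst_jointEmpirical x' y, mem_shell.mp hx', margFst_jointEmpirical]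
  exact mem_seqs.mp hx

theorem card_seq_le (X : Type*) [Fintype X] (n : ℕ) :
    (Fintype.card (Fin n → X) : ℝ) ≤ Real.exp (n * Fintype.card X) := by
  rw [Fintype.card_fun, Fintype.card_fin, Nat.cast_pow, Real.exp_nat_mul]
  gcongr
  linarith [Real.add_one_le_exp (Fintype.card X : ℝ)]

theorem card_seqs_le (Q : X → ℝ) (n : ℕ) :
    ((seqs Q n).card : ℝ) ≤ Real.exp (n * Fintype.card X) :=
  le_trans (by exact_mod_cast Finset.card_le_univ _) (card_seq_le X n)

/-- A union bound over exponentially many events of doubly exponentially small probability beats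
every exponential rate L. -/
theorem eventually_exp_mul_exp_neg_exp_le (a L : ℝ) {b η : ℝ} (hb : 0 < b) (hη : 0 < η) :
    ∀ᶠ n : ℕ in atTop,
      Real.exp (n * a) * (2 * Real.exp (-(b * Real.exp (n * η)))) ≤ Real.exp (-(n * L)) := by
  filter_upwards [eventually_mul_le_exp (a + 1 + L) hb hη, eventually_le_exp 2 one_pos] with n h1 h2
  calc _ ≤ Real.exp (n * a) * (Real.exp (n * 1) * Real.exp (-(b * Real.exp (n * η)))) := by gcongr
    _ = Real.exp (n * a + (n * 1 + -(b * Real.exp (n * η)))) := by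
        rw [Real.exp_add, Real.exp_add]
    _ ≤ _ := Real.exp_le_exp.mpr (by linarith)

/-- With overwhelming probability every shell of exponentially many expected codewords is
populated. -/
theorem eventually_prob_count_low (hR : 0 < R)
    (hM : Tendsto (fun n => Real.log (M n) / n) (blockLengths Q) (𝓝 R))
    (hs : ∀ᶠ n in blockLengths Q, ∃ κ, Sparse (seqs Q n) (farApart d Δ) (M n) κ)
    {ε η : ℝ} (hη : 0 < η) (hε : 4 * η ≤ ε) (L : ℝ) :
    ∀ᶠ n : ℕ in blockLengths Q, prob (M := M n) (seqs Q n) (farApart d Δ)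
      (fun c => ∃ p ∈ seqs Q n ×ˢ (Finset.univ : Finset (Fin n → Y)),
        mutualInfo (jointEmpirical p.1 p.2) ≤ R - ε ∧
        (countIn (shell p.1 p.2) c : ℝ) <
          Real.exp (n * (R - mutualInfo (jointEmpirical p.1 p.2) - 3 * η))) ≤
      Real.exp (-(n * L)) := by
  filter_upwards [hs, eventually_rate hR hM hη, blockLengths_le Q (eventually_le_exp 8 hη),
    blockLengths_le Q (eventually_card_jointType (A := X) (B := Y) hη),
    blockLengths_le Q (eventually_exp_mul_exp_neg_exp_le (Fintype.card X + Fintype.card Y) L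
      one_pos hη)] with n hsp hrate h8 hcard hfin
  obtain ⟨κ, hsp⟩ := hsp
  have hT : (0 : ℝ) < (seqs Q n).card := by exact_mod_cast hsp.nonempty.card_pos
  refine (prob_exists_le _ _).trans (le_trans ?_ hfin)
  have hterm : ∀ p ∈ seqs Q n ×ˢ (Finset.univ : Finset (Fin n → Y)),
      prob (M := M n) (seqs Q n) (farApart d Δ) (fun c =>
        mutualInfo (jointEmpirical p.1 p.2) ≤ R - ε ∧ (countIn (shell p.1 p.2) c : ℝ) <
          Real.exp (n * (R - mutualInfo (jointEmpirical p.1 p.2) - 3 * η))) ≤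
        2 * Real.exp (-(1 * Real.exp (n * η))) := by
    rintro ⟨x, y⟩ hp
    have hx : x ∈ seqs Q n := (Finset.mem_product.mp hp).1
    dsimp only
    set I := mutualInfo (jointEmpirical x y)
    by_cases hI : I ≤ R - ε
    · have hA := (hcard x y).1
      rw [← seqs_eq_typeOf hx, ← le_div_iff₀ hT] at hA
      change Real.exp (-(n * (I + η))) ≤ ((shell x y).card : ℝ) / (seqs Q n).card at hA
      set p : ℝ := ((shell x y).card : ℝ) / (seqs Q n).card
      have hp0 : 0 < p := (Real.exp_pos _).trans_le hA
      have hpM : Real.exp (n * (R - I - 3 * η)) ≤ p * M n / 8 := by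
        rw [le_div_iff₀ (by norm_num)]
        calc Real.exp (n * (R - I - 3 * η)) * 8 ≤
              Real.exp (n * (R - I - 3 * η)) * Real.exp (n * η) := by gcongr
          _ = Real.exp (-(n * (I + η))) * Real.exp (n * (R - η)) := by
              rw [← Real.exp_add, ← Real.exp_add]
              congr 1
              ring
          _ ≤ _ := by
              gcongr
              exact hrate.1
      -- Here the margin ε ≥ 4η is used: the expected occupancy of the shell is still exponentially
      -- large after all losses.
      have hbig : Real.exp (n * η) ≤ p * M n / 8 := by
        refine le_trans (Real.exp_le_exp.mpr ?_) hpM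
        have : (0 : ℝ) ≤ n := Nat.cast_nonneg n
        gcongr
        linarith
      refine le_trans (prob_mono fun c _ hc => ?_) ((prob_countIn_lt_le hsp (shell_subset hx y) hp0
        (by simp only [p]; field_simp)).trans ?_)
      · exact hc.2.trans_le hpM
      · gcongr
        linarith
    · simp only [hI, false_and]
      simp only [prob, if_false, Finset.sum_const_zero]
      positivity
  refine (Finset.sum_le_card_nsmul _ _ _ hterm).trans ?_
  rw [nsmul_eq_mul, Finset.card_product, Nat.cast_mul, mul_add, Real.exp_add]
  gcongr
  · exact card_seqs_le Q n
  · exact card_seq_le Y n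

/-- With overwhelming probability no shell contains many more codewords than expected. -/
theorem eventually_prob_count_high (hR : 0 < R)
    (hM : Tendsto (fun n => Real.log (M n) / n) (blockLengths Q) (𝓝 R))
    (hs : ∀ᶠ n in blockLengths Q, ∃ κ, Sparse (seqs Q n) (farApart d Δ) (M n) κ)
    {η : ℝ} (hη : 0 < η) (L : ℝ) :
    ∀ᶠ n : ℕ in blockLengths Q, prob (M := M n) (seqs Q n) (farApart d Δ)
      (fun c => ∃ p ∈ seqs Q n ×ˢ (Finset.univ : Finset (Fin n → Y)),
        Real.exp (n * (max (R - mutualInfo (jointEmpirical p.1 p.2)) 0 + 3 * η)) ≤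
          (countIn (shell p.1 p.2) c : ℝ)) ≤
      Real.exp (-(n * L)) := by
  filter_upwards [hs, eventually_rate hR hM hη, blockLengths_le Q (eventually_le_exp 8 hη),
    blockLengths_le Q (eventually_card_jointType (A := X) (B := Y) hη),
    blockLengths_le Q (eventually_exp_mul_exp_neg_exp_le (Fintype.card X + Fintype.card Y) L
      (half_pos one_pos) hη)] with n hsp hrate h8 hcard hfin
  obtain ⟨κ, hsp⟩ := hsp
  have hn : (0 : ℝ) ≤ n := Nat.cast_nonneg n
  refine (prob_exists_le _ _).trans (le_trans ?_ hfin)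
  have hterm : ∀ p ∈ seqs Q n ×ˢ (Finset.univ : Finset (Fin n → Y)),
      prob (M := M n) (seqs Q n) (farApart d Δ) (fun c =>
        Real.exp (n * (max (R - mutualInfo (jointEmpirical p.1 p.2)) 0 + 3 * η)) ≤
          (countIn (shell p.1 p.2) c : ℝ)) ≤
        2 * Real.exp (-(1 / 2 * Real.exp (n * η))) := by
    rintro ⟨x, y⟩ hp
    have hx : x ∈ seqs Q n := (Finset.mem_product.mp hp).1
    dsimp only
    set I := mutualInfo (jointEmpirical x y)
    have hA := (hcard x y).2
    rw [← seqs_eq_typeOf hx] at hA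
    refine (prob_countIn_ge_le hsp (shell x y) _ (Real.exp_pos (-(n * (I - η)))).le
      (le_trans (Nat.cast_le.mpr (Finset.card_le_card (@Finset.inter_subset_right _ (_) _ _))) hA)).trans ?_
    have h1 : 4 * Real.exp (-(n * (I - η))) * M n ≤
        1 / 2 * Real.exp (n * (max (R - I) 0 + 3 * η)) := by
      calc 4 * Real.exp (-(n * (I - η))) * M n ≤
            1 / 2 * (8 * (Real.exp (-(n * (I - η))) * Real.exp (n * (R + η)))) := by
            have := mul_le_mul_of_nonneg_left hrate.2.1 (Real.exp_pos (-(n * (I - η)))).le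
            linarith
        _ ≤ 1 / 2 * (Real.exp (n * η) * (Real.exp (-(n * (I - η))) * Real.exp (n * (R + η)))) := by
            gcongr
        _ ≤ _ := by
            rw [← Real.exp_add, ← Real.exp_add]
            gcongr
            have := mul_le_mul_of_nonneg_left (le_max_left (R - I) 0) hn
            linarith
    have h2 : Real.exp (n * η) ≤ Real.exp (n * (max (R - I) 0 + 3 * η)) := by
      gcongr
      linarith [le_max_right (R - I) 0]
    have h3 := Real.exp_pos (-(1 / 2 * Real.exp (n * η)))
    refine le_trans (Real.exp_le_exp.mpr ?_) (le_mul_of_one_le_left h3.le one_le_two)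
    linarith
  refine (Finset.sum_le_card_nsmul _ _ _ hterm).trans ?_
  rw [nsmul_eq_mul, Finset.card_product, Nat.cast_mul, mul_add, Real.exp_add]
  gcongr
  · exact card_seqs_le Q n
  · exact card_seq_le Y n

/-- With overwhelming probability no joint type is shared by many more pairs of codewords than
expected. -/
theorem eventually_prob_pairCount_high (hR : 0 < R)
    (hM : Tendsto (fun n => Real.log (M n) / n) (blockLengths Q) (𝓝 R))
    (hs : ∀ᶠ n in blockLengths Q, ∃ κ, Sparse (seqs Q n) (farApart d Δ) (M n) κ)
    {η : ℝ} (hη : 0 < η) (L : ℝ) :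
    ∀ᶠ n : ℕ in blockLengths Q, prob (M := M n) (seqs Q n) (farApart d Δ)
      (fun c => ∃ p ∈ seqs Q n ×ˢ seqs Q n,
        Real.exp (n * (max (2 * R - mutualInfo (jointEmpirical p.1 p.2)) 0 + 7 * η)) ≤
          (pairCount (fun u v => jointEmpirical u v = jointEmpirical p.1 p.2) c : ℝ)) ≤
      Real.exp (-(n * L)) := by
  filter_upwards [hs, eventually_rate hR hM hη, blockLengths_le Q (eventually_le_exp 8 hη),
    blockLengths_le Q (eventually_card_jointType (A := X) (B := X) hη),
    blockLengths_le Q (eventually_exp_mul_exp_neg_exp_le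
      (Fintype.card X + Fintype.card X + Fintype.card X) L (half_pos one_pos) hη)]
    with n hsp hrate h8 hcard hfin
  obtain ⟨κ, hsp⟩ := hsp
  have hn : (0 : ℝ) ≤ n := Nat.cast_nonneg n
  refine (prob_exists_le _ _).trans (le_trans ?_ hfin)
  have hterm : ∀ p ∈ seqs Q n ×ˢ seqs Q n,
      prob (M := M n) (seqs Q n) (farApart d Δ) (fun c =>
        Real.exp (n * (max (2 * R - mutualInfo (jointEmpirical p.1 p.2)) 0 + 7 * η)) ≤
          (pairCount (fun u v => jointEmpirical u v = jointEmpirical p.1 p.2) c : ℝ)) ≤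
        Real.exp (n * Fintype.card X) * (2 * Real.exp (-(1 / 2 * Real.exp (n * η)))) := by
    rintro ⟨x, z⟩ hp
    dsimp only
    set P := jointEmpirical x z
    set I := mutualInfo P
    have hsec := fun y => card_section_le (Q := Q) (fun x y => (hcard x y).2) P y
    have hM1 := hrate.2.1
    set q := Real.exp (-(n * (I - η))) with hq
    -- `B` bounds the number of partners that one sequence can typically have in the code, and t ≥
    -- e^{nη} B because [2R-I]_+ ≥ [R-I]_+. Both terms of `prob_pairCount_ge_le` are then doubly
    -- exponentially small.
    set B := Real.exp (n * (max (R - I) 0 + 3 * η)) with hB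
    set t := Real.exp (n * (max (2 * R - I) 0 + 7 * η)) with ht
    have hq0 : 0 < q := Real.exp_pos _
    have hB0 : 0 < B := Real.exp_pos _
    refine (prob_pairCount_ge_le hsp (r := fun u v => jointEmpirical u v = P) hq0.le
      (fun u _ => by convert (hsec u).2) (fun v _ => by convert (hsec v).1) t hB0).trans ?_
    have hmax1 := mul_le_mul_of_nonneg_left (le_max_left (R - I) 0) hn
    have hmax2 := mul_le_mul_of_nonneg_left (le_max_right (R - I) 0) hn
    have hmax3 := mul_le_mul_of_nonneg_left (le_max_left (2 * R - I) 0) hn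
    have hmax4 : n * max (R - I) 0 ≤ n * max (2 * R - I) 0 := by
      gcongr
      linarith
    have h1 : 4 * q * M n ≤ 1 / 2 * B := by
      calc 4 * q * M n ≤ 1 / 2 * (8 * (q * Real.exp (n * (R + η)))) := by
            have := mul_le_mul_of_nonneg_left hM1 hq0.le
            linarith
        _ ≤ 1 / 2 * (Real.exp (n * η) * (q * Real.exp (n * (R + η)))) := by gcongr
        _ ≤ _ := by
            rw [hq, hB, ← Real.exp_add, ← Real.exp_add]
            gcongr
            linarith
    have h2 : 4 * q * (M n : ℝ) ^ 2 ≤ 1 / 2 * t := by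
      calc 4 * q * (M n : ℝ) ^ 2 ≤ 4 * q * (Real.exp (n * (R + η))) ^ 2 := by gcongr
        _ = 1 / 2 * (8 * (q * (Real.exp (n * (R + η))) ^ 2)) := by ring
        _ ≤ 1 / 2 * (Real.exp (n * η) * (q * (Real.exp (n * (R + η))) ^ 2)) := by gcongr
        _ ≤ _ := by
            rw [hq, ht, pow_two, ← Real.exp_add, ← Real.exp_add, ← Real.exp_add]
            gcongr
            have : 0 ≤ n * η := by positivity
            linarith
    have h3 : Real.exp (n * η) ≤ B := by
      rw [hB]
      have : 0 ≤ n * η := by positivity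
      exact Real.exp_le_exp.mpr (by linarith)
    have h4 : Real.exp (n * η) * B ≤ t := by
      rw [hB, ht, ← Real.exp_add]
      have : 0 ≤ n * η := by positivity
      exact Real.exp_le_exp.mpr (by linarith)
    have hone : 1 ≤ Real.exp (n * Fintype.card X) := Real.one_le_exp (by positivity)
    have e1 : Real.exp (4 * q * M n - B) ≤ Real.exp (-(1 / 2 * Real.exp (n * η))) :=
      Real.exp_le_exp.mpr (by linarith)
    have e2 : Real.exp ((4 * q * (M n : ℝ) ^ 2 - t) / B) ≤
        Real.exp (-(1 / 2 * Real.exp (n * η))) := by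
      refine Real.exp_le_exp.mpr ?_
      rw [div_le_iff₀ hB0]
      linarith
    have e3 := Real.exp_pos (-(1 / 2 * Real.exp (n * η)))
    calc _ ≤ Real.exp (n * Fintype.card X) * Real.exp (-(1 / 2 * Real.exp (n * η))) +
          1 * Real.exp (-(1 / 2 * Real.exp (n * η))) := by
          rw [one_mul]
          refine add_le_add (mul_le_mul (card_seqs_le Q n) e1 (Real.exp_pos _).le
            (Real.exp_pos _).le) e2
      _ ≤ _ := by nlinarith
  refine (Finset.sum_le_card_nsmul _ _ _ hterm).trans ?_
  rw [nsmul_eq_mul, Finset.card_product, Nat.cast_mul, mul_add, mul_add, Real.exp_add,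
    Real.exp_add, mul_assoc (Real.exp _ * Real.exp _)]
  gcongr
  · exact card_seqs_le Q n
  · exact card_seqs_le Q n

end Typical

/-! ### The error probability of a code -/

section ErrorProb

variable {X Y : Type*} [Fintype X] [Fintype Y] {n M : ℕ} {W : X → Y → ℝ} {g : (X × Y → ℝ) → ℝ}

/-- The normalization of the likelihood decoder at the channel output `y`. -/
def decoderSum (g : (X × Y → ℝ) → ℝ) (c : Code X M n) (y : Fin n → Y) : ℝ :=
  ∑ k, Real.exp (n * g (jointEmpirical (c k) y))

/-- The contribution of a pair of codewords to the error probability. -/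
def pairError (W : X → Y → ℝ) (g : (X × Y → ℝ) → ℝ) (c : Code X M n) (m m' : Fin M) : ℝ :=
  ∑ y : Fin n → Y, (∏ i, W (c m i) (y i)) *
    (Real.exp (n * g (jointEmpirical (c m') y)) / decoderSum g c y)

theorem errorProb_eq (c : Code X M n) :
    errorProb W g c = 1 / (M : ℝ) *
      ∑ p ∈ Finset.univ.filter (fun p : Fin M × Fin M => p.1 ≠ p.2), pairError W g c p.1 p.2 := by
  unfold errorProb pairError decoderSum
  congr 1
  rw [Finset.sum_filter, Fintype.sum_prod_type]
  refine Finset.sum_congr rfl fun m _ => ?_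
  rw [← Finset.sum_filter]
  refine Finset.sum_congr ?_ fun _ _ => rfl
  ext m'
  simp [eq_comm]

theorem decoderSum_nonneg (c : Code X M n) (y : Fin n → Y) : 0 ≤ decoderSum g c y :=
  Finset.sum_nonneg fun _ _ => (Real.exp_pos _).le

theorem le_decoderSum (c : Code X M n) (y : Fin n → Y) (k : Fin M) :
    Real.exp (n * g (jointEmpirical (c k) y)) ≤ decoderSum g c y :=
  Finset.single_le_sum (f := fun k => Real.exp (n * g (jointEmpirical (c k) y)))
    (fun _ _ => (Real.exp_pos _).le) (Finset.mem_univ k)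

theorem pairError_nonneg (hW : ∀ x y, 0 ≤ W x y) (c : Code X M n) (m m' : Fin M) :
    0 ≤ pairError W g c m m' :=
  Finset.sum_nonneg fun y _ => mul_nonneg (Finset.prod_nonneg fun _ _ => hW _ _)
    (div_nonneg (Real.exp_pos _).le (decoderSum_nonneg c y))

/-- Positivity makes the logarithm in `errorExponent` genuine; at error probability 0 the convention
log 0 = 0 would give exponent 0. -/
theorem errorProb_pos (hW : ∀ x, W x ∈ stdSimplex ℝ Y) (hM : 2 ≤ M) (c : Code X M n) :
    0 < errorProb W g c := by
  have hM0 : (0 : ℝ) < M := by exact_mod_cast (by omega : 0 < M)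
  have hW0 : ∀ x y, 0 ≤ W x y := fun x y => (hW x).1 y
  have hy : ∀ x, ∃ y, 0 < W x y := by
    intro x
    by_contra h
    push Not at h
    have h1 : ∑ y, W x y = 0 := Finset.sum_eq_zero fun y _ => le_antisymm (h y) (hW0 x y)
    linarith [(hW x).2]
  choose f hf using hy
  rw [errorProb_eq]
  refine mul_pos (by positivity) ?_
  have hne : ((⟨0, by omega⟩ : Fin M), (⟨1, by omega⟩ : Fin M)) ∈
      Finset.univ.filter (fun p : Fin M × Fin M => p.1 ≠ p.2) := by simp
  refine Finset.sum_pos' (fun p _ => pairError_nonneg hW0 c _ _) ⟨_, hne, ?_⟩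
  refine Finset.sum_pos' (fun y _ => mul_nonneg (Finset.prod_nonneg fun _ _ => hW0 _ _)
    (div_nonneg (Real.exp_pos _).le (decoderSum_nonneg c y)))
    ⟨fun i => f (c ⟨0, by omega⟩ i), Finset.mem_univ _, ?_⟩
  exact mul_pos (Finset.prod_pos fun i _ => hf _) (div_pos (Real.exp_pos _)
    ((Real.exp_pos _).trans_le (le_decoderSum c _ ⟨0, by omega⟩)))

theorem exp_le_errorProb (hW : ∀ x, W x ∈ stdSimplex ℝ Y) (hn : 0 < n) (hM : 2 ≤ M)
    {c : Code X M n} {E₀ : ℝ} (h : errorExponent W g c ≤ E₀) :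
    Real.exp (-(n * E₀)) ≤ errorProb W g c := by
  have hn' : (0 : ℝ) < n := by exact_mod_cast hn
  rw [← Real.le_log_iff_exp_le (errorProb_pos hW hM c)]
  unfold errorExponent at h
  have h1 : -Real.log (errorProb W g c) / n ≤ E₀ := by
    refine le_trans (le_of_eq ?_) h
    ring
  rw [div_le_iff₀ hn'] at h1
  linarith

theorem errorExponent_le (hn : 0 < n) {c : Code X M n} {E₀ : ℝ}
    (h : Real.exp (-(n * E₀)) ≤ errorProb W g c) : errorExponent W g c ≤ E₀ := by
  have hn' : (0 : ℝ) < n := by exact_mod_cast hn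
  rw [← Real.le_log_iff_exp_le ((Real.exp_pos _).trans_le h)] at h
  unfold errorExponent
  have h1 : -Real.log (errorProb W g c) / n ≤ E₀ := by
    rw [div_le_iff₀ hn']
    linarith
  refine le_trans (le_of_eq ?_) h1
  ring

/-- The contribution of a pair of codewords is governed by their joint type. -/
theorem pairError_le (hW : ∀ x y, 0 ≤ W x y) {Q : X → ℝ} {R η η' F : ℝ} {c : Code X M n}
    {m m' : Fin M}
    (hden : ∀ y, Real.exp (n * (alpha g Q R (empirical y) - η')) ≤ decoderSum g c y) (hη' : 0 ≤ η')
    (htypes : ((Finset.univ.image fun x : Fin n → X × X × Y => empirical x).card : ℝ) ≤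
      Real.exp (n * η))
    (hsum : ∀ y : Fin n → Y, (∀ i, W (c m i) (y i) ≠ 0) →
      ∑ y' ∈ Finset.univ.filter (fun y' : Fin n → Y =>
        tripleType (c m) (c m') y' = tripleType (c m) (c m') y), ∏ i, W (c m i) (y' i) ≤
        Real.exp (-(n * (channelExp W (tripleType (c m) (c m') y) - η))))
    (hF : ∀ y : Fin n → Y, (∀ i, W (c m i) (y i) ≠ 0) →
      F ≤ channelExp W (tripleType (c m) (c m') y) +
        max (max (g (jointEmpirical (c m) y)) (alpha g Q R (empirical y)) -
          g (jointEmpirical (c m') y)) 0) :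
    pairError W g c m m' ≤ Real.exp (-(n * (F - 2 * η - η'))) := by
  have hn : (0 : ℝ) ≤ n := Nat.cast_nonneg n
  -- The denominator is bounded below in three ways: by its terms for `m` and for `m'`, and by the
  -- bulk term involving α. The best of the three produces the positive part in Γ.
  have hratio : ∀ y, Real.exp (n * g (jointEmpirical (c m') y)) / decoderSum g c y ≤
      Real.exp (-(n * (max (max (g (jointEmpirical (c m) y)) (alpha g Q R (empirical y)) -
          g (jointEmpirical (c m') y)) 0 - η'))) := by
    intro y
    have hpos := (Real.exp_pos _).trans_le (hden y)
    have h1 := le_decoderSum (g := g) c y m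
    have h2 := le_decoderSum (g := g) c y m'
    have h3 := hden y
    rw [div_le_iff₀ hpos]
    rw [← Real.le_log_iff_exp_le hpos] at h1 h2 h3
    rw [← Real.exp_log hpos, ← Real.exp_add]
    refine Real.exp_le_exp.mpr ?_
    have hη'n : 0 ≤ n * η' := by positivity
    rcases le_total (max (g (jointEmpirical (c m) y)) (alpha g Q R (empirical y)) -
          g (jointEmpirical (c m') y)) 0 with h | h
    · rw [max_eq_right h]
      linarith
    · rw [max_eq_left h]
      rcases le_total (g (jointEmpirical (c m) y)) (alpha g Q R (empirical y)) with h' | h'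
      · rw [max_eq_right h']
        linarith
      · rw [max_eq_left h']
        linarith
  have key := sum_le_card_mul (s := Finset.univ)
    (t := Finset.univ.image fun x : Fin n → X × X × Y => empirical x)
    (φ := fun y => tripleType (c m) (c m') y)
    (f := fun y => (∏ i, W (c m i) (y i)) *
      (Real.exp (n * g (jointEmpirical (c m') y)) / decoderSum g c y))
    (V := Real.exp (-(n * (F - η - η'))))
    (fun y _ => Finset.mem_image.mpr ⟨_, Finset.mem_univ _, rfl⟩) (fun y _ => ?_)
    (Real.exp_pos _).le
  · calc pairError W g c m m' ≤ _ := key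
      _ ≤ Real.exp (n * η) * Real.exp (-(n * (F - η - η'))) := by gcongr
      _ = _ := by
          rw [← Real.exp_add]
          congr 1
          ring
  · have hsame : ∀ y' ∈ Finset.univ.filter (fun y' : Fin n → Y =>
        tripleType (c m) (c m') y' = tripleType (c m) (c m') y),
        jointEmpirical (c m) y' = jointEmpirical (c m) y ∧
        jointEmpirical (c m') y' = jointEmpirical (c m') y ∧ empirical y' = empirical y := by
      intro y' hy'
      have h := (Finset.mem_filter.mp hy').2
      refine ⟨?_, ?_, ?_⟩
      · rw [← lawXY_tripleType _ (c m') y', h, lawXY_tripleType]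
      · rw [← lawX'Y_tripleType (c m) _ y', h, lawX'Y_tripleType]
      · rw [← lawY_tripleType (c m) (c m') y', h, lawY_tripleType]
    by_cases hpos : ∀ i, W (c m i) (y i) ≠ 0
    · set A := max (max (g (jointEmpirical (c m) y)) (alpha g Q R (empirical y)) -
          g (jointEmpirical (c m') y)) 0
      calc _ ≤ ∑ y' ∈ Finset.univ.filter (fun y' : Fin n → Y =>
            tripleType (c m) (c m') y' = tripleType (c m) (c m') y),
            (∏ i, W (c m i) (y' i)) * Real.exp (-(n * (A - η'))) := by
            refine Finset.sum_le_sum fun y' hy' => mul_le_mul_of_nonneg_left ?_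
              (Finset.prod_nonneg fun _ _ => hW _ _)
            have h := hratio y'
            obtain ⟨e1, e2, e3⟩ := hsame y' hy'
            rw [e1, e2, e3] at h
            rw [e2]
            exact h
        _ ≤ Real.exp (-(n * (channelExp W (tripleType (c m) (c m') y) - η))) *
            Real.exp (-(n * (A - η'))) := by
            rw [← Finset.sum_mul]
            gcongr
            exact hsum y hpos
        _ ≤ _ := by
            rw [← Real.exp_add]
            refine Real.exp_le_exp.mpr ?_
            have := mul_le_mul_of_nonneg_left (hF y hpos) hn
            linarith
    -- An impossible input-output letter pair recurs in every output of the same joint type, so the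
    -- whole class has probability zero.
    · push Not at hpos
      obtain ⟨i, hi⟩ := hpos
      refine le_trans (le_of_eq (Finset.sum_eq_zero fun y' hy' => ?_)) (Real.exp_pos _).le
      obtain ⟨j, hj1, hj2⟩ := jointEmpirical_ne_zero_iff.mp
        ((hsame y' hy').1 ▸ jointEmpirical_ne_zero_iff.mpr ⟨i, rfl, rfl⟩ :
          jointEmpirical (c m) y' (c m i, y i) ≠ 0)
      rw [Finset.prod_eq_zero (Finset.mem_univ j) (by rw [hj1, hj2, hi]), zero_mul]

theorem card_offdiag_le_pairCount {S : Type*} (r : S → S → Prop) (c : Fin M → S) :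
    ((Finset.univ.filter fun p : Fin M × Fin M => p.1 ≠ p.2).filter
      fun p => r (c p.1) (c p.2)).card ≤ pairCount r c + pairCount (fun u v => r v u) c := by
  unfold pairCount
  have h : ((Finset.univ.filter fun p : Fin M × Fin M => p.1 ≠ p.2).filter
      fun p => r (c p.1) (c p.2)) ⊆
      (Finset.univ.filter fun p : Fin M × Fin M => p.1 < p.2 ∧ r (c p.1) (c p.2)) ∪
      (Finset.univ.filter fun p : Fin M × Fin M => p.1 < p.2 ∧ r (c p.2) (c p.1)).image
        Prod.swap := by
    rintro ⟨i, j⟩ hp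
    simp only [Finset.mem_filter, Finset.mem_univ, true_and] at hp
    rcases lt_or_gt_of_ne hp.1 with h | h
    · exact Finset.mem_union_left _ (by simpa using ⟨h, hp.2⟩)
    · exact Finset.mem_union_right _ (Finset.mem_image.mpr
        ⟨(j, i), by simpa using ⟨h, hp.2⟩, rfl⟩)
  exact (Finset.card_le_card h).trans ((Finset.card_union_le _ _).trans
    (Nat.add_le_add_left Finset.card_image_le _))

end ErrorProb


/-! ### The upper bound on the lower tail -/

section Upper

variable {X Y : Type*} [Fintype X] [Fintype Y] {W : X → Y → ℝ} {g : (X × Y → ℝ) → ℝ} {Q : X → ℝ}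
  {d : (X × X → ℝ) → ℝ} {Δ R : ℝ}

theorem countIn_mul_le_decoderSum {M n : ℕ} (c : Code X M n) (x : Fin n → X) (y : Fin n → Y) :
    countIn (shell x y) c * Real.exp (n * g (jointEmpirical x y)) ≤ decoderSum g c y := by
  rw [countIn_eq_sum, Finset.sum_mul]
  refine Finset.sum_le_sum fun k _ => ?_
  split_ifs with h
  · rw [one_mul, mem_shell.mp h]
  · rw [zero_mul]
    exact (Real.exp_pos _).le

/-- A joint type outside `ℒ` has a large pairwise error exponent. -/
theorem lt_of_not_mem_setL {E : ℝ} {n : ℕ} {x x' : Fin n → X} {y : Fin n → Y} (hn : 0 < n)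
    (hP : jointEmpirical x x' ∈ couplings Q Q) (hd : Δ < d (jointEmpirical x x'))
    (hL : jointEmpirical x x' ∉ setL W g Q d Δ R E) (hpos : ∀ i, W (x i) (y i) ≠ 0) :
    max (2 * R - mutualInfo (jointEmpirical x x')) 0 - R + E < channelExp W (tripleType x x' y) +
      max (max (g (jointEmpirical x y)) (alpha g Q R (empirical y)) -
        g (jointEmpirical x' y)) 0 := by
  have hJ : tripleType x x' y ∈ stdSimplex ℝ (X × X × Y) := empirical_mem_stdSimplex hn _
  have hlt : ¬ (Gam W g Q (jointEmpirical x x') R + ((R - E : ℝ) : EReal) ≤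
      ((max (2 * R - mutualInfo (jointEmpirical x x')) 0 : ℝ) : EReal)) :=
    fun h => hL ⟨hP, hd, h⟩
  have hGam : Gam W g Q (jointEmpirical x x') R ≤ ((channelExp W (tripleType x x' y) +
      max (max (g (jointEmpirical x y)) (alpha g Q R (empirical y)) -
        g (jointEmpirical x' y)) 0 : ℝ) : EReal) := by
    refine (iInf₂_le (tripleType x x' y) ⟨hJ, lawXX'_tripleType x x' y⟩).trans (le_of_eq ?_)
    rw [condDiv_add_condMutualInfo hJ.1, lawXY_tripleType, lawX'Y_tripleType, lawY_tripleType]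
    intro a b hab
    rw [lawXY_tripleType] at hab
    obtain ⟨i, rfl, rfl⟩ := jointEmpirical_ne_zero_iff.mp hab
    exact hpos i
  by_contra hle
  push Not at hle
  refine hlt ((add_le_add_left hGam _).trans ?_)
  rw [← EReal.coe_add]
  exact EReal.coe_le_coe_iff.mpr (by linarith)

/-- The error probability of a code that behaves typically. -/
theorem errorProb_le_of_typical (hW : ∀ x y, 0 ≤ W x y) {M n : ℕ} (hn : 0 < n) {η η' E : ℝ}
    {c : Code X M n} (hη' : 0 ≤ η') (hrate : Real.exp (n * (R - η)) ≤ M)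
    (hden : ∀ y, Real.exp (n * (alpha g Q R (empirical y) - η')) ≤ decoderSum g c y)
    (htypes : ((Finset.univ.image fun x : Fin n → X × X × Y => empirical x).card : ℝ) ≤
      Real.exp (n * η))
    (htypes' : ((Finset.univ.image fun x : Fin n → X × X => empirical x).card : ℝ) ≤
      Real.exp (n * η))
    (h2 : 2 ≤ Real.exp (n * η))
    (hsum : ∀ (x x' : Fin n → X) (y : Fin n → Y), (∀ i, W (x i) (y i) ≠ 0) →
      ∑ y' ∈ Finset.univ.filter (fun y' : Fin n → Y => tripleType x x' y' = tripleType x x' y),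
        ∏ i, W (x i) (y' i) ≤ Real.exp (-(n * (channelExp W (tripleType x x' y) - η))))
    (hc : ∀ i, c i ∈ seqs Q n)
    (hpair : ∀ x ∈ seqs Q n, ∀ x' ∈ seqs Q n,
      (pairCount (fun u v : Fin n → X => jointEmpirical u v = jointEmpirical x x') c : ℝ) ≤
        Real.exp (n * (max (2 * R - mutualInfo (jointEmpirical x x')) 0 + 7 * η)))
    (hfar : ∀ i j, i ≠ j → Δ < d (jointEmpirical (c i) (c j)))
    (hL : ∀ i j, i ≠ j → jointEmpirical (c i) (c j) ∉ setL W g Q d Δ R E) :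
    errorProb W g c ≤ Real.exp (-(n * (E - 12 * η - η'))) := by
  have hM0 : (0 : ℝ) < M := (Real.exp_pos _).trans_le hrate
  -- The pairs are grouped by joint type. With D = [2R-I]_+, a class has at most 2e^{n(D+7η)} pairs,
  -- each contributing at most e^{-n(D-R+E-2η-η')} since its type is outside ℒ; D cancels. The
  -- number of types and the division by M cost η each.
  have key := sum_le_card_mul (s := Finset.univ.filter fun p : Fin M × Fin M => p.1 ≠ p.2)
    (t := Finset.univ.image fun x : Fin n → X × X => empirical x)
    (φ := fun p => jointEmpirical (c p.1) (c p.2))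
    (f := fun p => pairError W g c p.1 p.2)
    (V := Real.exp (n * (R - E + 10 * η + η')))
    (fun p _ => Finset.mem_image.mpr ⟨_, Finset.mem_univ _, rfl⟩) (fun p hp => ?_)
    (Real.exp_pos _).le
  · rw [errorProb_eq, one_div, inv_mul_le_iff₀ hM0]
    refine key.trans ?_
    calc _ ≤ Real.exp (n * η) * Real.exp (n * (R - E + 10 * η + η')) := by gcongr
      _ = Real.exp (n * (R - η)) * Real.exp (-(n * (E - 12 * η - η'))) := by
          rw [← Real.exp_add, ← Real.exp_add]
          congr 1
          ring
      _ ≤ _ := by gcongr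
  · obtain ⟨i, j⟩ := p
    set P := jointEmpirical (c i) (c j) with hP
    set D := max (2 * R - mutualInfo P) 0 with hD
    have hcard : (((Finset.univ.filter fun p : Fin M × Fin M => p.1 ≠ p.2).filter
        fun p => jointEmpirical (c p.1) (c p.2) = P).card : ℝ) ≤
        2 * Real.exp (n * (D + 7 * η)) := by
      have h := card_offdiag_le_pairCount (fun u v : Fin n → X => jointEmpirical u v = P) c
      have h1 := hpair _ (hc i) _ (hc j)
      have h3 := hpair _ (hc j) _ (hc i)
      rw [mutualInfo_jointEmpirical_comm (c i) (c j)] at h3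
      have hswap : (fun u v : Fin n → X => jointEmpirical u v = jointEmpirical (c j) (c i)) =
          fun u v => jointEmpirical v u = P := by
        funext u v
        exact propext (jointEmpirical_swap_eq_iff _ _ _ _)
      rw [hswap] at h3
      have h' : (((Finset.univ.filter fun p : Fin M × Fin M => p.1 ≠ p.2).filter
        fun p => jointEmpirical (c p.1) (c p.2) = P).card : ℝ) ≤
        pairCount (fun u v : Fin n → X => jointEmpirical u v = P) c +
          pairCount (fun u v : Fin n → X => jointEmpirical v u = P) c := by
        rw [← Nat.cast_add]
        exact Nat.cast_le.mpr (le_trans (le_of_eq (by congr!)) h)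
      linarith
    have hterm : ∀ p ∈ (Finset.univ.filter fun p : Fin M × Fin M => p.1 ≠ p.2).filter
        (fun p => jointEmpirical (c p.1) (c p.2) = P),
        pairError W g c p.1 p.2 ≤ Real.exp (-(n * (D - R + E - 2 * η - η'))) := by
      rintro ⟨k, l⟩ hkl
      obtain ⟨hkl1, hkl2⟩ := Finset.mem_filter.mp hkl
      have hne : k ≠ l := (Finset.mem_filter.mp hkl1).2
      have hkl2 : jointEmpirical (c k) (c l) = P := hkl2
      refine pairError_le hW hden hη' htypes (fun y => hsum _ _ y) fun y hy => ?_
      rw [hD, ← hkl2]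
      refine (lt_of_not_mem_setL hn ?_ (hfar k l hne) (hL k l hne) hy).le
      have := jointEmpirical_mem_couplings hn (c k) (c l)
      rwa [mem_seqs.mp (hc k), mem_seqs.mp (hc l)] at this
    refine (Finset.sum_le_card_nsmul _ _ _ hterm).trans ?_
    rw [nsmul_eq_mul]
    calc _ ≤ 2 * Real.exp (n * (D + 7 * η)) * Real.exp (-(n * (D - R + E - 2 * η - η'))) := by
          gcongr
      _ ≤ Real.exp (n * η) * Real.exp (n * (D + 7 * η)) *
          Real.exp (-(n * (D - R + E - 2 * η - η'))) := by gcongr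
      _ = _ := by
          rw [← Real.exp_add, ← Real.exp_add]
          congr 1
          ring

/-- It is unlikely that the code contains a pair whose joint type lies in a set of joint types of
mutual information well above `2 R`. -/
theorem eventually_prob_exists_pair_le {M : ℕ → ℕ} (hR : 0 < R)
    (hM : Tendsto (fun n => Real.log (M n) / n) (blockLengths Q) (𝓝 R))
    (hs : ∀ᶠ n in blockLengths Q, ∃ κ, Sparse (seqs Q n) (farApart d Δ) (M n) κ)
    {S : Set (X × X → ℝ)} {L η : ℝ} (hη : 0 < η) (hS : ∀ P ∈ S, L ≤ mutualInfo P - 2 * R) :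
    ∀ᶠ n : ℕ in blockLengths Q, prob (M := M n) (seqs Q n) (farApart d Δ)
      (fun c => ∃ P ∈ (Finset.univ.image fun x : Fin n → X × X => empirical x).filter (· ∈ S),
        0 < pairCount (fun u v : Fin n → X => jointEmpirical u v = P) c ∨
        0 < pairCount (fun u v : Fin n → X => jointEmpirical v u = P) c) ≤
      Real.exp (-(n * (L - 5 * η))) := by
  filter_upwards [hs, eventually_rate hR hM hη, blockLengths_le Q (eventually_le_exp 4 hη),
    blockLengths_le Q (eventually_types_le (A := X × X) hη),
    blockLengths_le Q (eventually_card_jointType (A := X) (B := X) hη)]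
    with n hsp hrate h4 htypes hcard
  obtain ⟨κ, hsp⟩ := hsp
  have hn : (0 : ℝ) ≤ n := Nat.cast_nonneg n
  refine (prob_exists_le _ _).trans ?_
  have hterm : ∀ P ∈ (Finset.univ.image fun x : Fin n → X × X => empirical x).filter (· ∈ S),
      prob (M := M n) (seqs Q n) (farApart d Δ) (fun c =>
        0 < pairCount (fun u v : Fin n → X => jointEmpirical u v = P) c ∨
        0 < pairCount (fun u v : Fin n → X => jointEmpirical v u = P) c) ≤
        Real.exp (n * η) * Real.exp (-(n * (L - 3 * η))) := by
    intro P hP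
    have hI := hS P (Finset.mem_filter.mp hP).2
    have hsec := fun y => card_section_le (Q := Q) (fun x y => (hcard x y).2) P y
    have hq0 := (Real.exp_pos (-(n * (mutualInfo P - η)))).le
    refine (prob_or_le _ _).trans ((add_le_add
      (prob_pairCount_pos_le hsp hq0 fun x _ => by convert (hsec x).2)
      (prob_pairCount_pos_le hsp hq0 fun x _ => by convert (hsec x).1)).trans ?_)
    calc _ = 4 * (Real.exp (-(n * (mutualInfo P - η))) * (M n : ℝ) ^ 2) := by ring
      _ ≤ Real.exp (n * η) *
          (Real.exp (-(n * (mutualInfo P - η))) * (Real.exp (n * (R + η))) ^ 2) := by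
          gcongr
          exact hrate.2.1
      _ ≤ _ := by
          rw [pow_two, ← Real.exp_add, ← Real.exp_add, ← Real.exp_add, ← Real.exp_add]
          refine Real.exp_le_exp.mpr ?_
          have := mul_le_mul_of_nonneg_left hI hn
          linarith
  refine (Finset.sum_le_card_nsmul _ _ _ hterm).trans ?_
  rw [nsmul_eq_mul]
  have hle : (((Finset.univ.image fun x : Fin n → X × X => empirical x).filter (· ∈ S)).card : ℝ) ≤
      Real.exp (n * η) := le_trans (by exact_mod_cast Finset.card_filter_le _ _) htypes
  calc _ ≤ Real.exp (n * η) * (Real.exp (n * η) * Real.exp (-(n * (L - 3 * η)))) := by gcongr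
    _ = _ := by
        rw [← Real.exp_add, ← Real.exp_add]
        congr 1
        ring

theorem pairCount_pos {S : Type*} {M : ℕ} {r : S → S → Prop} {c : Fin M → S} {i j : Fin M}
    (hij : i < j) (hr : r (c i) (c j)) : 0 < pairCount r c :=
  Finset.card_pos.mpr ⟨(i, j), Finset.mem_filter.mpr ⟨Finset.mem_univ _, hij, hr⟩⟩

/-- Three bad events are set aside: an underpopulated shell, a joint type with too many pairs, and a
pair of codewords whose type lies in ℒ(R, E). The first two are super-exponentially unlikely and the
third has the claimed exponent. For all other codes the error probability is below e^{-nE₀}. -/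
theorem eventually_lowerTail_le (hW : ∀ x, W x ∈ stdSimplex ℝ Y)
    (hg : ContinuousOn g (stdSimplex ℝ (X × Y)))
    (hdsymm : ∀ P ∈ stdSimplex ℝ (X × X), d (fun p => P p.swap) = d P)
    {M : ℕ → ℕ} (hR : 0 < R)
    (hM : Tendsto (fun n => Real.log (M n) / n) (blockLengths Q) (𝓝 R))
    (hkey : ∃ δ > 0, ∀ n, ∀ P ∈ jointTypes Q n, d P ≤ Δ → R ≤ mutualInfo P - 2 * δ)
    {E₀ E L : ℝ} (hE : E₀ < E) (hL : (L : EReal) < Eub W g Q d Δ R E) :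
    ∀ᶠ n : ℕ in blockLengths Q, prob (M := M n) (seqs Q n) (farApart d Δ)
      (fun c => errorExponent W g c ≤ E₀) ≤ Real.exp (-(n * L)) := by
  have hs := eventually_sparse hdsymm hR hM hkey
  -- For negative L the bound exceeds 1. For L ≥ 0 the positive part in the exponent can be dropped,
  -- as L' > 0.
  rcases lt_or_ge L 0 with hL0 | hL0
  · filter_upwards [hs] with n hsp
    obtain ⟨κ, hsp⟩ := hsp
    have h1 : prob (M := M n) (seqs Q n) (farApart d Δ) (fun c => errorExponent W g c ≤ E₀) ≤ 1 := by
      refine le_trans (Finset.sum_le_sum fun c _ => ?_) (sum_tupleProb_le_one hsp)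
      split_ifs
      exacts [le_rfl, tupleProb_nonneg c]
    refine h1.trans (Real.one_le_exp ?_)
    have : (0 : ℝ) ≤ n := Nat.cast_nonneg n
    nlinarith
  obtain ⟨L', hL1, hL2⟩ := EReal.lt_iff_exists_real_btwn.mp hL
  have hL1 : L < L' := EReal.coe_lt_coe_iff.mp hL1
  have hS : ∀ P ∈ setL W g Q d Δ R E, L' ≤ mutualInfo P - 2 * R := by
    intro P hP
    have h := hL2.le.trans (iInf₂_le P hP)
    rcases le_max_iff.mp (EReal.coe_le_coe_iff.mp h) with h | h
    · exact h
    · linarith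
  set e := E - E₀ with he
  have he0 : 0 < e := by simp only [he]; linarith
  -- The order of choices matters: the gap e fixes the accuracy for α, which determines ε, and only
  -- then η. The total loss 12η + (e/8 + 3η) is at most e/2, and 5η plus the factor 3 fits into L' -
  -- L.
  obtain ⟨ε, hε, N₀, hα⟩ := exists_seq_alpha (Q := Q) hg hR (η := e / 8) (by positivity)
  set η := min (min (ε / 4) (e / 40)) ((L' - L) / 6) with hηdef
  have hη : 0 < η := by
    have : 0 < L' - L := by linarith
    simp only [hηdef]
    positivity
  have hη1 : 4 * η ≤ ε := by
    have : η ≤ ε / 4 := (min_le_left _ _).trans (min_le_left _ _)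
    linarith
  have hη2 : 40 * η ≤ e := by
    have : η ≤ e / 40 := (min_le_left _ _).trans (min_le_right _ _)
    linarith
  have hη3 : 6 * η ≤ L' - L := by
    have : η ≤ (L' - L) / 6 := min_le_right _ _
    linarith
  have hW0 : ∀ x y, 0 ≤ W x y := fun x y => (hW x).1 y
  filter_upwards [eventually_rate hR hM hη, blockLengths_le Q (eventually_le_exp 2 hη),
    blockLengths_le Q (eventually_le_exp 3 hη), blockLengths_le Q (eventually_gt_atTop 0),
    blockLengths_le Q (eventually_ge_atTop N₀), eventually_blockLengths_nonempty Q,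
    blockLengths_le Q (eventually_types_le (A := X × X × Y) hη),
    blockLengths_le Q (eventually_types_le (A := X × X) hη),
    blockLengths_le Q (eventually_sum_prod_tripleType hW0 hη),
    eventually_prob_count_low (Y := Y) hR hM hs hη hη1 L',
    eventually_prob_pairCount_high hR hM hs hη L',
    eventually_prob_exists_pair_le hR hM hs hη hS]
    with n hrate h2 h3 hn hN hne htypes htypes' hsum hbad1 hbad2 hbad3
  have hn' : (0 : ℝ) < n := by exact_mod_cast hn
  refine le_trans ((prob_mono fun c hc hexp => ?_).trans ((prob_or_le _ _).trans
    (add_le_add hbad1 ((prob_or_le _ _).trans (add_le_add hbad2 hbad3))))) ?_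
  · by_contra hgood
    push Not at hgood
    obtain ⟨hg1, hg2, hg3⟩ := hgood
    have hcT : ∀ i, c i ∈ seqs Q n := fun i => avail_subset c i (hc i)
    have hfar : ∀ i j, i ≠ j → Δ < d (jointEmpirical (c i) (c j)) := by
      intro i j hij
      rcases lt_or_gt_of_ne hij with h | h
      · have h1 := (Finset.mem_filter.mp (hc j)).2 i h
        unfold farApart at h1
        have h2 := hdsymm (jointEmpirical (c i) (c j)) (empirical_mem_stdSimplex hn _)
        rw [jointEmpirical_swap] at h2
        rwa [h2] at h1
      · exact (Finset.mem_filter.mp (hc i)).2 j h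
    have hbound := errorProb_le_of_typical (W := W) (g := g) (Q := Q) (d := d) (Δ := Δ) (R := R)
      (E := E) (η := η) (η' := e / 8 + 3 * η) (c := c) hW0 hn (by positivity) hrate.1 ?_ htypes
      htypes' h2 (fun x x' y hy => (hsum x x' y hy).2) hcT
      (fun x hx x' hx' => (hg2 (x, x') (Finset.mem_product.mpr ⟨hx, hx'⟩)).le) hfar ?_
    · have hlow := exp_le_errorProb hW hn hrate.2.2 hexp
      have h := Real.exp_le_exp.mp (hlow.trans hbound)
      have : n * E₀ < n * (E - 12 * η - (e / 8 + 3 * η)) := by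
        gcongr
        linarith
      linarith
    · intro y
      obtain ⟨x₀, hx₀⟩ := hne
      obtain ⟨x, hx, hI, hxα⟩ := hα n hN hn x₀ y (mem_seqs.mp hx₀)
      have h1 := hg1 (x, y) (Finset.mem_product.mpr ⟨mem_seqs.mpr hx, Finset.mem_univ _⟩) hI
      refine le_trans ?_ (countIn_mul_le_decoderSum c x y)
      refine le_trans ?_ (mul_le_mul_of_nonneg_right h1 (Real.exp_pos _).le)
      rw [← Real.exp_add]
      refine Real.exp_le_exp.mpr ?_
      have := mul_le_mul_of_nonneg_left hxα hn'.le
      dsimp only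
      linarith
    · intro i j hij hmem
      have hP := hg3 (jointEmpirical (c i) (c j)) (Finset.mem_filter.mpr
        ⟨Finset.mem_image.mpr ⟨_, Finset.mem_univ _, rfl⟩, hmem⟩)
      rcases lt_or_gt_of_ne hij with h | h
      · have : 0 < pairCount (fun u v : Fin n → X => jointEmpirical u v = jointEmpirical (c i) (c j)) c :=
          pairCount_pos h rfl
        omega
      · have : 0 < pairCount (fun u v : Fin n → X => jointEmpirical v u = jointEmpirical (c i) (c j)) c :=
          pairCount_pos h rfl
        omega
  · have h5 : Real.exp (-(n * L')) ≤ Real.exp (-(n * (L' - 5 * η))) := by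
      refine Real.exp_le_exp.mpr ?_
      have : 0 < n * η := by positivity
      linarith
    calc _ ≤ 3 * Real.exp (-(n * (L' - 5 * η))) := by linarith
      _ ≤ Real.exp (n * η) * Real.exp (-(n * (L' - 5 * η))) := by gcongr
      _ ≤ _ := by
          rw [← Real.exp_add]
          refine Real.exp_le_exp.mpr ?_
          have := mul_le_mul_of_nonneg_left hη3 hn'.le
          linarith

end Upper


/-! ### The lower bound on the lower tail -/

section Lower

variable {X Y : Type*} [Fintype X] [Fintype Y] {W : X → Y → ℝ} {g : (X × Y → ℝ) → ℝ} {Q : X → ℝ}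
  {d : (X × X → ℝ) → ℝ} {Δ R : ℝ}

/-- Every joint law is approximated by the joint type of three sequences, two of which have the
prescribed type, without leaving the support of the channel. -/
theorem exists_triple_near (hW : ∀ x, W x ∈ stdSimplex ℝ Y) {J : X × X × Y → ℝ}
    (hJ : ∀ a, 0 ≤ J a) (hP : lawXX' J ∈ couplings Q Q)
    (hsupp : ∀ x y, lawXY J (x, y) ≠ 0 → W x y ≠ 0) {n : ℕ} (hn : 0 < n) {x₀ : Fin n → X}
    (hx₀ : empirical x₀ = Q) :
    ∃ (x x' : Fin n → X) (y : Fin n → Y), empirical x = Q ∧ empirical x' = Q ∧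
      (∀ a, |tripleType x x' y a - J a| ≤
        ((Fintype.card X + 1 : ℝ) + (Fintype.card (X × X × Y) + 1)) / n) ∧
      ∀ i, W (x i) (y i) ≠ 0 := by
  set P := lawXX' J with hPdef
  obtain ⟨x, hx, hxP⟩ := exists_seq_near_coupling hn x₀ x₀ (P := P) (by rwa [hx₀])
  have hJP : ∀ a b y, J (a, b, y) ≤ P (a, b) := fun a b y =>
    Finset.single_le_sum (f := fun y => J (a, b, y)) (fun _ _ => hJ _) (Finset.mem_univ y)
  have hP0 : ∀ p, 0 ≤ P p := fun p => hP.1.1 p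
  -- `V` is the conditional law of Y given (X, X'), replaced by the channel itself where `P`
  -- vanishes. Rounding `P` may create new letter pairs, and this choice keeps their outputs within
  -- the support of the channel.
  set V : X × X × Y → ℝ := fun a =>
    if P (a.1, a.2.1) = 0 then W a.1 a.2.2 else J a / P (a.1, a.2.1) with hV
  have hV0 : ∀ a, 0 ≤ V a := by
    intro a
    simp only [hV]
    split_ifs
    · exact (hW _).1 _
    · exact div_nonneg (hJ _) (hP0 _)
  have hVsum : ∀ a b, ∑ y, V (a, b, y) = 1 := by
    intro a b
    simp only [hV]
    split_ifs with h
    · exact (hW a).2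
    · rw [← Finset.sum_div]
      exact div_self h
  have hV1 : ∀ a, V a ≤ 1 := by
    rintro ⟨a, b, y⟩
    rw [← hVsum a b]
    exact Finset.single_le_sum (f := fun y => V (a, b, y)) (fun _ _ => hV0 _) (Finset.mem_univ y)
  have hJV : ∀ a, J a = P (a.1, a.2.1) * V a := by
    rintro ⟨a, b, y⟩
    simp only [hV]
    split_ifs with h
    · have h1 := hJP a b y
      rw [h] at h1 ⊢
      rw [zero_mul]
      exact le_antisymm h1 (hJ _)
    · field_simp
  set J' : X × X × Y → ℝ := fun a => jointEmpirical x x₀ (a.1, a.2.1) * V a with hJ'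
  have hJ'law : ∀ b, lawXX' J' b = jointEmpirical x x₀ b := by
    rintro ⟨a, b⟩
    simp only [lawXX', hJ']
    rw [← Finset.mul_sum, hVsum, mul_one]
  -- The output is rounded over the fixed pair of sequences, by the rounding that adds no support.
  obtain ⟨w, hw1, hw2⟩ := exists_seq_near_over hn (fun a : X × X × Y => (a.1, a.2.1))
    (fun i => (x i, x₀ i)) J' (fun a => mul_nonneg (empirical_nonneg _ _) (hV0 a))
    (fun b => by
      rw [← show lawXX' J' b = empirical (fun i => (x i, x₀ i)) b from hJ'law b, lawXX'_eq]
      congr!)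
  have hwi : ∀ i, (w i).1 = x i ∧ (w i).2.1 = x₀ i := fun i => Prod.mk.inj (congrFun hw1 i)
  have htriple : tripleType x x₀ (fun i => (w i).2.2) = empirical w := by
    unfold tripleType
    congr 1
    funext i
    rw [← (hwi i).1, ← (hwi i).2]
  refine ⟨x, x₀, fun i => (w i).2.2, hx.trans hx₀, hx₀, fun a => ?_, fun i => ?_⟩
  · rw [htriple, add_div]
    have h1 : |J' a - J a| ≤ (Fintype.card X + 1 : ℝ) / n := by
      rw [hJV a, ← sub_mul, abs_mul, abs_of_nonneg (hV0 a)]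
      exact (mul_le_of_le_one_right (abs_nonneg _) (hV1 a)).trans (hxP _)
    calc _ = |(J' a - J a) + (empirical w a - J' a)| := by
          congr 1
          ring
      _ ≤ _ := (abs_add_le _ _).trans (add_le_add h1 (hw2 a).1)
  · have h := (hw2 (w i)).2 (empirical_apply_pos w i).ne'
    have hVne : V (w i) ≠ 0 := right_ne_zero_of_mul h
    rw [← (hwi i).1]
    by_cases hz : P ((w i).1, (w i).2.1) = 0
    · simpa [hV, hz] using hVne
    · have hJne : J (w i) ≠ 0 := by
        rw [hJV]
        exact mul_ne_zero hz hVne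
      refine hsupp _ _ fun h0 => hJne ?_
      exact (Finset.sum_eq_zero_iff_of_nonneg fun _ _ => hJ _).mp h0 (w i).2.1 (Finset.mem_univ _)

theorem eventually_exists_triple (hW : ∀ x, W x ∈ stdSimplex ℝ Y) {J : X × X × Y → ℝ}
    (hJ : ∀ a, 0 ≤ J a) (hP : lawXX' J ∈ couplings Q Q)
    (hsupp : ∀ x y, lawXY J (x, y) ≠ 0 → W x y ≠ 0) {p : (X × X × Y → ℝ) → Prop}
    (hp : ∀ᶠ J' in 𝓝[stdSimplex ℝ (X × X × Y)] J, p J') :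
    ∀ᶠ n : ℕ in blockLengths Q, ∃ (x x' : Fin n → X) (y : Fin n → Y), empirical x = Q ∧
      empirical x' = Q ∧ p (tripleType x x' y) ∧ ∀ i, W (x i) (y i) ≠ 0 := by
  obtain ⟨r, hr, hball⟩ := Metric.mem_nhdsWithin_iff.mp hp
  have hlim : Tendsto (fun n : ℕ =>
      ((Fintype.card X + 1 : ℝ) + (Fintype.card (X × X × Y) + 1)) / n) atTop (𝓝 0) :=
    tendsto_const_div_atTop_nhds_zero_nat _
  filter_upwards [eventually_blockLengths_nonempty Q, blockLengths_le Q (eventually_gt_atTop 0),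
    blockLengths_le Q (hlim.eventually_lt_const hr)] with n hne hn hlt
  obtain ⟨x₀, hx₀⟩ := hne
  obtain ⟨x, x', y, hx, hx', hnear, hpos⟩ :=
    exists_triple_near hW hJ hP hsupp hn (mem_seqs.mp hx₀)
  refine ⟨x, x', y, hx, hx', hball ⟨?_, empirical_mem_stdSimplex hn _⟩, hpos⟩
  rw [Metric.mem_ball, dist_pi_lt_iff hr]
  exact fun a => (hnear a).trans_lt hlt

/-- Codewords are grouped by their joint type with y. A class of mutual information I has at most
e^{n([R-I]_+ + 3η)} members, each adding e^{ng}; maximizing over types gives β. -/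
theorem decoderSum_le (hg : ContinuousOn g (stdSimplex ℝ (X × Y))) {M n : ℕ} (hn : 0 < n) {η : ℝ}
    {c : Code X M n} (hc : ∀ i, c i ∈ seqs Q n)
    (htypes : ((Finset.univ.image fun x : Fin n → X × Y => empirical x).card : ℝ) ≤
      Real.exp (n * η))
    (hcount : ∀ x ∈ seqs Q n, ∀ y : Fin n → Y, (countIn (shell x y) c : ℝ) ≤
      Real.exp (n * (max (R - mutualInfo (jointEmpirical x y)) 0 + 3 * η))) (y : Fin n → Y) :
    decoderSum g c y ≤ Real.exp (n * (beta g Q R (empirical y) + 4 * η)) := by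
  have hn0 : (0 : ℝ) ≤ n := Nat.cast_nonneg n
  have key := sum_le_card_mul (s := Finset.univ)
    (t := Finset.univ.image fun x : Fin n → X × Y => empirical x)
    (φ := fun k => jointEmpirical (c k) y)
    (f := fun k => Real.exp (n * g (jointEmpirical (c k) y)))
    (V := Real.exp (n * (beta g Q R (empirical y) + 3 * η)))
    (fun k _ => Finset.mem_image.mpr ⟨_, Finset.mem_univ _, rfl⟩) (fun k _ => ?_)
    (Real.exp_pos _).le
  · calc decoderSum g c y ≤ _ := key
      _ ≤ Real.exp (n * η) * Real.exp (n * (beta g Q R (empirical y) + 3 * η)) := by gcongr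
      _ = _ := by
          rw [← Real.exp_add]
          congr 1
          ring
  · have hP : jointEmpirical (c k) y ∈ couplings Q (empirical y) := by
      have := jointEmpirical_mem_couplings hn (c k) y
      rwa [mem_seqs.mp (hc k)] at this
    have hβ := mul_le_mul_of_nonneg_left (le_beta hg (R := R) hP) hn0
    calc _ = countIn (shell (c k) y) c * Real.exp (n * g (jointEmpirical (c k) y)) := by
          rw [countIn_eq_sum, Finset.sum_mul, Finset.sum_filter]
          refine Finset.sum_congr rfl fun l _ => ?_
          simp only [mem_shell]
          split_ifs with h
          · rw [h, one_mul]
          · rw [zero_mul]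
      _ ≤ Real.exp (n * (max (R - mutualInfo (jointEmpirical (c k) y)) 0 + 3 * η)) *
          Real.exp (n * g (jointEmpirical (c k) y)) := by
          gcongr
          exact hcount _ (hc k) y
      _ ≤ _ := by
          rw [← Real.exp_add]
          exact Real.exp_le_exp.mpr (by linarith)

theorem tripleType_comp_perm {n : ℕ} (x x' : Fin n → X) (y : Fin n → Y) (σ : Equiv.Perm (Fin n)) :
    tripleType (x ∘ σ) (x' ∘ σ) (y ∘ σ) = tripleType x x' y :=
  empirical_eq_iff.mpr (occ_comp_perm (fun i => (x i, x' i, y i)) σ)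

theorem jointEmpirical_comp_perm {n : ℕ} (x : Fin n → X) (y : Fin n → Y)
    (σ : Equiv.Perm (Fin n)) : jointEmpirical (x ∘ σ) (y ∘ σ) = jointEmpirical x y :=
  empirical_eq_iff.mpr (occ_comp_perm (fun i => (x i, y i)) σ)

/-- The contribution of a pair of codewords is at least that of any joint type that extends
theirs. -/
theorem le_pairError (hW : ∀ x y, 0 ≤ W x y) {M n : ℕ} {η B : ℝ} {c : Code X M n} {m m' : Fin M}
    {x x' : Fin n → X} {y : Fin n → Y} (hpos : ∀ i, W (x i) (y i) ≠ 0)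
    (hsum : ∀ (x x' : Fin n → X) (y : Fin n → Y), (∀ i, W (x i) (y i) ≠ 0) →
      Real.exp (-(n * (channelExp W (tripleType x x' y) + η))) ≤
      ∑ y' ∈ Finset.univ.filter (fun y' : Fin n → Y => tripleType x x' y' = tripleType x x' y),
        ∏ i, W (x i) (y' i))
    (hden : ∀ y' : Fin n → Y, empirical y' = empirical y → decoderSum g c y' ≤ Real.exp (n * B))
    (hpair : jointEmpirical (c m) (c m') = jointEmpirical x x') :
    Real.exp (-(n * (channelExp W (tripleType x x' y) + B - g (jointEmpirical x' y) + η))) ≤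
      pairError W g c m m' := by
  -- Pairs of the same joint type differ by a permutation of positions, which transports y to an
  -- output with the prescribed triple type.
  obtain ⟨σ, hσ⟩ := exists_perm_of_occ_eq (empirical_eq_iff.mp hpair.symm)
  have h1 : x ∘ σ = c m := funext fun i => (Prod.mk.inj (congrFun hσ i)).1
  have h2 : x' ∘ σ = c m' := funext fun i => (Prod.mk.inj (congrFun hσ i)).2
  have htr : tripleType (c m) (c m') (y ∘ σ) = tripleType x x' y := by
    rw [← h1, ← h2, tripleType_comp_perm]
  have hs := hsum (c m) (c m') (y ∘ σ) (fun i => by rw [← h1]; exact hpos (σ i))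
  rw [htr] at hs
  calc _ = Real.exp (-(n * (channelExp W (tripleType x x' y) + η))) *
        Real.exp (n * (g (jointEmpirical x' y) - B)) := by
        rw [← Real.exp_add]
        congr 1
        ring
    _ ≤ (∑ y' ∈ Finset.univ.filter (fun y' : Fin n → Y =>
          tripleType (c m) (c m') y' = tripleType x x' y), ∏ i, W (c m i) (y' i)) *
        Real.exp (n * (g (jointEmpirical x' y) - B)) := by gcongr
    _ ≤ ∑ y' ∈ Finset.univ.filter (fun y' : Fin n → Y =>
          tripleType (c m) (c m') y' = tripleType x x' y), (∏ i, W (c m i) (y' i)) *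
          (Real.exp (n * g (jointEmpirical (c m') y')) / decoderSum g c y') := by
        rw [Finset.sum_mul]
        refine Finset.sum_le_sum fun y' hy' => mul_le_mul_of_nonneg_left ?_
          (Finset.prod_nonneg fun _ _ => hW _ _)
        have h := (Finset.mem_filter.mp hy').2
        have e1 : jointEmpirical (c m') y' = jointEmpirical x' y := by
          rw [← lawX'Y_tripleType (c m) _ y', h, lawX'Y_tripleType]
        have e2 : empirical y' = empirical y := by
          rw [← lawY_tripleType (c m) (c m') y', h, lawY_tripleType]
        rw [e1, mul_sub, Real.exp_sub]
        have hd : 0 < decoderSum g c y' := (Real.exp_pos _).trans_le (le_decoderSum c y' m)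
        have := hden y' e2
        gcongr
    _ ≤ _ := Finset.sum_le_sum_of_subset_of_nonneg (Finset.subset_univ _) fun y' _ _ =>
        mul_nonneg (Finset.prod_nonneg fun _ _ => hW _ _)
          (div_nonneg (Real.exp_pos _).le (decoderSum_nonneg c y'))

theorem pairCount_mul_le_errorProb (hW : ∀ x y, 0 ≤ W x y) {M n : ℕ} {c : Code X M n}
    {r : (Fin n → X) → (Fin n → X) → Prop} {V : ℝ}
    (h : ∀ m m', r (c m) (c m') → V ≤ pairError W g c m m') :
    1 / (M : ℝ) * (pairCount r c * V) ≤ errorProb W g c := by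
  rw [errorProb_eq]
  refine mul_le_mul_of_nonneg_left ?_ (by positivity)
  unfold pairCount
  rw [← nsmul_eq_mul]
  refine (Finset.card_nsmul_le_sum _ (fun p => pairError W g c p.1 p.2) V fun p hp =>
    h _ _ (Finset.mem_filter.mp hp).2.2).trans ?_
  refine Finset.sum_le_sum_of_subset_of_nonneg (fun p hp => ?_) fun p _ _ => pairError_nonneg hW c _ _
  exact Finset.mem_filter.mpr ⟨Finset.mem_univ _, (Finset.mem_filter.mp hp).2.1.ne⟩

/-- The number of pairs of sequences of a given joint type. -/
theorem le_card_pairs {n : ℕ} {x x' : Fin n → X} (hx : x ∈ seqs Q n) (hx' : x' ∈ seqs Q n) {η : ℝ}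
    (hcard : ∀ x y : Fin n → X,
      Real.exp (-(n * (mutualInfo (jointEmpirical x y) + η))) * (typeOf x).card ≤
        (Finset.univ.filter fun x' : Fin n → X =>
          jointEmpirical x' y = jointEmpirical x y).card) :
    Real.exp (-(n * (mutualInfo (jointEmpirical x x') + η))) * ((seqs Q n).card : ℝ) ^ 2 ≤
      (((seqs Q n) ×ˢ (seqs Q n)).filter fun p =>
        jointEmpirical p.1 p.2 = jointEmpirical x x').card := by
  set T := seqs Q n with hT
  have hrow : ∀ u ∈ T, Real.exp (-(n * (mutualInfo (jointEmpirical x x') + η))) * (T.card : ℝ) ≤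
      ∑ v ∈ T, if jointEmpirical u v = jointEmpirical x x' then (1 : ℝ) else 0 := by
    intro u hu
    -- Permuting x into u carries x' to a partner of u, so no row is empty and each has the size
    -- given by `hcard`.
    obtain ⟨σ, hσ⟩ := exists_perm_of_occ_eq
      (empirical_eq_iff.mp ((mem_seqs.mp hx).trans (mem_seqs.mp hu).symm))
    have hv : x' ∘ σ ∈ T := mem_seqs.mpr
      ((empirical_eq_iff.mpr (occ_comp_perm x' σ)).trans (mem_seqs.mp hx'))
    have huv : jointEmpirical u (x' ∘ σ) = jointEmpirical x x' := by
      rw [← hσ, jointEmpirical_comp_perm]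
    have h := hcard (x' ∘ σ) u
    rw [mutualInfo_jointEmpirical_comm u, huv, ← seqs_eq_typeOf hv] at h
    refine h.trans ?_
    rw [← Finset.sum_filter, Finset.sum_const, nsmul_eq_mul, mul_one]
    refine Nat.cast_le.mpr (Finset.card_le_card fun v hv' => ?_)
    have hv' : jointEmpirical v u = jointEmpirical (x' ∘ σ) u := (Finset.mem_filter.mp hv').2
    refine Finset.mem_filter.mpr ⟨?_, ?_⟩
    · rw [mem_seqs, ← margFst_jointEmpirical v u, hv', margFst_jointEmpirical]
      exact mem_seqs.mp hv
    · rw [← huv]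
      exact (jointEmpirical_swap_eq_iff _ _ _ _).mp hv'
  calc _ = ∑ u ∈ T, Real.exp (-(n * (mutualInfo (jointEmpirical x x') + η))) * (T.card : ℝ) := by
        rw [Finset.sum_const, nsmul_eq_mul]
        ring
    _ ≤ _ := Finset.sum_le_sum hrow
    _ = _ := by
        rw [Finset.card_filter, ← Finset.sum_product']
        push_cast
        rfl

/-- With at least the expected probability a joint type is shared by at least the expected number
of pairs of codewords. -/
theorem exp_le_prob_pairCount {M n : ℕ} {κ η : ℝ}
    (hdsymm : ∀ P ∈ stdSimplex ℝ (X × X), d (fun p => P p.swap) = d P) (hn : 0 < n)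
    (hsp : Sparse (seqs Q n) (farApart d Δ) M κ) (hM : 2 ≤ M)
    (hrate : Real.exp (n * (R - η)) ≤ M) (hη : 0 ≤ η) (hbig : 2560 ≤ Real.exp (n * η))
    (hcard : ∀ x y : Fin n → X,
      Real.exp (-(n * (mutualInfo (jointEmpirical x y) + η))) * (typeOf x).card ≤
        (Finset.univ.filter fun x' : Fin n → X =>
          jointEmpirical x' y = jointEmpirical x y).card ∧
      ((Finset.univ.filter fun x' : Fin n → X =>
          jointEmpirical x' y = jointEmpirical x y).card : ℝ) ≤
        Real.exp (-(n * (mutualInfo (jointEmpirical x y) - η))) * (typeOf x).card)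
    {x x' : Fin n → X} (hx : x ∈ seqs Q n) (hx' : x' ∈ seqs Q n)
    (hd : Δ < d (jointEmpirical x x')) :
    Real.exp (-(n * (max (mutualInfo (jointEmpirical x x') - 2 * R) 0 + 6 * η))) ≤
      prob (M := M) (seqs Q n) (farApart d Δ) (fun c =>
        Real.exp (n * (max (2 * R - mutualInfo (jointEmpirical x x')) 0 - 4 * η)) ≤
          pairCount (fun u v => jointEmpirical u v = jointEmpirical x x') c) := by
  have hn0 : (0 : ℝ) ≤ n := Nat.cast_nonneg n
  set P := jointEmpirical x x' with hP
  set I := mutualInfo P with hI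
  have hsec := fun y => card_section_le (Q := Q) (fun x y => (hcard x y).2) P y
  set q := Real.exp (-(n * (I - η))) with hq
  set q' := Real.exp (-(n * (I + η))) with hq'
  have hq0 : 0 < q := Real.exp_pos _
  have hq'0 : 0 < q' := Real.exp_pos _
  have hqq : q' = q * Real.exp (-(2 * (n * η))) := by
    rw [hq, hq', ← Real.exp_add]
    congr 1
    ring
  have hM2 : Real.exp (n * (2 * R - 2 * η)) ≤ (M : ℝ) ^ 2 := by
    calc _ = Real.exp (n * (R - η)) ^ 2 := by
          rw [pow_two, ← Real.exp_add]
          congr 1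
          ring
      _ ≤ _ := by gcongr
  -- `A` is the expected number of pairs to first order. The Paley-Zygmund ratio behaves like A / (A
  -- + 1), hence like min(1, A), whose exponent is [I - 2R]_+; the gap between `q` and `q'` costs
  -- e^{-4nη}.
  set A := q * (M : ℝ) ^ 2 with hA
  have hA1 : Real.exp (n * (2 * R - I - η)) ≤ A := by
    calc _ = q * Real.exp (n * (2 * R - 2 * η)) := by
          rw [hq, ← Real.exp_add]
          congr 1
          ring
      _ ≤ _ := mul_le_mul_of_nonneg_left hM2 hq0.le
  have hA0 : 0 < A := (Real.exp_pos _).trans_le hA1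
  have key := prob_pairCount_ge_ge hsp hM (r := fun u v => jointEmpirical u v = P) hq0 hq'0
    (fun u _ => by convert (hsec u).2) (fun v _ => by convert (hsec v).1)
    (by convert le_card_pairs hx hx' fun x y => (hcard x y).1) (fun u _ v _ huv => by
      unfold farApart
      have h := hdsymm (jointEmpirical u v) (empirical_mem_stdSimplex hn _)
      rw [jointEmpirical_swap, huv] at h
      rw [h]
      exact hd)
  refine le_trans ?_ (key.trans (prob_mono fun c _ hc => ?_))
  · have hE : (q' * (M : ℝ) ^ 2 / 8) ^ 2 / (4 * (8 * q ^ 2 * (M : ℝ) ^ 4 + 2 * q * (M : ℝ) ^ 2)) =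
        Real.exp (-(4 * (n * η))) * (A / (2048 * A + 512)) := by
      have hexp : Real.exp (-(4 * (n * η))) = Real.exp (-(2 * (n * η))) ^ 2 := by
        rw [pow_two, ← Real.exp_add]
        congr 1
        ring
      rw [hqq, hexp]
      have h1 : q * Real.exp (-(2 * (n * η))) * (M : ℝ) ^ 2 = A * Real.exp (-(2 * (n * η))) := by
        rw [hA]
        ring
      have h2 : 4 * (8 * q ^ 2 * (M : ℝ) ^ 4 + 2 * q * (M : ℝ) ^ 2) = 32 * A ^ 2 + 8 * A := by
        rw [hA]
        ring
      rw [h1, h2]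
      field_simp
      ring
    rw [hE]
    -- 2560 = 2048 + 512 is the value of the denominator at A = 1, which separates the two cases.
    have hmin : Real.exp (-(n * (max (I - 2 * R) 0 + η))) ≤ 2560 * (A / (2048 * A + 512)) := by
      rcases le_total 1 A with h | h
      · have h3 : (1 : ℝ) ≤ 2560 * (A / (2048 * A + 512)) := by
          rw [← mul_div_assoc, le_div_iff₀ (by positivity)]
          linarith
        refine le_trans (Real.exp_le_one_iff.mpr ?_) h3
        have : 0 ≤ n * (max (I - 2 * R) 0 + η) := by positivity
        linarith
      · have h3 : A ≤ 2560 * (A / (2048 * A + 512)) := by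
          rw [← mul_div_assoc, le_div_iff₀ (by positivity)]
          nlinarith
        refine le_trans (le_trans (Real.exp_le_exp.mpr ?_) hA1) h3
        have := mul_le_mul_of_nonneg_left (le_max_left (I - 2 * R) 0) hn0
        linarith
    calc _ = Real.exp (-(4 * (n * η))) * (Real.exp (-(n * η)) *
          Real.exp (-(n * (max (I - 2 * R) 0 + η)))) := by
          rw [← Real.exp_add, ← Real.exp_add]
          congr 1
          ring
      _ ≤ Real.exp (-(4 * (n * η))) * (Real.exp (-(n * η)) *
          (Real.exp (n * η) * (A / (2048 * A + 512)))) := by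
          gcongr
          exact hmin.trans (mul_le_mul_of_nonneg_right hbig (by positivity))
      _ = _ := by
          rw [← mul_assoc (Real.exp (-(n * η))), ← Real.exp_add, neg_add_cancel, Real.exp_zero,
            one_mul]
  · have hcpos : (0 : ℝ) < pairCount (fun u v => jointEmpirical u v = P) c :=
      lt_of_lt_of_le (by have : (0 : ℝ) < M := (Real.exp_pos _).trans_le hrate
                         positivity) hc
    have hη0 : 0 ≤ n * η := by positivity
    -- If I ≥ 2R the threshold is at most 1, and it suffices that the integer count is positive.
    rcases le_total (2 * R - I) 0 with h | h
    · rw [max_eq_right h]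
      refine le_trans (Real.exp_le_one_iff.mpr (by linarith)) ?_
      exact_mod_cast hcpos
    · rw [max_eq_left h]
      refine le_trans ?_ hc
      rw [le_div_iff₀ (by norm_num)]
      calc _ ≤ Real.exp (n * (2 * R - I - 4 * η)) * Real.exp (n * η) := by
            gcongr
            linarith
        _ = q' * Real.exp (n * (2 * R - 2 * η)) := by
            rw [hq', ← Real.exp_add, ← Real.exp_add]
            congr 1
            ring
        _ ≤ _ := by gcongr

/-- An element of `ℳ` comes with a joint law that nearly attains `Λ`. -/
theorem exists_extension_of_mem_setM {E η : ℝ} (hη : 0 < η) {P : X × X → ℝ}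
    (hP : P ∈ setM W g Q d Δ R E) :
    ∃ J ∈ extensions Y P, (∀ x y, lawXY J (x, y) ≠ 0 → W x y ≠ 0) ∧
      channelExp W J + beta g Q R (lawY J) - g (lawX'Y J) <
        max (2 * R - mutualInfo P) 0 - (R - E) + η := by
  obtain ⟨-, -, hLam⟩ := hP
  set D := max (2 * R - mutualInfo P) 0
  have hlt : Lam W g Q P R < ((D - (R - E) + η : ℝ) : EReal) := by
    generalize Lam W g Q P R = l at hLam
    induction l with
    | bot => exact EReal.bot_lt_coe _
    | top =>
      rw [EReal.top_add_coe] at hLam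
      exact absurd hLam (not_le.mpr (EReal.coe_lt_top _))
    | coe l =>
      rw [← EReal.coe_add, EReal.coe_le_coe_iff] at hLam
      exact EReal.coe_lt_coe_iff.mpr (by linarith)
  simp only [Lam, iInf_lt_iff] at hlt
  obtain ⟨J, hJ, hlt⟩ := hlt
  -- A finite value of the objective excludes the infinite divergence, so the near-minimizer
  -- respects the support of the channel.
  have hsupp : ∀ x y, lawXY J (x, y) ≠ 0 → W x y ≠ 0 := by
    intro x y hxy h0
    have : condDiv W (lawXY J) = ⊤ := if_pos ⟨x, y, hxy, h0⟩
    rw [this, EReal.top_add_coe] at hlt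
    exact not_top_lt hlt
  refine ⟨J, hJ, hsupp, ?_⟩
  rw [add_sub_assoc, condDiv_add_condMutualInfo hJ.1.1 hsupp, EReal.coe_lt_coe_iff] at hlt
  linarith

/-- A type in ℳ(R, E) of nearly optimal exponent, extended by a law nearly attaining Λ, is
approximated by triple types. With the probability from `exp_le_prob_pairCount` there are about
e^{n[2R-I]_+} pairs of that type, each contributing roughly e^{-nΛ} once the denominators are
bounded through β. This brings the error probability above e^{-nE₀}. -/
theorem eventually_le_lowerTail (hW : ∀ x, W x ∈ stdSimplex ℝ Y)
    (hg : ContinuousOn g (stdSimplex ℝ (X × Y))) (hd : ContinuousOn d (stdSimplex ℝ (X × X)))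
    (hdsymm : ∀ P ∈ stdSimplex ℝ (X × X), d (fun p => P p.swap) = d P)
    {M : ℕ → ℕ} (hR : 0 < R)
    (hM : Tendsto (fun n => Real.log (M n) / n) (blockLengths Q) (𝓝 R))
    (hkey : ∃ δ > 0, ∀ n, ∀ P ∈ jointTypes Q n, d P ≤ Δ → R ≤ mutualInfo P - 2 * δ)
    {E₀ E L : ℝ} (hE : E < E₀) (hL : Elb W g Q d Δ R E < (L : EReal)) :
    ∀ᶠ n : ℕ in blockLengths Q, Real.exp (-(n * L)) ≤
      prob (M := M n) (seqs Q n) (farApart d Δ) (fun c => errorExponent W g c ≤ E₀) := by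
  have hs := eventually_sparse hdsymm hR hM hkey
  simp only [Elb, iInf_lt_iff] at hL
  obtain ⟨P, hP, hL⟩ := hL
  rw [EReal.coe_lt_coe_iff] at hL
  set η := min ((E₀ - E) / 20) ((L - max (mutualInfo P - 2 * R) 0) / 10) with hηdef
  have hη : 0 < η := by
    have h1 : 0 < E₀ - E := by linarith
    have h2 : 0 < L - max (mutualInfo P - 2 * R) 0 := by linarith
    simp only [hηdef]
    positivity
  have hη1 : 20 * η ≤ E₀ - E := by
    have : η ≤ (E₀ - E) / 20 := min_le_left _ _
    linarith
  have hη2 : 10 * η ≤ L - max (mutualInfo P - 2 * R) 0 := by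
    have : η ≤ (L - max (mutualInfo P - 2 * R) 0) / 10 := min_le_right _ _
    linarith
  obtain ⟨J, ⟨hJ, rfl⟩, hsupp, hJE⟩ := exists_extension_of_mem_setM (Y := Y) hη hP
  set S := stdSimplex ℝ (X × X × Y)
  have hI : Tendsto (fun J' => mutualInfo (lawXX' J')) (𝓝[S] J) (𝓝 (mutualInfo (lawXX' J))) :=
    (continuousOn_mutualInfo.comp continuous_lawXX'.continuousOn
      fun J' hJ' => lawXX'_mem_stdSimplex hJ') J hJ
  have hdt : Tendsto (fun J' => d (lawXX' J')) (𝓝[S] J) (𝓝 (d (lawXX' J))) :=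
    (hd.comp continuous_lawXX'.continuousOn fun J' hJ' => lawXX'_mem_stdSimplex hJ') J hJ
  have hgt : Tendsto (fun J' => g (lawX'Y J')) (𝓝[S] J) (𝓝 (g (lawX'Y J))) :=
    (hg.comp continuous_lawX'Y.continuousOn fun J' hJ' => lawX'Y_mem_stdSimplex hJ') J hJ
  have hCt : Tendsto (channelExp W) (𝓝[S] J) (𝓝 (channelExp W J)) :=
    (continuous_channelExp W).continuousWithinAt
  have hβ : ∀ᶠ J' in 𝓝[S] J, (couplings Q (lawY J')).Nonempty →
      beta g Q R (lawY J') ≤ beta g Q R (lawY J) + η :=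
    continuous_lawY.continuousWithinAt.eventually (beta_upper hg R (lawY J) hη)
  -- Everything needed of the limiting law is an open or semicontinuous condition, so it survives
  -- the approximation. In particular d > Δ is strict, and for β an upper bound suffices.
  have hnear := (((((hdt.eventually_const_lt hP.2.1).and
    (hI.eventually_lt_const (by linarith : mutualInfo (lawXX' J) < mutualInfo (lawXX' J) + η))).and
    (hgt.eventually_const_lt (by linarith : g (lawX'Y J) - η < g (lawX'Y J)))).and
    (hCt.eventually_lt_const (by linarith : channelExp W J < channelExp W J + η))).and hβ)
  have hW0 : ∀ x y, 0 ≤ W x y := fun x y => (hW x).1 y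
  filter_upwards [hs, eventually_rate hR hM hη, blockLengths_le Q (eventually_le_exp 2560 hη),
    blockLengths_le Q (eventually_gt_atTop 0),
    blockLengths_le Q (eventually_types_le (A := X × Y) hη),
    blockLengths_le Q (eventually_card_jointType (A := X) (B := X) hη),
    blockLengths_le Q (eventually_sum_prod_tripleType hW0 hη),
    eventually_exists_triple hW hJ.1 hP.1 hsupp hnear,
    eventually_prob_count_high (Y := Y) hR hM hs hη L]
    with n hsp hrate hbig hn htypes hcard hsum hex hbad
  obtain ⟨κ, hsp⟩ := hsp
  obtain ⟨x, x', y, hx, hx', ⟨⟨⟨⟨hd1, hI1⟩, hg1⟩, hC1⟩, hβ1⟩, hpos⟩ := hex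
  rw [lawXX'_tripleType] at hd1 hI1
  rw [lawX'Y_tripleType] at hg1
  rw [lawY_tripleType] at hβ1
  have hβ1 := hβ1 ⟨_, by
    have := jointEmpirical_mem_couplings hn x y
    rwa [hx] at this⟩
  have hn' : (0 : ℝ) < n := by exact_mod_cast hn
  have hx := mem_seqs.mpr hx
  have hx' := mem_seqs.mpr hx'
  have hprob := exp_le_prob_pairCount hdsymm hn hsp hrate.2.2 hrate.1 hη.le hbig hcard hx hx' hd1
  set I := mutualInfo (jointEmpirical x x')
  set I₀ := mutualInfo (lawXX' J)
  -- The event of many pairs has probability at least 2e^{-nL}, as η is small against the slack in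
  -- L. Discarding the codes with an overfull shell, of probability at most e^{-nL}, leaves e^{-nL}.
  have hsplit := hprob.trans ((prob_mono fun c hc hcount => ?_).trans
    ((prob_or_le (fun c => errorExponent W g c ≤ E₀) _).trans (add_le_add le_rfl hbad)))
  · have h1 : Real.exp (n * η) * Real.exp (-(n * L)) ≤
        Real.exp (-(n * (max (I - 2 * R) 0 + 6 * η))) := by
      rw [← Real.exp_add]
      refine Real.exp_le_exp.mpr ?_
      have h2 : max (I - 2 * R) 0 ≤ max (I₀ - 2 * R) 0 + η :=
        max_le (by linarith [le_max_left (I₀ - 2 * R) 0]) (by linarith [le_max_right (I₀ - 2 * R) 0])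
      have h3 : 0 ≤ n * (L - η - (max (I - 2 * R) 0 + 6 * η)) :=
        mul_nonneg hn'.le (by linarith)
      linarith
    have h2 : 2 * Real.exp (-(n * L)) ≤ Real.exp (n * η) * Real.exp (-(n * L)) := by
      gcongr
      linarith
    linarith
  · rw [or_iff_not_imp_right]
    intro hgood
    push Not at hgood
    have hcT : ∀ i, c i ∈ seqs Q n := fun i => avail_subset c i (hc i)
    have hden := decoderSum_le (R := R) hg hn hcT htypes
      (fun u hu v => (hgood (u, v) (Finset.mem_product.mpr ⟨hu, Finset.mem_univ _⟩)).le)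
    have herr := pairCount_mul_le_errorProb (W := W) (g := g) hW0 (c := c)
      (r := fun u v => jointEmpirical u v = jointEmpirical x x')
      (fun m m' hmm' => le_pairError (g := g) hW0 hpos (fun x x' y hy => (hsum x x' y hy).1)
        (B := beta g Q R (empirical y) + 4 * η) (fun y' hy' => hy' ▸ hden y') hmm')
    refine errorExponent_le hn (le_trans ?_ herr)
    have hM0 : (0 : ℝ) < M n := (Real.exp_pos _).trans_le hrate.1
    have hinv : Real.exp (-(n * (R + η))) ≤ 1 / (M n : ℝ) := by
      rw [Real.exp_neg, ← one_div]
      exact one_div_le_one_div_of_le hM0 hrate.2.1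
    refine le_trans ?_ (mul_le_mul hinv (mul_le_mul_of_nonneg_right hcount (Real.exp_pos _).le)
      (by positivity) (by positivity))
    rw [← Real.exp_add, ← Real.exp_add]
    refine Real.exp_le_exp.mpr ?_
    have h2 : max (2 * R - I₀) 0 ≤ max (2 * R - I) 0 + η :=
      max_le (by linarith [le_max_left (2 * R - I) 0]) (by linarith [le_max_right (2 * R - I) 0])
    have h3 : 0 ≤ n * (E₀ - (R + η) + (max (2 * R - I) 0 - 4 * η) -
        (channelExp W (tripleType x x' y) + (beta g Q R (empirical y) + 4 * η) -
          g (jointEmpirical x' y) + η)) := mul_nonneg hn'.le (by linarith)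
    linarith

end Lower

-- Removing the shift where the exponent is one-sidedly continuous, and conclusion

theorem ExpLE.of_continuousWithinAt {l : Filter ℕ} {a : ℕ → ℝ≥0∞} {F : ℝ → EReal} {E₀ : ℝ}
    (h : ∀ E > E₀, ExpLE l a (F E)) (hF : ContinuousWithinAt F (Set.Ici E₀) E₀) :
    ExpLE l a (F E₀) := by
  have hF' : Tendsto (fun E => -F E) (𝓝[>] E₀) (𝓝 (-F E₀)) :=
    (continuous_neg.tendsto _).comp (hF.mono Set.Ioi_subset_Ici_self)
  exact ge_of_tendsto hF' (eventually_mem_nhdsWithin.mono h)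

theorem ExpGE.of_continuousWithinAt {l : Filter ℕ} {a : ℕ → ℝ≥0∞} {F : ℝ → EReal} {E₀ : ℝ}
    (h : ∀ E < E₀, ExpGE l a (F E)) (hF : ContinuousWithinAt F (Set.Iic E₀) E₀) :
    ExpGE l a (F E₀) := by
  have hF' : Tendsto (fun E => -F E) (𝓝[<] E₀) (𝓝 (-F E₀)) :=
    (continuous_neg.tendsto _).comp (hF.mono Set.Iio_subset_Iic_self)
  exact le_of_tendsto hF' (eventually_mem_nhdsWithin.mono h)

end RGV
end

theorem mainTheorem4 {X Y : Type*} [Fintype X] [Fintype Y]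
    -- a discrete memoryless channel
    (W : X → Y → ℝ) (hW : ∀ x, W x ∈ stdSimplex ℝ Y)
    -- a continuous decoding metric
    (g : (X × Y → ℝ) → ℝ) (hg : ContinuousOn g (stdSimplex ℝ (X × Y)))
    -- a continuous symmetric type-dependent distance function, and a minimum distance
    (d : (X × X → ℝ) → ℝ) (hd : ContinuousOn d (stdSimplex ℝ (X × X)))
    (hdsymm : ∀ P ∈ stdSimplex ℝ (X × X), d (fun p => P p.swap) = d P) (Δ : ℝ)
    -- a composition, which is a type of some block length
    (Q : X → ℝ) (hQ : Q ∈ stdSimplex ℝ X) (hQtype : ∃ n, (RGV.typeClass Q n).Nonempty)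
    -- a positive rate, and numbers of codewords of that rate
    (R : ℝ) (hR : 0 < R) (M : ℕ → ℕ)
    (hM : Tendsto (fun n => Real.log (M n) / n) (RGV.blockLengths Q) (𝓝 R))
    -- the rate condition
    (hkey : ∃ δ > 0, ∀ n, ∀ P ∈ RGV.jointTypes Q n, d P ≤ Δ → R ≤ RGV.mutualInfo P - 2 * δ)
    (E₀ : ℝ) :
    -- upper bound, at every `E₀` up to an arbitrarily small shift, and without the shift
    -- wherever the exponent is right-continuous
    ((∀ E > E₀, RGV.ExpLE (RGV.blockLengths Q)
        (fun n => RGV.lowerTail W g Q d Δ E₀ (M n) n) (RGV.Eub W g Q d Δ R E)) ∧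
      (ContinuousWithinAt (RGV.Eub W g Q d Δ R) (Set.Ici E₀) E₀ →
        RGV.ExpLE (RGV.blockLengths Q)
          (fun n => RGV.lowerTail W g Q d Δ E₀ (M n) n) (RGV.Eub W g Q d Δ R E₀))) ∧
    -- lower bound, at every `E₀` up to an arbitrarily small shift, and without the shift
    -- wherever the exponent is left-continuous
    ((∀ E < E₀, RGV.ExpGE (RGV.blockLengths Q)
        (fun n => RGV.lowerTail W g Q d Δ E₀ (M n) n) (RGV.Elb W g Q d Δ R E)) ∧
      (ContinuousWithinAt (RGV.Elb W g Q d Δ R) (Set.Iic E₀) E₀ →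
        RGV.ExpGE (RGV.blockLengths Q)
          (fun n => RGV.lowerTail W g Q d Δ E₀ (M n) n) (RGV.Elb W g Q d Δ R E₀))) := by
  have hupper : ∀ E > E₀, RGV.ExpLE (RGV.blockLengths Q)
      (fun n => RGV.lowerTail W g Q d Δ E₀ (M n) n) (RGV.Eub W g Q d Δ R E) := by
    intro E hE
    simp only [RGV.lowerTail_eq]
    exact RGV.expLE_of_eventually (RGV.blockLengths_le Q) fun L hL =>
      RGV.eventually_lowerTail_le hW hg hdsymm hR hM hkey hE hL
  have hlower : ∀ E < E₀, RGV.ExpGE (RGV.blockLengths Q)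
      (fun n => RGV.lowerTail W g Q d Δ E₀ (M n) n) (RGV.Elb W g Q d Δ R E) := by
    intro E hE
    simp only [RGV.lowerTail_eq]
    exact RGV.expGE_of_eventually (RGV.blockLengths_le Q) fun L hL =>
      RGV.eventually_le_lowerTail hW hg hd hdsymm hR hM hkey hE hL
  exact ⟨⟨hupper, RGV.ExpLE.of_continuousWithinAt hupper⟩,
    ⟨hlower, RGV.ExpGE.of_continuousWithinAt hlower⟩⟩
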